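/- **Notation.** Let $\kappa\le\lambda$ be cardinals. For a cardinal $\mu$ and a set $X$ let $P_\mu X=\{y\subseteq X:|y|<\mu\}$. For $x\in P_\kappa\lambda$ (a set of ordinals) let $\kappa_x=|x\cap\kappa|$. "Inaccessible" means strongly inaccessible. *Strong stationarity and 1-clubs.* Let $(\mu,X)$ be $(\kappa,\lambda)$, or $(\kappa_x,x)$ with $x\in P_\kappa\lambda$. For $f:P_\mu X\to P_\mu X$ let $$C_f=\{y\in P_\mu X:\ y\cap\kappa\neq\emptyset\ \text{ and }\ f[P_{\kappa_y}y]\subseteq P_{\kappa_y}y\}.$$ A set $S\subseteq P_\mu X$ is in $\mathrm{NSS}_{\mu,X}$ if $S\cap C_f=\emptyset$ for some $f:P_\mu X\to P_\mu X$, and in $\mathrm{NSS}_{\mu,X}^+$ otherwise. A set $C\subseteq P_\kappa\lambda$ is *1-club* if $C\in\mathrm{NSS}_{\kappa,\lambda}^+$ and, for every $x\in P_\kappa\lambda$ such that $\kappa_x$ is inaccessible and $C\cap P_{\kappa_x}x\in\mathrm{NSS}_{\kappa_x,x}^+$, we have $x\in C$. *Indescribability.* For a cardinal $\mu$ and a set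 of ordinals $A$ put $V_0(\mu,A)=A$, $V_{\alpha+1}(\mu,A)=P_\mu(V_\alpha(\mu,A))\cup V_\alpha(\mu,A)$, and $V_\alpha(\mu,A)=\bigcup_{\beta<\alpha}V_\beta(\mu,A)$ for limit $\alpha$. A $\Pi^1_1$-sentence has the form $\forall X_1\cdots\forall X_n\,\psi$, with $\psi$ first-order in $\in$, a unary predicate $R$ and the unary set variables $X_1,\dots,X_n$, which range over all subsets of the domain. A set $W\subseteq P_\kappa\lambda$ is *$\Pi^1_1$-indescribable* (Baumgartner) if for every $R\subseteq V_\kappa(\kappa,\lambda)$ and every $\Pi^1_1$-sentence $\varphi$ with $(V_\kappa(\kappa,\lambda),\in,R)\models\varphi$ there is $x\in W$ such that $x\cap\kappa=\kappa_x$ and $(V_{\kappa_x}(\kappa_x,x),\in,R\cap V_{\kappa_x}(\kappa_x,x))\models\varphi$. *Weak compactness.* Let $\mathrm{ZFC}^-$ be $\mathrm{ZFC}$ without the power set axiom, with the Collection scheme and with Choice in the form "every set can be well-ordered". A set $W\subseteq P_\kappa\lambda$ is *weakly compact* if for every $A\subseteq\lambda$ there are a transitive set $M\models\mathrm{ZFC}^-$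 with $\lambda,A,W\in M$, a transitive set $N$ and an elementary embedding $j:M\to N$ with critical point $\kappa$ such that $j(\kappa)>\lambda$ and $j''\lambda\in j(W)$, where $j''\lambda=\{j(\alpha):\alpha<\lambda\}$. **Theorem 1.3.** Let $\kappa\le\lambda$ be cardinals with $\lambda^{<\kappa}=\lambda$, suppose that $P_\kappa\lambda$ is weakly compact (as a subset of itself), and let $W\subseteq P_\kappa\lambda$. The following are equivalent: 1. $W$ is $\Pi^1_1$-indescribable. 2. $W$ is weakly compact. 3. $C\cap W\neq\emptyset$ for every 1-club $C\subseteq P_\kappa\lambda$. -/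

import Mathlib

/-! The universe `V` of set theory is Mathlib's `ZFSet.{u}`; its cardinals and ordinals are
`Cardinal.{u}` and `Ordinal.{u}`. A cardinal `κ` is regarded as a set through its initial von
Neumann ordinal `κ.ord.toZFSet`. -/

universe u

open FirstOrder Cardinal

namespace TwoCardinal

/-! ### `P_κ X`, `κ_x`, strong stationarity and 1-clubs -/

/-- The cardinal `κ` as a von Neumann ordinal. -/
noncomputable abbrev cset (κ : Cardinal.{u}) : ZFSet.{u} := κ.ord.toZFSet

/-- `P_κ X`, the set of all subsets of `X` of cardinality less than `κ`. -/
noncomputable def Pk (κ : Cardinal.{u}) (X : ZFSet.{u}) : ZFSet.{u} :=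
  ZFSet.sep (fun y => y.card < κ) X.powerset

theorem mem_Pk {κ : Cardinal.{u}} {X y : ZFSet.{u}} : y ∈ Pk κ X ↔ y ⊆ X ∧ y.card < κ := by
  simp [Pk]

/-- `κ_x = |x ∩ κ|`. -/
noncomputable def kap (κ : Cardinal.{u}) (x : ZFSet.{u}) : Cardinal.{u} :=
  (x ∩ cset κ).card

/-- For a function `f : P_μ X → P_μ X`, the set of closure points
`C_f = {y ∈ P_μ X : y ∩ κ ≠ ∅ ∧ f[P_{κ_y} y] ⊆ P_{κ_y} y}`.
The cases of interest are `(μ, X) = (κ, λ)` and `(μ, X) = (κ_x, x)` for `x ∈ P_κ λ`. -/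
noncomputable def closurePts (κ μ : Cardinal.{u}) (X : ZFSet.{u}) (f : ZFSet.{u} → ZFSet.{u}) :
    ZFSet.{u} :=
  ZFSet.sep (fun y => y ∩ cset κ ≠ ∅ ∧ ∀ z ∈ Pk (kap κ y) y, f z ∈ Pk (kap κ y) y) (Pk μ X)

/-- `S` belongs to `NSS⁺_{μ,X}`: it meets `C_f` for every `f : P_μ X → P_μ X`. -/
def StronglyStationary (κ μ : Cardinal.{u}) (X S : ZFSet.{u}) : Prop :=
  ∀ f : ZFSet.{u} → ZFSet.{u}, (∀ z ∈ Pk μ X, f z ∈ Pk μ X) →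
    ∃ y ∈ S, y ∈ closurePts κ μ X f

/-- `C` is 1-closed: for every `x ∈ P_κ λ` with `κ_x` inaccessible and
`C ∩ P_{κ_x} x ∈ NSS⁺_{κ_x,x}` we have `x ∈ C`. -/
def OneClosed (κ lam : Cardinal.{u}) (C : ZFSet.{u}) : Prop :=
  ∀ x ∈ Pk κ (cset lam), (kap κ x).IsInaccessible →
    StronglyStationary κ (kap κ x) x (C ∩ Pk (kap κ x) x) → x ∈ C

/-- `C ⊆ P_κ λ` is 1-club: it is in `NSS⁺_{κ,λ}` and 1-closed. -/
def OneClub (κ lam : Cardinal.{u}) (C : ZFSet.{u}) : Prop :=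
  C ⊆ Pk κ (cset lam) ∧ StronglyStationary κ κ (cset lam) C ∧ OneClosed κ lam C

/-! ### First-order structures `(D, ∈, …)` -/

/-- Relation symbols: the binary `∈`, and one unary predicate symbol for each `p : P`. -/
inductive SetRel (P : Type) : ℕ → Type
  | mem : SetRel P 2
  | pred (p : P) : SetRel P 1

/-- The language of set theory with additional unary predicate symbols indexed by `P`. -/
def langP (P : Type) : FirstOrder.Language.{0, 0} := ⟨fun _ => Empty, SetRel P⟩

/-- The language `{∈}` of set theory. -/
abbrev langSet : FirstOrder.Language.{0, 0} := langP Empty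

/-- The structure `(D, ∈, (I p)_p)` on the set `D`. -/
@[reducible] def memStructure (D : ZFSet.{u}) {P : Type} (I : P → Set D) :
    (langP P).Structure D where
  funMap := fun g _ => Empty.elim g
  RelMap := fun r => match r with
    | SetRel.mem => fun v => (v 0 : ZFSet.{u}) ∈ (v 1 : ZFSet.{u})
    | SetRel.pred p => fun v => v 0 ∈ I p

/-- Every set `M` is a structure `(M, ∈)` for the language of set theory. -/
instance (M : ZFSet.{u}) : langSet.Structure M := memStructure M (fun p : Empty => p.elim)

/-! ### Π¹₁-indescribability -/

/-- `V_α(κ, A)`: `V_0 = A`, `V_{α+1} = P_κ(V_α) ∪ V_α`, and unions at limits. -/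
noncomputable def hier (κ : Cardinal.{u}) (A : ZFSet.{u}) (α : Ordinal.{u}) : ZFSet.{u} :=
  Ordinal.limitRecOn α A (fun _ V => Pk κ V ∪ V)
    (fun β _ ih => ZFSet.iUnion (fun γ : Set.Iio β => ih γ.1 γ.2))

theorem hier_zero (κ : Cardinal.{u}) (A : ZFSet.{u}) : hier κ A 0 = A := by
  simp [hier]

theorem hier_add_one (κ : Cardinal.{u}) (A : ZFSet.{u}) (α : Ordinal.{u}) :
    hier κ A (α + 1) = Pk κ (hier κ A α) ∪ hier κ A α := by
  simp [hier]

theorem hier_limit (κ : Cardinal.{u}) (A : ZFSet.{u}) {β : Ordinal.{u}}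
    (hβ : Order.IsSuccLimit β) :
    hier κ A β = ZFSet.iUnion (fun γ : Set.Iio β => hier κ A γ.1) := by
  simp [hier, Ordinal.limitRecOn_limit _ _ _ _ hβ]

/-- `V_κ(κ, A)`. -/
noncomputable def bigV (κ : Cardinal.{u}) (A : ZFSet.{u}) : ZFSet.{u} := hier κ A κ.ord

/-- A Π¹₁-sentence `∀ X₁ … ∀ Xₙ ψ`, where `ψ` is a first-order sentence in `∈`, a predicate symbol
for `R` (the index `none`) and predicate symbols for the set variables `X₁, …, Xₙ`. -/
structure PiOneOne where
  n : ℕ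
  matrix : (langP (Option (Fin n))).Sentence

/-- `(D, ∈, R) ⊨ φ` for a Π¹₁-sentence `φ`; the set variables range over all subsets of `D`. -/
def PiOneOne.Holds (φ : PiOneOne) (D R : ZFSet.{u}) : Prop :=
  ∀ X : Fin φ.n → Set D,
    @FirstOrder.Language.Sentence.Realize _ D
      (memStructure D (fun p => p.elim {d : D | (d : ZFSet.{u}) ∈ R} X)) φ.matrix

/-- `S ⊆ P_κ λ` is Π¹₁-indescribable in the sense of Baumgartner. -/
def PiOneOneIndescribable (κ lam : Cardinal.{u}) (S : ZFSet.{u}) : Prop :=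
  ∀ R ⊆ bigV κ (cset lam), ∀ φ : PiOneOne, φ.Holds (bigV κ (cset lam)) R →
    ∃ x ∈ S, x ∩ cset κ = cset (kap κ x) ∧
      φ.Holds (bigV (kap κ x) x) (R ∩ bigV (kap κ x) x)

/-! ### Weak compactness through elementary embeddings -/

/-- `(M, ∈) ⊨ ZFC⁻` for a transitive set `M`: all axioms of ZFC except the power set axiom, with
the Collection scheme (which together with Separation gives Replacement) and with Choice in the
form that every set can be well-ordered. Ordered pairs are absolute for transitive models of
Pairing, so the well-ordering axiom is stated with the ordered pairs of `V`. -/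
structure ModelsZFCMinus (M : ZFSet.{u}) : Prop where
  extensionality : ∀ a b : M, (∀ z : M, (z : ZFSet.{u}) ∈ (a : ZFSet.{u}) ↔
    (z : ZFSet.{u}) ∈ (b : ZFSet.{u})) → a = b
  foundation : ∀ a : M, (∃ z : M, (z : ZFSet.{u}) ∈ (a : ZFSet.{u})) →
    ∃ z : M, (z : ZFSet.{u}) ∈ (a : ZFSet.{u}) ∧
      ∀ w : M, (w : ZFSet.{u}) ∈ (a : ZFSet.{u}) → (w : ZFSet.{u}) ∉ (z : ZFSet.{u})
  pairing : ∀ a b : M, ∃ c : M, ∀ z : M, (z : ZFSet.{u}) ∈ (c : ZFSet.{u}) ↔ z = a ∨ z = b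
  union : ∀ a : M, ∃ c : M, ∀ z : M, (z : ZFSet.{u}) ∈ (c : ZFSet.{u}) ↔
    ∃ y : M, (y : ZFSet.{u}) ∈ (a : ZFSet.{u}) ∧ (z : ZFSet.{u}) ∈ (y : ZFSet.{u})
  infinity : ∃ w ∈ M, ∅ ∈ w ∧ ∀ y ∈ w, insert y y ∈ w
  separation : ∀ (n : ℕ) (φ : langSet.Formula (Fin (n + 1))) (p : Fin n → M) (a : M),
    ∃ b : M, ∀ x : M, (x : ZFSet.{u}) ∈ (b : ZFSet.{u}) ↔
      (x : ZFSet.{u}) ∈ (a : ZFSet.{u}) ∧ φ.Realize (Fin.cons x p)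
  collection : ∀ (n : ℕ) (φ : langSet.Formula (Fin (n + 2))) (p : Fin n → M) (a : M),
    (∀ x : M, (x : ZFSet.{u}) ∈ (a : ZFSet.{u}) →
      ∃ y : M, φ.Realize (Fin.cons x (Fin.cons y p))) →
    ∃ b : M, ∀ x : M, (x : ZFSet.{u}) ∈ (a : ZFSet.{u}) →
      ∃ y : M, (y : ZFSet.{u}) ∈ (b : ZFSet.{u}) ∧ φ.Realize (Fin.cons x (Fin.cons y p))
  wellOrdering : ∀ a ∈ M, ∃ r ∈ M,
    (∀ x ∈ a, ZFSet.pair x x ∉ r) ∧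
    (∀ x ∈ a, ∀ y ∈ a, ∀ z ∈ a, ZFSet.pair x y ∈ r → ZFSet.pair y z ∈ r → ZFSet.pair x z ∈ r) ∧
    (∀ x ∈ a, ∀ y ∈ a, x = y ∨ ZFSet.pair x y ∈ r ∨ ZFSet.pair y x ∈ r) ∧
    (∀ b ∈ M, b ⊆ a → b ≠ ∅ → ∃ m ∈ b, ∀ y ∈ b, ZFSet.pair y m ∉ r)

/-- The ordinal `κ ∈ M` is the critical point of `j`: the least ordinal moved by `j`. -/
def IsCriticalPoint {M N : ZFSet.{u}} (j : M ↪ₑ[langSet] N) (κ : M) : Prop :=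
  (κ : ZFSet.{u}).IsOrdinal ∧
    (∀ α : M, (α : ZFSet.{u}) ∈ (κ : ZFSet.{u}) → (j α : ZFSet.{u}) = α) ∧
    (j κ : ZFSet.{u}) ≠ κ

/-- `W ⊆ P_κ λ` is weakly compact: for every `A ⊆ λ` there are a transitive `M ⊨ ZFC⁻` with
`λ, A, W ∈ M`, a transitive `N` and an elementary embedding `j : M → N` with critical point `κ`
such that `j(κ) > λ` and `j"λ ∈ j(W)`. (As `M` is transitive and `κ ≤ λ ∈ M`, also `κ ∈ M`.) -/
def WeaklyCompact (κ lam : Cardinal.{u}) (W : ZFSet.{u}) : Prop :=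
  ∀ A ⊆ cset lam, ∃ M N : ZFSet.{u},
    M.IsTransitive ∧ ModelsZFCMinus M ∧ N.IsTransitive ∧ cset lam ∈ M ∧ A ∈ M ∧
    ∃ (hκ : cset κ ∈ M) (hW : W ∈ M) (j : M ↪ₑ[langSet] N),
      IsCriticalPoint j ⟨cset κ, hκ⟩ ∧
      cset lam ∈ (j ⟨cset κ, hκ⟩ : ZFSet.{u}) ∧
      ∃ s ∈ (j ⟨W, hW⟩ : ZFSet.{u}),
        ∀ z, z ∈ s ↔ ∃ α : M, (α : ZFSet.{u}) ∈ cset lam ∧ (j α : ZFSet.{u}) = z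

end TwoCardinal

open TwoCardinal

/-! ### Cardinalities of sets and of initial ordinals. -/

namespace TwoCardinal

/-! All three conditions are equivalent to one combinatorial compactness principle, `Threadable`:
whenever g i x ∈ x for all i ∈ x ∈ W, a single function f agrees, on every z ∈ P_κ λ, with i ↦ g i x
for some x ∈ W containing z.

The strength of threads lies in `Threadable.exists_filter`. Given at most λ functions on P_κ λ,
index them by λ and thread them simultaneously. The sets of x ∈ W that agree with the thread on a
small z generate a proper fine κ-complete filter U containing W, and each given function that is
regressive on a U-positive set is constant on a set in U. For λ many questions such a U behaves like
a normal ultrafilter. Since λ^{<κ} = λ, that covers all of P_κ λ, all of V_κ(κ, λ), and all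
parameters from a model of size λ. The predicate `Ev` collects the functions needed before U is
chosen.

From threads to the three conditions. For a 1-club C missing W, almost every x carries a function
witnessing that C ∩ P_{κ_x} x is not strongly stationary; freezing its values gives a function on
P_κ λ with no closure point in C. For indescribability, counterexamples to a Π¹₁-sentence at the
members of W are frozen to a counterexample in V_κ(κ, λ), by a Łoś argument in which choices of
witnesses are regressive through an injection of V_κ(κ, λ) into λ. For weak compactness, take a
transitive elementary submodel M of H(λ⁺) of size at most λ and form the ultrapower by functions
coded in M; the identity represents j''λ, and x ↦ otp(x ∩ β) represents β for β ≤ λ.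

From the conditions back to threads. Were g threadless, the x at which g has no local thread would
form a 1-club disjoint from W (`threadable_of_inter_nonempty`); its stationarity uses threads on P_κ
λ itself. Being a thread is a propositional theory in variables "f(i) = η" with clauses of size less
than κ, and "every valuation violates a clause" is a Π¹₁-sentence that fails at each x ∈ W
(`Threadable.of_indescribable`). Finally, if j''λ ∈ j(W), then j(g) evaluated at j''λ is a thread
for g (`Threadable.of_weaklyCompact`); a single A ⊆ λ codes all the data needed in M.

Weak compactness of P_κ λ yields threads on P_κ λ, and these make κ inaccessible
(`Threadable.isInaccessible`), which every other step needs. -/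

theorem card_le_iff {X : ZFSet.{u}} {lam : Cardinal.{u}} :
    X.card ≤ lam ↔ #(X : Set ZFSet.{u}) ≤ lift.{u + 1} lam := by
  have : #(X : Set ZFSet.{u}) = lift.{u + 1, u} X.card := ZFSet.cardinalMk_coe_sort
  rw [this, lift_le]

theorem card_lt_iff {X : ZFSet.{u}} {lam : Cardinal.{u}} :
    X.card < lam ↔ #(X : Set ZFSet.{u}) < lift.{u + 1} lam := by
  have : #(X : Set ZFSet.{u}) = lift.{u + 1, u} X.card := ZFSet.cardinalMk_coe_sort
  rw [this, lift_lt]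

theorem card_cset (κ : Cardinal.{u}) : (cset κ).card = κ := by
  simp [cset]

theorem mk_cset (κ : Cardinal.{u}) : #(cset κ : Set ZFSet.{u}) = lift.{u + 1} κ := by
  have : #(cset κ : Set ZFSet.{u}) = lift.{u + 1, u} (cset κ).card := ZFSet.cardinalMk_coe_sort
  rw [this, card_cset]

theorem mem_cset {κ : Cardinal.{u}} {a : ZFSet.{u}} :
    a ∈ cset κ ↔ ∃ o < κ.ord, o.toZFSet = a := Ordinal.mem_toZFSet_iff

theorem isOrdinal_cset (κ : Cardinal.{u}) : (cset κ).IsOrdinal := ZFSet.isOrdinal_toZFSet _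

theorem isOrdinal_of_mem_cset {κ : Cardinal.{u}} {a : ZFSet.{u}} (h : a ∈ cset κ) :
    a.IsOrdinal := (isOrdinal_cset κ).mem h

theorem card_lt_of_mem_cset {κ : Cardinal.{u}} {a : ZFSet.{u}} (h : a ∈ cset κ) :
    a.card < κ := by
  obtain ⟨o, ho, rfl⟩ := mem_cset.1 h
  rw [Ordinal.card_toZFSet]
  exact lt_ord.1 ho

theorem mem_cset_of_isOrdinal {κ : Cardinal.{u}} {a : ZFSet.{u}} (h : a.IsOrdinal)
    (hc : a.card < κ) : a ∈ cset κ := by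
  obtain ⟨o, rfl⟩ := ZFSet.isOrdinal_iff_mem_range_toZFSet.1 h
  rw [Ordinal.card_toZFSet] at hc
  exact mem_cset.2 ⟨o, lt_ord.2 hc, rfl⟩

theorem cset_mem_cset {μ κ : Cardinal.{u}} : cset μ ∈ cset κ ↔ μ < κ := by
  simp [cset]

theorem cset_subset_cset {μ κ : Cardinal.{u}} : cset μ ⊆ cset κ ↔ μ ≤ κ := by
  simp [cset]

theorem subset_cset_of_mem {κ : Cardinal.{u}} {a : ZFSet.{u}} (h : a ∈ cset κ) :
    a ⊆ cset κ := (isOrdinal_cset κ).subset_of_mem h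

/-! ### Enumerations, codes and cardinal arithmetic of unions. -/

theorem exists_enum {α : Type (u + 1)} {lam : Cardinal.{u}} {s : Set α}
    (hs : #s ≤ lift.{u + 1} lam) (hne : s.Nonempty) :
    ∃ e : ZFSet.{u} → α, (∀ i, e i ∈ s) ∧ ∀ a ∈ s, ∃ i ∈ cset lam, e i = a := by
  classical
  rw [← mk_cset] at hs
  obtain ⟨g⟩ := hs
  obtain ⟨a₀, ha₀⟩ := hne
  have : Nonempty s := ⟨⟨a₀, ha₀⟩⟩
  refine ⟨fun i => if h : i ∈ cset lam then (Function.invFun g ⟨i, h⟩ : s) else a₀, ?_, ?_⟩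
  · intro i
    dsimp only
    split_ifs
    · exact Subtype.property _
    · exact ha₀
  · intro a ha
    refine ⟨(g ⟨a, ha⟩).1, (g ⟨a, ha⟩).2, ?_⟩
    have h2 : ((g ⟨a, ha⟩).1 : ZFSet) ∈ cset lam := (g ⟨a, ha⟩).2
    have : Function.invFun g ⟨(g ⟨a, ha⟩).1, h2⟩ = ⟨a, ha⟩ :=
      Function.leftInverse_invFun g.injective ⟨a, ha⟩
    simp only [h2, dif_pos, this]

theorem exists_code {α : Type (u + 1)} {lam : Cardinal.{u}} {s : Set α}
    (hs : #s ≤ lift.{u + 1} lam) :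
    ∃ c : α → ZFSet.{u}, Set.InjOn c s ∧ ∀ a ∈ s, c a ∈ cset lam := by
  classical
  rw [← mk_cset] at hs
  obtain ⟨g⟩ := hs
  refine ⟨fun a => if h : a ∈ s then (g ⟨a, h⟩).1 else ∅, ?_, ?_⟩
  · intro a ha b hb hab
    simp only [ha, hb, dif_pos] at hab
    have := g.injective (Subtype.ext hab)
    simpa using this
  · intro a ha
    simp only [ha, dif_pos]
    exact (g ⟨a, ha⟩).2

/-- A subset of `V` of small cardinality is a set. -/
theorem exists_zfset {lam : Cardinal.{u}} {s : Set ZFSet.{u}} (hs : #s ≤ lift.{u + 1} lam) :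
    ∃ z : ZFSet.{u}, (∀ a, a ∈ z ↔ a ∈ s) ∧ z.card ≤ lam := by
  have hsm : Small.{u} s := by
    rw [small_iff_lift_mk_lt_univ]
    refine lt_of_le_of_lt (lift_le.2 hs) ?_
    simpa using lift_lt_univ lam
  refine ⟨ZFSet.range (fun a : s => a.1), ?_, ?_⟩
  · intro a; simp
  · rw [card_le_iff]
    refine le_trans (le_of_eq ?_) hs
    congr 2
    ext a; simp

/-- The image of a set under a function. -/
noncomputable def img (f : ZFSet.{u} → ZFSet.{u}) (s : ZFSet.{u}) : ZFSet.{u} :=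
  ZFSet.range (fun i : s => f i)

theorem mem_img {f : ZFSet.{u} → ZFSet.{u}} {s a : ZFSet.{u}} :
    a ∈ img f s ↔ ∃ i ∈ s, f i = a := by
  simp [img]

theorem mem_img_of_mem {f : ZFSet.{u} → ZFSet.{u}} {s i : ZFSet.{u}} (h : i ∈ s) :
    f i ∈ img f s := mem_img.2 ⟨i, h, rfl⟩

theorem card_img_le (f : ZFSet.{u} → ZFSet.{u}) (s : ZFSet.{u}) : (img f s).card ≤ s.card := by
  rw [card_le_iff]
  have : ((img f s : ZFSet) : Set ZFSet.{u}) = f '' (s : Set ZFSet.{u}) := by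
    ext a; simp [mem_img]
  rw [this]
  exact mk_image_le.trans (card_le_iff.1 le_rfl)

/-- A fixed enumeration of each set `s` by its cardinality. -/
theorem exists_enumeration : ∃ e : ZFSet.{u} → ZFSet.{u} → ZFSet.{u},
    ∀ s a, a ∈ s ↔ ∃ k ∈ cset s.card, e s k = a := by
  have : ∀ s : ZFSet.{u}, ∃ e : ZFSet.{u} → ZFSet.{u},
      ∀ a, a ∈ s ↔ ∃ k ∈ cset s.card, e k = a := by
    intro s
    rcases ZFSet.eq_empty_or_nonempty s with rfl | hne
    · refine ⟨id, fun a => ?_⟩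
      simp [cset]
    · obtain ⟨e, h1, h2⟩ := exists_enum (card_le_iff.1 (le_refl s.card)) hne
      exact ⟨e, fun a => ⟨h2 a, by rintro ⟨k, -, rfl⟩; exact h1 k⟩⟩
  choose e he using this
  exact ⟨e, he⟩

/-- `enum s k` for `k < |s|` runs through the elements of `s`. -/
noncomputable def enum : ZFSet.{u} → ZFSet.{u} → ZFSet.{u} := exists_enumeration.choose

theorem mem_iff_enum {s a : ZFSet.{u}} : a ∈ s ↔ ∃ k ∈ cset s.card, enum s k = a :=
  exists_enumeration.choose_spec s a

/-- The union `⋃_{i ∈ I} f i`. -/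
noncomputable def bUnion (I : ZFSet.{u}) (f : ZFSet.{u} → ZFSet.{u}) : ZFSet.{u} :=
  ZFSet.iUnion (fun i : I => f i)

theorem mem_bUnion {I a : ZFSet.{u}} {f : ZFSet.{u} → ZFSet.{u}} :
    a ∈ bUnion I f ↔ ∃ i ∈ I, a ∈ f i := by
  simp [bUnion]

theorem card_bUnion_le_sum (I : ZFSet.{u}) (f : ZFSet.{u} → ZFSet.{u}) :
    (bUnion I f).card ≤ sum fun i : Shrink.{u} I => (f ((equivShrink I).symm i)).card := by
  have h : bUnion I f = ZFSet.iUnion (fun i : Shrink.{u} I => f ((equivShrink I).symm i)) := by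
    ext a
    rw [mem_bUnion, ZFSet.mem_iUnion]
    constructor
    · rintro ⟨i, hi, ha⟩
      exact ⟨equivShrink I ⟨i, hi⟩, by simpa using ha⟩
    · rintro ⟨i, hi⟩
      exact ⟨_, ((equivShrink I).symm i).2, hi⟩
  rw [h]
  have := ZFSet.lift_card_iUnion_le_sum_card
    (f := fun i : Shrink.{u} I => f ((equivShrink I).symm i))
  simpa using this

theorem card_bUnion_lt {κ : Cardinal.{u}} (hκ : κ.IsRegular) {I : ZFSet.{u}}
    {f : ZFSet.{u} → ZFSet.{u}} (hI : I.card < κ) (hf : ∀ i ∈ I, (f i).card < κ) :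
    (bUnion I f).card < κ :=
  (card_bUnion_le_sum I f).trans_lt
    (sum_lt_of_isRegular hκ hI fun i => hf _ ((equivShrink I).symm i).2)

theorem card_bUnion_le {lam : Cardinal.{u}} (hl : ℵ₀ ≤ lam) {I : ZFSet.{u}}
    {f : ZFSet.{u} → ZFSet.{u}} (hI : I.card ≤ lam) (hf : ∀ i ∈ I, (f i).card ≤ lam) :
    (bUnion I f).card ≤ lam := by
  refine (card_bUnion_le_sum I f).trans ?_
  refine (sum_le_sum _ (fun _ => lam) fun i => hf _ ((equivShrink I).symm i).2).trans ?_
  rw [sum_const']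
  exact (mul_le_mul_left hI _).trans (mul_eq_self hl).le

theorem card_union_lt {κ : Cardinal.{u}} (hκ : ℵ₀ ≤ κ) {a b : ZFSet.{u}} (ha : a.card < κ)
    (hb : b.card < κ) : (a ∪ b).card < κ :=
  ZFSet.card_union_le.trans_lt (add_lt_of_lt hκ ha hb)

theorem card_insert_lt {κ : Cardinal.{u}} (hκ : ℵ₀ ≤ κ) {a b : ZFSet.{u}} (hb : b.card < κ) :
    (insert a b).card < κ :=
  ZFSet.card_insert_le.trans_lt (add_lt_of_lt hκ hb (one_lt_aleph0.trans_le hκ))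

theorem card_pair_le (a b : ZFSet.{u}) : ({a, b} : ZFSet).card ≤ 2 := by
  refine ZFSet.card_insert_le.trans ?_
  rw [ZFSet.card_singleton, one_add_one_eq_two]

theorem empty_mem_cset {κ : Cardinal.{u}} (hκ : κ ≠ 0) : ∅ ∈ cset κ :=
  mem_cset_of_isOrdinal ZFSet.isOrdinal_empty (by simpa using pos_iff_ne_zero.2 hκ)

theorem insert_mem_cset {κ : Cardinal.{u}} (hκ : ℵ₀ ≤ κ) {a : ZFSet.{u}} (ha : a ∈ cset κ) :
    insert a a ∈ cset κ :=
  mem_cset_of_isOrdinal (ZFSet.isOrdinal_succ (isOrdinal_of_mem_cset ha))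
    (card_insert_lt hκ (card_lt_of_mem_cset ha))

theorem singleton_empty_mem_cset {κ : Cardinal.{u}} (hκ : ℵ₀ ≤ κ) : {∅} ∈ cset κ := by
  have := insert_mem_cset hκ (empty_mem_cset (aleph0_pos.trans_le hκ).ne')
  simpa using this

theorem card_Pk_le {κ lam : Cardinal.{u}} (hle : κ ≤ lam) (hl : ℵ₀ ≤ lam)
    (hpow : lam ^< κ ≤ lam) {X : ZFSet.{u}} (hX : X.card ≤ lam) : (Pk κ X).card ≤ lam := by
  -- every member of `Pk κ X` is the range of a function from some `cset μ`, `μ < κ`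
  let I : ZFSet.{u} := ZFSet.sep (fun a => ∃ μ : Cardinal.{u}, a = cset μ) (cset κ)
  let f : ZFSet.{u} → ZFSet.{u} := fun m => ZFSet.sep (fun y => y.card = m.card) X.powerset
  have hsub : Pk κ X ⊆ bUnion I f := by
    intro y hy
    rw [mem_Pk] at hy
    refine mem_bUnion.2 ⟨cset y.card, ?_, ?_⟩
    · exact ZFSet.mem_sep.2 ⟨cset_mem_cset.2 hy.2, _, rfl⟩
    · refine ZFSet.mem_sep.2 ⟨ZFSet.mem_powerset.2 hy.1, (card_cset _).symm⟩
  refine (ZFSet.card_mono hsub).trans (card_bUnion_le hl ?_ ?_)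
  · refine (ZFSet.card_mono ZFSet.sep_subset).trans ?_
    rwa [card_cset]
  · intro i hi
    obtain ⟨hi1, μ, rfl⟩ := ZFSet.mem_sep.1 hi
    have hμ : μ < κ := cset_mem_cset.1 hi1
    refine le_trans ?_ ((le_powerlt lam hμ).trans hpow)
    rw [card_le_iff]
    let g : (f (cset μ) : Set ZFSet.{u}) → {t : Set (X : Set ZFSet.{u}) // #t ≤ lift.{u + 1} μ} :=
      fun y => ⟨{a | a.1 ∈ y.1}, by
        have h2 := (ZFSet.mem_sep.1 y.2).2
        rw [card_cset] at h2
        refine le_trans ?_ (card_le_iff.1 h2.le)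
        exact mk_le_of_injective (f := fun a => ⟨a.1.1, a.2⟩)
          (fun a b hab => Subtype.ext (Subtype.ext (by simpa using hab)))⟩
    have hg : Function.Injective g := by
      intro y y' hyy
      have h1 := ZFSet.mem_powerset.1 (ZFSet.mem_sep.1 y.2).1
      have h1' := ZFSet.mem_powerset.1 (ZFSet.mem_sep.1 y'.2).1
      have h2 : ∀ a : (X : Set ZFSet.{u}), a.1 ∈ y.1 ↔ a.1 ∈ y'.1 := by
        intro a
        have := congrArg (fun t => a ∈ t.1) hyy
        simpa [g] using this
      apply Subtype.ext
      ext a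
      exact ⟨fun ha => (h2 ⟨a, h1 ha⟩).1 ha, fun ha => (h2 ⟨a, h1' ha⟩).2 ha⟩
    refine (mk_le_of_injective hg).trans ((mk_bounded_set_le _ _).trans ?_)
    rw [lift_power]
    refine power_le_power_right (max_le (card_le_iff.1 hX) ?_)
    rw [← lift_aleph0.{u + 1, u}]
    exact lift_le.2 hl

open Filter

/-- This is the form in which regularity gets verified, both for κ and for κ_x, where only subsets
of x ∩ κ are under control. -/
theorem le_cof_ord_of_bounded {c : Cardinal.{u}}
    (h : ∀ S ⊆ cset c, S.card < c → ∃ ζ ∈ cset c, ∀ ξ ∈ S, ξ ∈ ζ) : c ≤ c.ord.cof := by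
  by_contra hlt
  rw [not_le] at hlt
  obtain ⟨S, hS, hSc⟩ := Order.exists_cof_eq (Set.Iio c.ord)
  rw [Ordinal.cof_Iio, ← Ordinal.lift_cof] at hSc
  let T : Set ZFSet.{u} := (fun o : Set.Iio c.ord => o.1.toZFSet) '' S
  have hT : #T ≤ lift.{u + 1} c.ord.cof := by
    rw [← hSc]; exact mk_image_le
  obtain ⟨z, hz, hzc⟩ := exists_zfset hT
  obtain ⟨ζ, hζ, hb⟩ := h z (by
    intro a ha
    obtain ⟨o, -, rfl⟩ := (hz a).1 ha
    exact mem_cset.2 ⟨o.1, o.2, rfl⟩) (hzc.trans_lt hlt)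
  obtain ⟨o, ho, rfl⟩ := mem_cset.1 hζ
  obtain ⟨s, hs, hos⟩ := hS ⟨o, ho⟩
  have := hb s.1.toZFSet ((hz _).2 ⟨s, hs, rfl⟩)
  rw [Ordinal.toZFSet_mem_toZFSet_iff] at this
  exact absurd hos (not_le.2 this)

theorem exists_bound {κ : Cardinal.{u}} (hκ : κ.IsRegular) {S : ZFSet.{u}} (hS : S ⊆ cset κ)
    (hc : S.card < κ) : ∃ ζ ∈ cset κ, ∀ ξ ∈ S, ξ ∈ ζ := by
  have hord : (bUnion S id).IsOrdinal := by
    rw [ZFSet.isOrdinal_iff_forall_mem_isOrdinal]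
    refine ⟨?_, ?_⟩
    · intro a ha b hb
      obtain ⟨i, hi, ha⟩ := mem_bUnion.1 ha
      exact mem_bUnion.2 ⟨i, hi, (isOrdinal_of_mem_cset (hS hi)).mem_trans hb ha⟩
    · intro a ha
      obtain ⟨i, hi, ha⟩ := mem_bUnion.1 ha
      exact (isOrdinal_of_mem_cset (hS hi)).mem ha
  have hmem : bUnion S id ∈ cset κ := mem_cset_of_isOrdinal hord
    (card_bUnion_lt hκ hc fun i hi => card_lt_of_mem_cset (hS hi))
  refine ⟨_, insert_mem_cset hκ.1 hmem, fun ξ hξ => ?_⟩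
  have : ξ ⊆ bUnion S id := fun a ha => mem_bUnion.2 ⟨ξ, hξ, ha⟩
  rw [ZFSet.mem_insert_iff]
  exact ((isOrdinal_of_mem_cset (hS hξ)).subset_iff_eq_or_mem hord).1 this

/-! ### Fine κ-complete filters that decide λ many functions. -/

/-- `U` is a proper fine `κ`-complete filter on `P_κ λ`. -/
structure Base (κ lam : Cardinal.{u}) (U : Filter ZFSet.{u}) : Prop where
  neBot : U.NeBot
  pk : ∀ᶠ x in U, x ∈ Pk κ (cset lam)
  fine : ∀ ξ ∈ cset lam, ∀ᶠ x in U, ξ ∈ x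
  complete : ∀ I : ZFSet.{u}, I.card < κ → ∀ P : ZFSet.{u} → ZFSet.{u} → Prop,
    (∀ i ∈ I, ∀ᶠ x in U, P i x) → ∀ᶠ x in U, ∀ i ∈ I, P i x

/-- `G` is constant on a set in `U`, unless it fails to be regressive on a set in `U`. -/
def Decides (U : Filter ZFSet.{u}) (G : ZFSet.{u} → ZFSet.{u}) : Prop :=
  (∃ᶠ x in U, G x ∈ x) → ∃ η, ∀ᶠ x in U, G x = η

/-- `P` holds of all fine `κ`-complete filters deciding a suitable family of at most `λ`
functions. -/
def Ev (κ lam : Cardinal.{u}) (P : Filter ZFSet.{u} → Prop) : Prop :=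
  ∃ F : Set (ZFSet.{u} → ZFSet.{u}), #F ≤ lift.{u + 1} lam ∧
    ∀ U, Base κ lam U → (∀ G ∈ F, Decides U G) → P U

section Ev

variable {κ lam : Cardinal.{u}}

theorem Ev.mono {P Q : Filter ZFSet.{u} → Prop} (h : Ev κ lam P)
    (hPQ : ∀ U, Base κ lam U → P U → Q U) : Ev κ lam Q := by
  obtain ⟨F, hF, h⟩ := h
  exact ⟨F, hF, fun U hU hd => hPQ U hU (h U hU hd)⟩

theorem Ev.of_base {P : Filter ZFSet.{u} → Prop} (h : ∀ U, Base κ lam U → P U) : Ev κ lam P :=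
  ⟨∅, by simp, fun U hU _ => h U hU⟩

theorem Ev.and (hl : ℵ₀ ≤ lam) {P Q : Filter ZFSet.{u} → Prop} (hP : Ev κ lam P)
    (hQ : Ev κ lam Q) : Ev κ lam (fun U => P U ∧ Q U) := by
  obtain ⟨F, hF, h⟩ := hP
  obtain ⟨F', hF', h'⟩ := hQ
  refine ⟨F ∪ F', ?_, fun U hU hd => ⟨h U hU fun G hG => hd G (Or.inl hG),
    h' U hU fun G hG => hd G (Or.inr hG)⟩⟩
  refine (mk_union_le _ _).trans ((add_le_add hF hF').trans ?_)
  rw [← lift_add, Cardinal.lift_le]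
  exact (add_eq_self hl).le

/-- Since λ · λ = λ, up to λ many requirements can be met by one filter. Requirements are
accumulated first and the filter is chosen only afterwards. -/
theorem Ev.forall (hl : ℵ₀ ≤ lam) {α : Type (u + 1)} {s : Set α} (hs : #s ≤ lift.{u + 1} lam)
    {P : α → Filter ZFSet.{u} → Prop} (hP : ∀ a ∈ s, Ev κ lam (P a)) :
    Ev κ lam (fun U => ∀ a ∈ s, P a U) := by
  choose! F hF h using hP
  refine ⟨⋃ a : s, F a, ?_, fun U hU hd a ha => h a ha U hU fun G hG =>
    hd G (Set.mem_iUnion.2 ⟨⟨a, ha⟩, hG⟩)⟩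
  refine (mk_iUnion_le_sum_mk).trans ((sum_le_sum _ (fun _ : s => Cardinal.lift.{u + 1} lam)
    fun a => hF a.1 a.2).trans ?_)
  rw [sum_const']
  refine (mul_le_mul_left hs _).trans ?_
  rw [← lift_mul, Cardinal.lift_le]
  exact (mul_eq_self hl).le

theorem Ev.decides (hl : ℵ₀ ≤ lam) (G : ZFSet.{u} → ZFSet.{u}) :
    Ev κ lam (fun U => Decides U G) := by
  refine ⟨{G}, ?_, fun U _ hd => hd G rfl⟩
  rw [mk_singleton]
  exact one_le_aleph0.trans (by rwa [aleph0_le_lift])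

/-- Frequently regressive choices may be taken constant. -/
theorem Ev.regressive (hl : ℵ₀ ≤ lam) (Q : ZFSet.{u} → ZFSet.{u} → Prop) :
    Ev κ lam (fun U => (∃ᶠ x in U, ∃ ξ ∈ x, Q x ξ) →
      ∃ η ∈ cset lam, ∃ᶠ x in U, Q x η) := by
  classical
  refine (Ev.decides hl fun x => if h : ∃ ξ ∈ x, Q x ξ then h.choose else x).mono ?_
  intro U hU hd hf
  obtain ⟨η, hη⟩ := hd (hf.mono fun x hx => by
    simp only [hx, dif_pos]; exact hx.choose_spec.1)
  have h2 := (hf.and_eventually (hη.and hU.pk))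
  have h3 : ∀ x, (∃ ξ ∈ x, Q x ξ) ∧ (dite (∃ ξ ∈ x, Q x ξ) (fun h => h.choose) fun _ => x) = η ∧
      x ∈ Pk κ (cset lam) → η ∈ cset lam ∧ Q x η := by
    rintro x ⟨h, h', h''⟩
    simp only [h, dif_pos] at h'
    rw [← h']
    exact ⟨(mem_Pk.1 h'').1 h.choose_spec.1, h.choose_spec.2⟩
  obtain ⟨x, hx⟩ := h2.exists
  exact ⟨η, (h3 x hx).1, h2.mono fun x hx => (h3 x hx).2⟩

/-- The sets ∅ and {∅} belong to almost every x by fineness, so a characteristic function with these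
two values is regressive, and its constant value settles Q. -/
theorem Ev.decide (hl : ℵ₀ ≤ lam) (Q : ZFSet.{u} → Prop) :
    Ev κ lam (fun U => (∀ᶠ x in U, Q x) ∨ ∀ᶠ x in U, ¬ Q x) := by
  classical
  refine (Ev.decides hl fun x => if Q x then ∅ else {∅}).mono ?_
  intro U hU hd
  have := hU.neBot
  have h0 := hU.fine ∅ (empty_mem_cset (aleph0_pos.trans_le hl).ne')
  have h1 := hU.fine {∅} (singleton_empty_mem_cset hl)
  obtain ⟨η, hη⟩ := hd (Eventually.frequently (by
    filter_upwards [h0, h1] with x h0 h1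
    split_ifs <;> assumption))
  have hne : (∅ : ZFSet.{u}) ≠ {∅} := by
    intro h
    have := ZFSet.mem_singleton.2 (rfl : (∅ : ZFSet.{u}) = ∅)
    rw [← h] at this
    exact ZFSet.notMem_empty _ this
  by_cases hη0 : η = ∅
  · left
    filter_upwards [hη] with x hx
    by_contra hQ
    rw [if_neg hQ, hη0] at hx
    exact hne hx.symm
  · right
    filter_upwards [hη] with x hx hQ
    rw [if_pos hQ] at hx
    exact hη0 hx.symm

theorem Base.subset {U : Filter ZFSet.{u}} (hU : Base κ lam U) {s : ZFSet.{u}}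
    (hs : s ∈ Pk κ (cset lam)) : ∀ᶠ x in U, s ⊆ x := by
  have hs := mem_Pk.1 hs
  exact hU.complete s hs.2 (fun i x => i ∈ x) fun i hi => hU.fine i (hs.1 hi)

/-- The condition that |S x| is a member of x makes x ↦ |S x| regressive, hence constant with some
value μ < κ. Then each of the μ coordinates of the enumeration of S x is regressive, hence constant,
and κ-completeness combines them. -/
theorem Ev.const_subset (hle : κ ≤ lam) (hl : ℵ₀ ≤ lam) (S : ZFSet.{u} → ZFSet.{u}) :
    Ev κ lam (fun U => (∃ᶠ x in U, S x ⊆ x ∧ cset (S x).card ∈ x) →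
      ∃ s ∈ Pk κ (cset lam), ∀ᶠ x in U, S x = s) := by
  have hκ : #(cset κ : Set ZFSet.{u}) ≤ lift.{u + 1} lam := by
    rw [mk_cset, Cardinal.lift_le]; exact hle
  refine ((Ev.decides hl fun x => cset (S x).card).and hl
    (Ev.forall hl hκ fun k _ => Ev.decides hl fun x => enum (S x) k)).mono ?_
  rintro U hU ⟨h1, h2⟩ hf
  obtain ⟨m, hm⟩ := h1 (hf.mono fun x hx => hx.2)
  have hf2 := (hf.and_eventually (hm.and hU.pk))
  obtain ⟨x₀, ⟨hx1, hx2⟩, hx3, hx4⟩ := hf2.exists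
  have hμ : (S x₀).card < κ := (ZFSet.card_mono hx1).trans_lt (mem_Pk.1 hx4).2
  set μ := (S x₀).card with hμdef
  have hm' : ∀ᶠ x in U, (S x).card = μ := by
    filter_upwards [hm] with x hx
    rw [← hx3] at hx
    have := congrArg ZFSet.card hx
    rwa [card_cset, card_cset] at this
  have h3 : ∀ k ∈ cset μ, ∃ η, ∀ᶠ x in U, enum (S x) k = η := by
    intro k hk
    refine h2 k ?_ ((hf.and_eventually hm').mono ?_)
    · exact cset_subset_cset.2 hμ.le hk
    · rintro x ⟨⟨hx, -⟩, hx'⟩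
      exact hx (mem_iff_enum.2 ⟨k, by rw [hx']; exact hk, rfl⟩)
  choose! η hη using h3
  have h4 := hU.complete (cset μ) (by rwa [card_cset]) (fun k x => enum (S x) k = η k) hη
  have h5 : ∀ᶠ x in U, S x = img η (cset μ) := by
    filter_upwards [h4, hm'] with x hx hx'
    ext a
    rw [mem_iff_enum, mem_img, hx']
    constructor
    · rintro ⟨k, hk, rfl⟩; exact ⟨k, hk, (hx k hk).symm⟩
    · rintro ⟨k, hk, rfl⟩; exact ⟨k, hk, hx k hk⟩
  refine ⟨_, ?_, h5⟩
  obtain ⟨x, ⟨hx, -⟩, hx', hx''⟩ := (hf.and_eventually (h5.and hU.pk)).exists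
  rw [← hx', mem_Pk]
  exact ⟨hx.trans (mem_Pk.1 hx'').1, (ZFSet.card_mono hx).trans_lt (mem_Pk.1 hx'').2⟩

/-- Frequently chosen small subsets may be taken constant. -/
theorem Ev.regressive_subset (hle : κ ≤ lam) (hl : ℵ₀ ≤ lam)
    (Q : ZFSet.{u} → ZFSet.{u} → Prop) :
    Ev κ lam (fun U => (∃ᶠ x in U, ∃ s ⊆ x, cset s.card ∈ x ∧ Q x s) →
      ∃ s ∈ Pk κ (cset lam), ∃ᶠ x in U, Q x s) := by
  classical
  refine (Ev.const_subset hle hl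
    fun x => if h : ∃ s ⊆ x, cset s.card ∈ x ∧ Q x s then h.choose else x).mono ?_
  intro U hU hd hf
  obtain ⟨s, hs, hs'⟩ := hd (hf.mono fun x hx => by
    simp only [hx, dif_pos]; exact ⟨hx.choose_spec.1, hx.choose_spec.2.1⟩)
  refine ⟨s, hs, (hf.and_eventually hs').mono ?_⟩
  rintro x ⟨hx, hx'⟩
  simp only [hx, dif_pos] at hx'
  rw [← hx']
  exact hx.choose_spec.2.2

/-! ### Almost every x reflects the inaccessibility of κ. -/

theorem pk_mem_of_cset (hle : κ ≤ lam) {s : ZFSet.{u}} (hs : s ⊆ cset κ) (hc : s.card < κ) :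
    s ∈ Pk κ (cset lam) :=
  mem_Pk.2 ⟨hs.trans (cset_subset_cset.2 hle), hc⟩

theorem exists_mem_cset_notMem {s : ZFSet.{u}} (hc : s.card < κ) : ∃ ξ ∈ cset κ, ξ ∉ s := by
  by_contra h
  push Not at h
  have : cset κ ⊆ s := fun ξ hξ => h ξ hξ
  have := ZFSet.card_mono this
  rw [card_cset] at this
  exact absurd hc (not_lt.2 this)

/-- For a transitive `x ∩ κ` whose cardinality is not a member, `x ∩ κ = κ_x`. -/
theorem inter_cset_eq {x : ZFSet.{u}} (htr : ∀ ξ ∈ x ∩ cset κ, ξ ⊆ x)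
    (hc : cset (x ∩ cset κ).card ∉ x ∩ cset κ) : x ∩ cset κ = cset (kap κ x) := by
  have hord : (x ∩ cset κ).IsOrdinal := by
    rw [ZFSet.isOrdinal_iff_forall_mem_isOrdinal]
    refine ⟨fun ξ hξ ζ hζ => ?_, fun ξ hξ => isOrdinal_of_mem_cset (ZFSet.mem_inter.1 hξ).2⟩
    exact ZFSet.mem_inter.2 ⟨htr ξ hξ hζ, subset_cset_of_mem (ZFSet.mem_inter.1 hξ).2 hζ⟩
  have h1 : x ∩ cset κ ⊆ cset (kap κ x) :=
    (ZFSet.IsOrdinal.notMem_iff_subset (isOrdinal_cset _) hord).1 hc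
  rcases (hord.subset_iff_eq_or_mem (isOrdinal_cset _)).1 h1 with h | h
  · exact h
  · exact absurd (card_lt_of_mem_cset h) (lt_irrefl _)

/-- Each way for x ∩ κ to fail to be an inaccessible cardinal equal to κ_x has a witness that is an
element of x or a subset of x with cardinality in x. A witness occurring U-positively often can be
frozen, and then fineness, with the inaccessibility of κ, refutes it. -/
theorem Ev.inaccessible (hle : κ ≤ lam) (hκ : κ.IsInaccessible) :
    Ev κ lam (fun U => ∀ᶠ x in U, x ∩ cset κ = cset (kap κ x) ∧ (kap κ x).IsInaccessible) := by
  have hl : ℵ₀ ≤ lam := hκ.aleph0_lt.le.trans hle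
  have hsub : cset κ ⊆ cset lam := cset_subset_cset.2 hle
  refine ((Ev.regressive hl fun x ξ => ξ ∈ cset κ ∧ ¬ ξ ⊆ x).and hl
    ((Ev.regressive_subset hle hl fun x s => s = x ∩ cset κ).and hl
    ((Ev.regressive_subset hle hl fun x S => S ⊆ x ∩ cset κ ∧ ¬ ∃ ζ ∈ x ∩ cset κ,
      ∀ ξ ∈ S, ξ ∈ ζ).and hl
    (Ev.regressive hl fun x ξ => ξ ∈ cset κ ∧ cset (2 ^ ξ.card) ∉ x)))).mono ?_
  rintro U hU ⟨h1, h2, h3, h4⟩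
  have e1 : ∀ᶠ x in U, ∀ ξ ∈ x ∩ cset κ, ξ ⊆ x := by
    by_contra hcon
    rw [not_eventually] at hcon
    obtain ⟨η, -, hη⟩ := h1 (hcon.mono fun x hx => by
      push Not at hx
      obtain ⟨ξ, hξ, h⟩ := hx
      rw [ZFSet.mem_inter] at hξ
      exact ⟨ξ, hξ.1, hξ.2, h⟩)
    have hηκ := hη.exists.choose_spec.1
    have := hU.subset (pk_mem_of_cset hle (subset_cset_of_mem hηκ) (card_lt_of_mem_cset hηκ))
    obtain ⟨x, hx, hx'⟩ := (hη.and_eventually this).exists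
    exact hx.2 hx'
  -- If |x ∩ κ| were a member of x, then x ∩ κ could be frozen to one set s of size less than κ;
  -- fineness puts into x an ordinal below κ outside s.
  have e2 : ∀ᶠ x in U, cset (x ∩ cset κ).card ∉ x ∩ cset κ := by
    by_contra hcon
    rw [not_eventually] at hcon
    obtain ⟨s, hs, hs'⟩ := h2 (hcon.mono fun x hx => by
      rw [not_not, ZFSet.mem_inter] at hx
      exact ⟨_, fun a ha => (ZFSet.mem_inter.1 ha).1, hx.1, rfl⟩)
    obtain ⟨ξ, hξ, hξs⟩ := exists_mem_cset_notMem (mem_Pk.1 hs).2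
    obtain ⟨x, hx, hx'⟩ := (hs'.and_eventually (hU.fine ξ (hsub hξ))).exists
    rw [hx] at hξs
    exact hξs (ZFSet.mem_inter.2 ⟨hx', hξ⟩)
  have e3 : ∀ᶠ x in U, ∀ S ⊆ x ∩ cset κ, cset S.card ∈ x →
      ∃ ζ ∈ x ∩ cset κ, ∀ ξ ∈ S, ξ ∈ ζ := by
    by_contra hcon
    rw [not_eventually] at hcon
    obtain ⟨s, hs, hs'⟩ := h3 (hcon.mono fun x hx => by
      push Not at hx
      obtain ⟨S, hS, hS', h⟩ := hx
      refine ⟨S, fun a ha => (ZFSet.mem_inter.1 (hS ha)).1, hS', hS, ?_⟩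
      push Not
      exact h)
    obtain ⟨x, hx⟩ := hs'.exists
    obtain ⟨ζ, hζ, hb⟩ := exists_bound hκ.isRegular
      (fun a ha => (ZFSet.mem_inter.1 (hx.1 ha)).2) (mem_Pk.1 hs).2
    obtain ⟨x, hx, hx'⟩ := (hs'.and_eventually (hU.fine ζ (hsub hζ))).exists
    exact hx.2 ⟨ζ, ZFSet.mem_inter.2 ⟨hx', hζ⟩, hb⟩
  have e4 : ∀ᶠ x in U, ∀ ξ ∈ x ∩ cset κ, cset (2 ^ ξ.card) ∈ x := by
    by_contra hcon
    rw [not_eventually] at hcon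
    obtain ⟨η, -, hη⟩ := h4 (hcon.mono fun x hx => by
      push Not at hx
      obtain ⟨ξ, hξ, h⟩ := hx
      rw [ZFSet.mem_inter] at hξ
      exact ⟨ξ, hξ.1, hξ.2, h⟩)
    have hηκ := hη.exists.choose_spec.1
    have := hU.fine _ (hsub (cset_mem_cset.2
      (hκ.isStrongLimit.isStrongPrelimit (card_lt_of_mem_cset hηκ))))
    obtain ⟨x, hx, hx'⟩ := (hη.and_eventually this).exists
    exact hx.2 hx'
  have e5 := hU.fine _ (hsub (cset_mem_cset.2 hκ.aleph0_lt))
  filter_upwards [e1, e2, e3, e4, e5] with x h1 h2 h3 h4 h5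
  have heq := inter_cset_eq h1 h2
  have hmem : ∀ μ, cset μ ∈ x ∩ cset κ ↔ μ < kap κ x := fun μ => by
    rw [heq, cset_mem_cset]
  refine ⟨heq, ⟨(hmem _).1 (ZFSet.mem_inter.2 ⟨h5, cset_mem_cset.2 hκ.aleph0_lt⟩), ?_, ?_⟩⟩
  · refine le_cof_ord_of_bounded fun S hS hSc => ?_
    rw [← heq] at hS ⊢
    exact h3 S hS (ZFSet.mem_inter.1 ((hmem _).2 hSc)).1
  · refine fun μ hμ => (hmem _).1 ?_
    have := (hmem μ).2 hμ
    have h6 := h4 _ this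
    rw [card_cset] at h6
    exact ZFSet.mem_inter.2 ⟨h6, cset_mem_cset.2
      (hκ.isStrongLimit.isStrongPrelimit (cset_mem_cset.1 (ZFSet.mem_inter.1 this).2))⟩

theorem cset_card_mem_of_lt_kap {x : ZFSet.{u}} (hx : x ∩ cset κ = cset (kap κ x))
    {μ : Cardinal.{u}} (h : μ < kap κ x) : cset μ ∈ x := by
  have := cset_mem_cset.2 h
  rw [← hx] at this
  exact (ZFSet.mem_inter.1 this).1

/-- Once x ∩ κ = κ_x, every cardinal below κ_x belongs to x, so the side condition of
`Ev.const_subset` holds for all members of P_{κ_x} x. -/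
theorem Ev.const_Pk (hle : κ ≤ lam) (hκ : κ.IsInaccessible) (S : ZFSet.{u} → ZFSet.{u}) :
    Ev κ lam (fun U => (∃ᶠ x in U, S x ∈ Pk (kap κ x) x) →
      ∃ s ∈ Pk κ (cset lam), ∀ᶠ x in U, S x = s) := by
  have hl : ℵ₀ ≤ lam := hκ.aleph0_lt.le.trans hle
  refine ((Ev.inaccessible hle hκ).and hl (Ev.const_subset hle hl S)).mono ?_
  rintro U hU ⟨h1, h2⟩ hf
  refine h2 ((hf.and_eventually h1).mono ?_)
  rintro x ⟨hx, hx', -⟩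
  rw [mem_Pk] at hx
  exact ⟨hx.1, cset_card_mem_of_lt_kap hx' hx.2⟩

theorem Ev.regressive_Pk (hle : κ ≤ lam) (hκ : κ.IsInaccessible)
    (Q : ZFSet.{u} → ZFSet.{u} → Prop) :
    Ev κ lam (fun U => (∃ᶠ x in U, ∃ s ∈ Pk (kap κ x) x, Q x s) →
      ∃ s ∈ Pk κ (cset lam), ∃ᶠ x in U, Q x s) := by
  have hl : ℵ₀ ≤ lam := hκ.aleph0_lt.le.trans hle
  refine ((Ev.inaccessible hle hκ).and hl (Ev.regressive_subset hle hl Q)).mono ?_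
  rintro U hU ⟨h1, h2⟩ hf
  refine h2 ((hf.and_eventually h1).mono ?_)
  rintro x ⟨⟨s, hx, hQ⟩, hx', -⟩
  rw [mem_Pk] at hx
  exact ⟨s, hx.1, cset_card_mem_of_lt_kap hx' hx.2, hQ⟩

theorem Ev.fine_Pk (hle : κ ≤ lam) (hκ : κ.IsInaccessible) :
    Ev κ lam (fun U => ∀ s ∈ Pk κ (cset lam), ∀ᶠ x in U, s ∈ Pk (kap κ x) x) := by
  refine (Ev.inaccessible hle hκ).mono ?_
  rintro U hU h s hs
  have hc := (mem_Pk.1 hs).2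
  filter_upwards [h, hU.subset hs, hU.fine (cset s.card) (cset_subset_cset.2 hle
    (cset_mem_cset.2 hc))] with x hx hsx hcx
  refine mem_Pk.2 ⟨hsx, ?_⟩
  rw [← cset_mem_cset, ← hx.1]
  exact ZFSet.mem_inter.2 ⟨hcx, cset_mem_cset.2 hc⟩

end Ev

/-! ### Threads and the filters they generate. -/

/-- Every regressive family on `W` agrees, on each small set of indices, with a fixed function at
some member of `W`. -/
def Threadable (κ lam : Cardinal.{u}) (W : ZFSet.{u}) : Prop :=
  ∀ g : ZFSet.{u} → ZFSet.{u} → ZFSet.{u}, (∀ x ∈ W, ∀ i ∈ x, g i x ∈ x) →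
    ∃ f : ZFSet.{u} → ZFSet.{u}, ∀ z ∈ Pk κ (cset lam), ∃ x ∈ W, z ⊆ x ∧ ∀ i ∈ z, g i x = f i

/-- The filter is generated by the sets of x ∈ W that contain z and agree with the thread on z, for
z ∈ P_κ λ. The thread makes these nonempty; regularity of κ, applied to unions of fewer than κ many
z, gives completeness. -/
theorem Threadable.exists_filter {κ lam : Cardinal.{u}} (hle : κ ≤ lam) (hκ : κ.IsRegular)
    {W : ZFSet.{u}} (hW : W ⊆ Pk κ (cset lam)) (h : Threadable κ lam W)
    {P : Filter ZFSet.{u} → Prop} (hP : Ev κ lam P) :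
    ∃ U, Base κ lam U ∧ (∀ᶠ x in U, x ∈ W) ∧ P U := by
  classical
  have hl : ℵ₀ ≤ lam := hκ.1.trans hle
  obtain ⟨F, hF, hP⟩ := hP
  -- Every function gets two indices, one recording its value and one recording whether it is
  -- regressive at x. The function `id` is added only so that there is something to enumerate.
  let s : Set ((ZFSet.{u} → ZFSet.{u}) × ULift.{u + 1} Bool) := (insert id F) ×ˢ Set.univ
  have hs : #s ≤ lift.{u + 1} lam := by
    have hl' : ℵ₀ ≤ lift.{u + 1} lam := by rwa [aleph0_le_lift]
    rw [mk_setProd]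
    have h1 : #(insert id F : Set _) ≤ lift.{u + 1} lam :=
      mk_insert_le.trans ((add_le_add hF (one_le_aleph0.trans hl')).trans (add_eq_self hl').le)
    have h2 : #(Set.univ : Set (ULift.{u + 1} Bool)) ≤ lift.{u + 1} lam :=
      (mk_le_aleph0).trans hl'
    simpa using (mul_le_mul' h1 h2).trans (mul_eq_self hl').le
  obtain ⟨e, he, he'⟩ := exists_enum hs ⟨(id, ⟨true⟩), by simp [s]⟩
  -- The fallback value i is a member of x whenever the index i is, so g is regressive whatever the
  -- given functions do. The sets ∅ and {∅} serve as truth values.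
  let g : ZFSet.{u} → ZFSet.{u} → ZFSet.{u} := fun i x =>
    if (e i).2.down then (if (e i).1 x ∈ x then (e i).1 x else i)
    else if ∅ ∈ x ∧ {∅} ∈ x then (if (e i).1 x ∈ x then {∅} else ∅) else i
  obtain ⟨f, hf⟩ := h g (by
    intro x _ i hi
    simp only [g]
    split_ifs with h1 h2 h2 h3
    · exact h2
    · exact hi
    · exact h2.2
    · exact h2.1
    · exact hi)
  let B : ZFSet.{u} → Set ZFSet.{u} := fun z => {x | x ∈ W ∧ z ⊆ x ∧ ∀ i ∈ z, g i x = f i}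
  have hBmono : ∀ {z z' : ZFSet.{u}}, z ⊆ z' → B z' ⊆ B z := fun hzz x hx =>
    ⟨hx.1, hzz.trans hx.2.1, fun i hi => hx.2.2 i (hzz hi)⟩
  have hempty : ∅ ∈ Pk κ (cset lam) := mem_Pk.2 ⟨ZFSet.empty_subset _, by
    rw [ZFSet.card_empty]; exact aleph0_pos.trans_le hκ.1⟩
  let U : Filter ZFSet.{u} :=
    { sets := {S | ∃ z ∈ Pk κ (cset lam), B z ⊆ S}
      univ_sets := ⟨∅, hempty, Set.subset_univ _⟩
      sets_of_superset := fun ⟨z, hz, h⟩ h' => ⟨z, hz, h.trans h'⟩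
      inter_sets := by
        rintro S T ⟨z, hz, h⟩ ⟨z', hz', h'⟩
        rw [mem_Pk] at hz hz'
        refine ⟨z ∪ z', mem_Pk.2 ⟨fun a ha => ?_, card_union_lt hκ.1 hz.2 hz'.2⟩, ?_⟩
        · rcases ZFSet.mem_union.1 ha with ha | ha
          · exact hz.1 ha
          · exact hz'.1 ha
        · exact Set.subset_inter
            ((hBmono fun a ha => ZFSet.mem_union.2 (Or.inl ha)).trans h)
            ((hBmono fun a ha => ZFSet.mem_union.2 (Or.inr ha)).trans h') }
  have hUmem : ∀ {p : ZFSet.{u} → Prop}, (∀ᶠ x in U, p x) ↔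
      ∃ z ∈ Pk κ (cset lam), ∀ x ∈ B z, p x := Iff.rfl
  have hsing : ∀ ξ ∈ cset lam, {ξ} ∈ Pk κ (cset lam) := fun ξ hξ => mem_Pk.2
    ⟨fun a ha => by rw [ZFSet.mem_singleton.1 ha]; exact hξ, by
      rw [ZFSet.card_singleton]; exact one_lt_aleph0.trans_le hκ.1⟩
  have hUW : ∀ᶠ x in U, x ∈ W := hUmem.2 ⟨∅, hempty, fun x hx => hx.1⟩
  have hUfine : ∀ ξ ∈ cset lam, ∀ᶠ x in U, ξ ∈ x := fun ξ hξ =>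
    hUmem.2 ⟨{ξ}, hsing ξ hξ, fun x hx => hx.2.1 (ZFSet.mem_singleton.2 rfl)⟩
  have hUf : ∀ ξ ∈ cset lam, ∀ᶠ x in U, g ξ x = f ξ := fun ξ hξ =>
    hUmem.2 ⟨{ξ}, hsing ξ hξ, fun x hx => hx.2.2 _ (ZFSet.mem_singleton.2 rfl)⟩
  have hne : U.NeBot := by
    refine ⟨fun hbot => ?_⟩
    have : ∀ᶠ x in U, False := by rw [hbot]; exact eventually_bot
    obtain ⟨z, hz, hz'⟩ := hUmem.1 this
    obtain ⟨x, hx⟩ := hf z hz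
    exact hz' x hx
  have hU : Base κ lam U := by
    refine ⟨hne, hUW.mono fun x hx => hW hx, hUfine, ?_⟩
    intro I hI P hP
    choose! z hz hz' using fun i hi => hUmem.1 (hP i hi)
    refine hUmem.2 ⟨bUnion I z, mem_Pk.2 ⟨fun a ha => ?_, card_bUnion_lt hκ hI fun i hi =>
      (mem_Pk.1 (hz i hi)).2⟩, fun x hx i hi => hz' i hi x (hBmono ?_ hx)⟩
    · obtain ⟨i, hi, ha⟩ := mem_bUnion.1 ha
      exact (mem_Pk.1 (hz i hi)).1 ha
    · exact fun a ha => mem_bUnion.2 ⟨i, hi, ha⟩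
  refine ⟨U, hU, hUW, hP U hU fun G hG hfr => ?_⟩
  obtain ⟨i, hi, hei⟩ := he' (G, ⟨true⟩) (by simp [s, hG])
  obtain ⟨j, hj, hej⟩ := he' (G, ⟨false⟩) (by simp [s, hG])
  have h0 := hUfine ∅ (empty_mem_cset (aleph0_pos.trans_le hl).ne')
  have h1 := hUfine {∅} (singleton_empty_mem_cset hl)
  -- The truth value recorded at index j is the same for almost all x. As G is regressive positively
  -- often, that value must be {∅}, so G is regressive almost everywhere and index i records its
  -- true value.
  have hflag : ∀ᶠ x in U, (if G x ∈ x then ({∅} : ZFSet.{u}) else ∅) = f j := by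
    filter_upwards [h0, h1, hUf j hj] with x h0 h1 hx
    simpa [g, hej, h0, h1] using hx
  have hfj : f j = {∅} := by
    obtain ⟨x, hx, hx'⟩ := (hfr.and_eventually hflag).exists
    rw [if_pos hx] at hx'
    exact hx'.symm
  refine ⟨f i, ?_⟩
  filter_upwards [hflag, hUf i hi] with x hx hx'
  have hreg : G x ∈ x := by
    by_contra hcon
    rw [if_neg hcon, hfj] at hx
    have := ZFSet.mem_singleton.2 (rfl : (∅ : ZFSet.{u}) = ∅)
    rw [← hx] at this
    exact ZFSet.notMem_empty _ this
  simpa [g, hei, hreg] using hx'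

/-! ### Threads and 1-clubs. -/

section

variable {κ lam : Cardinal.{u}} {W : ZFSet.{u}}

theorem card_Pk_lt {μ : Cardinal.{u}} (hκ : κ.IsInaccessible) {y : ZFSet.{u}} (hy : y.card < κ) :
    (Pk μ y).card < κ := by
  refine (ZFSet.card_mono (y := y.powerset) ?_).trans_lt ?_
  · exact fun z hz => ZFSet.mem_powerset.2 (mem_Pk.1 hz).1
  · rw [ZFSet.card_powerset]
    exact hκ.isStrongLimit.isStrongPrelimit hy

theorem kap_le_card (x : ZFSet.{u}) : kap κ x ≤ x.card :=
  ZFSet.card_mono fun _ ha => (ZFSet.mem_inter.1 ha).1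

theorem Pk_kap_subset {y : ZFSet.{u}} (hy : y ∈ Pk κ (cset lam)) :
    Pk (kap κ y) y ⊆ Pk κ (cset lam) := fun z hz => by
  rw [mem_Pk] at hy hz ⊢
  exact ⟨hz.1.trans hy.1, hz.2.trans ((kap_le_card y).trans_lt hy.2)⟩

/-- For x ∈ W outside C with κ_x inaccessible, 1-closedness of C supplies a function on P_{κ_x} x
without closure points in C. There are at most λ many arguments z ∈ P_κ λ, so these functions can be
frozen pointwise to one f on P_κ λ, and stationarity of C is contradicted at a closure point of f.
-/
theorem Threadable.inter_nonempty (hle : κ ≤ lam) (hpow : lam ^< κ ≤ lam)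
    (hκ : κ.IsInaccessible) (hW : W ⊆ Pk κ (cset lam)) (h : Threadable κ lam W)
    {C : ZFSet.{u}} (hC : OneClub κ lam C) : (C ∩ W).Nonempty := by
  classical
  by_contra hcon
  have hdisj : ∀ x ∈ W, x ∉ C := fun x hx hxC =>
    hcon (ZFSet.nonempty_of_mem (ZFSet.mem_inter.2 ⟨hxC, hx⟩))
  have hl : ℵ₀ ≤ lam := hκ.aleph0_lt.le.trans hle
  have hPk : #(Pk κ (cset lam) : Set ZFSet.{u}) ≤ lift.{u + 1} lam :=
    card_le_iff.1 (card_Pk_le hle hl hpow (card_cset lam).le)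
  let Wit : ZFSet.{u} → (ZFSet.{u} → ZFSet.{u}) → Prop := fun x f =>
    (∀ z ∈ Pk (kap κ x) x, f z ∈ Pk (kap κ x) x) ∧
      ∀ y ∈ C, y ∉ closurePts κ (kap κ x) x f
  obtain ⟨F, hF⟩ : ∃ F : ZFSet.{u} → ZFSet.{u} → ZFSet.{u}, ∀ x, (∃ f, Wit x f) → Wit x (F x) := by
    refine ⟨fun x => if h : ∃ f, Wit x f then h.choose else id, fun x hx => ?_⟩
    simp only [hx, dif_pos]
    exact hx.choose_spec
  obtain ⟨U, hU, hUW, h1, h2, h3⟩ := h.exists_filter hle hκ.isRegular hW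
    ((Ev.inaccessible hle hκ).and hl ((Ev.fine_Pk hle hκ).and hl
      (Ev.forall hl hPk fun z _ => Ev.const_Pk hle hκ fun x => F x z)))
  have := hU.neBot
  have hWit : ∀ᶠ x in U, Wit x (F x) := by
    filter_upwards [hUW, h1] with x hx hx'
    apply hF
    by_contra hno
    refine hdisj x hx (hC.2.2 x (hW hx) hx'.2 fun f hf => ?_)
    by_contra hno'
    refine hno ⟨f, hf, fun y hy hyc => hno' ⟨y, ?_, hyc⟩⟩
    exact ZFSet.mem_inter.2 ⟨hy, (ZFSet.mem_sep.1 hyc).1⟩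
  have h4 : ∀ z ∈ Pk κ (cset lam), ∃ s ∈ Pk κ (cset lam), ∀ᶠ x in U, F x z = s := by
    intro z hz
    apply h3 z hz
    apply Eventually.frequently
    filter_upwards [hWit, h2 z hz] with x hx hzx
    exact hx.1 z hzx
  choose! f hf hf' using h4
  obtain ⟨y, hyC, hy⟩ := hC.2.1 f hf
  obtain ⟨hyP, hy0, hyf⟩ := ZFSet.mem_sep.1 hy
  -- P_{κ_y} y has size less than κ, as κ is inaccessible. Hence almost every x has F x = f on all
  -- of it, so y is also a closure point of F x.
  have h5 : ∀ᶠ x in U, ∀ z ∈ Pk (kap κ y) y, F x z = f z :=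
    hU.complete _ (card_Pk_lt hκ (mem_Pk.1 hyP).2) (fun z x => F x z = f z)
      fun z hz => hf' z (Pk_kap_subset hyP hz)
  obtain ⟨x, hx1, hx2, hx3⟩ := (hWit.and (h5.and (h2 y hyP))).exists
  refine hx1.2 y hyC (ZFSet.mem_sep.2 ⟨hx3, hy0, fun z hz => ?_⟩)
  rw [hx2 z hz]
  exact hyf z hz

/-- If g had no thread, the x without a local thread for g would form a 1-club. It misses W, because
for x ∈ W the function i ↦ g i x is itself a local thread at x. -/
theorem threadable_of_inter_nonempty (hle : κ ≤ lam)
    (hκ : κ.IsInaccessible) (hP : Threadable κ lam (Pk κ (cset lam)))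
    (h : ∀ C, OneClub κ lam C → (C ∩ W).Nonempty) : Threadable κ lam W := by
  classical
  by_contra hcon
  simp only [Threadable] at hcon
  push Not at hcon
  obtain ⟨g, hg, hno⟩ := hcon
  have hl : ℵ₀ ≤ lam := hκ.aleph0_lt.le.trans hle
  let Thr : ZFSet.{u} → (ZFSet.{u} → ZFSet.{u}) → Prop := fun y f =>
    (∀ i ∈ y, f i ∈ y) ∧ ∀ z ∈ Pk (kap κ y) y, ∃ x ∈ W, z ⊆ x ∧ ∀ i ∈ z, g i x = f i
  let C : ZFSet.{u} := ZFSet.sep (fun y => y ∩ cset κ = cset (kap κ y) ∧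
    (kap κ y).IsInaccessible ∧ ¬ ∃ f, Thr y f) (Pk κ (cset lam))
  have hCW : ¬ (C ∩ W).Nonempty := by
    rintro ⟨x, hx⟩
    obtain ⟨hxC, hxW⟩ := ZFSet.mem_inter.1 hx
    obtain ⟨-, -, -, hx⟩ := ZFSet.mem_sep.1 hxC
    exact hx ⟨fun i => g i x, fun i hi => hg x hxW i hi, fun z hz => ⟨x, hxW, (mem_Pk.1 hz).1,
      fun i _ => rfl⟩⟩
  refine hCW (h C ⟨ZFSet.sep_subset, ?_, ?_⟩)
  -- Strong stationarity: almost every x is closed under p. If none of those were in C, almost all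
  -- of them would have local threads, and freezing these at each i ∈ λ would produce a global
  -- thread for g.
  · intro p hp
    obtain ⟨F, hF⟩ : ∃ F : ZFSet.{u} → ZFSet.{u} → ZFSet.{u},
        ∀ x, (∃ f, Thr x f) → Thr x (F x) := by
      refine ⟨fun x => if h : ∃ f, Thr x f then h.choose else id, fun x hx => ?_⟩
      simp only [hx, dif_pos]
      exact hx.choose_spec
    obtain ⟨U, hU, hUW, h1, h2, h3, h4⟩ := hP.exists_filter hle hκ.isRegular (fun _ h => h)
      ((Ev.inaccessible hle hκ).and hl ((Ev.fine_Pk hle hκ).and hl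
        ((Ev.regressive_Pk hle hκ fun x z => p z ∉ Pk (kap κ x) x).and hl
        (Ev.forall hl (mk_cset lam).le fun i _ => Ev.decides hl fun x => F x i))))
    have := hU.neBot
    by_contra hdisj
    push Not at hdisj
    have e1 : ∀ᶠ x in U, ∀ z ∈ Pk (kap κ x) x, p z ∈ Pk (kap κ x) x := by
      by_contra hcon
      rw [not_eventually] at hcon
      obtain ⟨s, hs, hs'⟩ := h3 (hcon.mono fun x hx => by push Not at hx; exact hx)
      obtain ⟨x, hx, hx'⟩ := (hs'.and_eventually (h2 _ (hp s hs))).exists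
      exact hx hx'
    have e2 : ∀ᶠ x in U, Thr x (F x) := by
      filter_upwards [e1, h1, hUW] with x hx1 hx2 hx3
      apply hF
      by_contra hno'
      refine hdisj x (ZFSet.mem_sep.2 ⟨hx3, hx2.1, hx2.2, hno'⟩)
        (ZFSet.mem_sep.2 ⟨hx3, ?_, hx1⟩)
      rw [hx2.1]
      intro h0
      have := empty_mem_cset hx2.2.ne_zero
      rw [h0] at this
      exact ZFSet.notMem_empty _ this
    have e3 : ∀ i ∈ cset lam, ∃ η, ∀ᶠ x in U, F x i = η := by
      intro i hi
      apply h4 i hi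
      apply Eventually.frequently
      filter_upwards [e2, hU.fine i hi] with x hx hix
      exact hx.1 i hix
    choose! f hf using e3
    obtain ⟨z, hz, hz'⟩ := hno f
    have e4 := hU.complete z (mem_Pk.1 hz).2 (fun i x => F x i = f i)
      fun i hi => hf i ((mem_Pk.1 hz).1 hi)
    obtain ⟨x, hx1, hx2, hx3⟩ := (e4.and (e2.and (h2 z hz))).exists
    obtain ⟨x', hx'W, hzx', hx'⟩ := hx2.2 z hx3
    obtain ⟨i, hi, hne⟩ := hz' x' hx'W hzx'
    exact hne ((hx' i hi).trans (hx1 i hi))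
  -- 1-closedness: a local thread at x, restricted to a closure point y ∈ C that is closed under it,
  -- would be a local thread at y.
  · intro x hx hxi hss
    have hinf : ℵ₀ ≤ kap κ x := hxi.aleph0_lt.le
    -- A closure point of z ↦ z ∪ {ξ} contains ξ, as its value at ∅ shows. Hence some y ∈ C with |y|
    -- < κ_x contains ξ, and y ∩ κ = κ_y gives ξ ⊆ y ⊆ x and |ξ| < κ_y < κ_x.
    have key : ∀ ξ ∈ x ∩ cset κ, ξ ⊆ x ∧ ξ.card < kap κ x := by
      intro ξ hξ
      rw [ZFSet.mem_inter] at hξ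
      obtain ⟨y, hy, hyc⟩ := hss (fun z => insert ξ z) fun z hz => by
        rw [mem_Pk] at hz ⊢
        refine ⟨fun a ha => ?_, card_insert_lt hinf hz.2⟩
        rcases ZFSet.mem_insert_iff.1 ha with rfl | ha
        · exact hξ.1
        · exact hz.1 ha
      obtain ⟨hyx, hy0, hyf⟩ := ZFSet.mem_sep.1 hyc
      rw [mem_Pk] at hyx
      have hyκ := (ZFSet.mem_sep.1 (ZFSet.mem_inter.1 hy).1).2
      have hempty : ∅ ∈ Pk (kap κ y) y := mem_Pk.2 ⟨ZFSet.empty_subset _, by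
        rw [ZFSet.card_empty]; exact hyκ.2.1.pos⟩
      have hξy : ξ ∈ y := (mem_Pk.1 (hyf ∅ hempty)).1 (ZFSet.mem_insert _ _)
      have hξy' : ξ ∈ cset (kap κ y) := by
        rw [← hyκ.1]; exact ZFSet.mem_inter.2 ⟨hξy, hξ.2⟩
      refine ⟨?_, ?_⟩
      · have := subset_cset_of_mem hξy'
        rw [← hyκ.1] at this
        exact fun a ha => hyx.1 (ZFSet.mem_inter.1 (this ha)).1
      · exact (card_lt_of_mem_cset hξy').trans ((kap_le_card y).trans_lt hyx.2)
    refine ZFSet.mem_sep.2 ⟨hx, inter_cset_eq (fun ξ hξ => (key ξ hξ).1) ?_, hxi, ?_⟩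
    · intro hmem
      have := (key _ hmem).2
      rw [card_cset] at this
      exact lt_irrefl _ this
    · rintro ⟨f, hf, hf'⟩
      -- close off under `f`
      obtain ⟨y, hy, hyc⟩ := hss (fun z => img f z) fun z hz => by
        rw [mem_Pk] at hz ⊢
        refine ⟨fun a ha => ?_, (card_img_le _ _).trans_lt hz.2⟩
        obtain ⟨i, hi, rfl⟩ := mem_img.1 ha
        exact hf i (hz.1 hi)
      obtain ⟨hyx, hy0, hyf⟩ := ZFSet.mem_sep.1 hyc
      have hyκ := (ZFSet.mem_sep.1 (ZFSet.mem_inter.1 hy).1).2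
      refine hyκ.2.2 ⟨f, fun i hi => ?_, fun z hz => hf' z ?_⟩
      · have : {i} ∈ Pk (kap κ y) y := mem_Pk.2 ⟨fun a ha => by
          rw [ZFSet.mem_singleton.1 ha]; exact hi, by
          rw [ZFSet.card_singleton]; exact one_lt_aleph0.trans hyκ.2.1.aleph0_lt⟩
        exact (mem_Pk.1 (hyf _ this)).1 (mem_img_of_mem (ZFSet.mem_singleton.2 rfl))
      · rw [mem_Pk] at hz hyx ⊢
        exact ⟨hz.1.trans hyx.1, hz.2.trans ((kap_le_card y).trans_lt hyx.2)⟩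

/-! ### Threads on P_κ λ make κ inaccessible. -/

theorem singleton_mem_Pk {X ξ : ZFSet.{u}} (hκ : ℵ₀ ≤ κ) (hξ : ξ ∈ X) : {ξ} ∈ Pk κ X :=
  mem_Pk.2 ⟨fun a ha => by rw [ZFSet.mem_singleton.1 ha]; exact hξ, by
    rw [ZFSet.card_singleton]; exact one_lt_aleph0.trans_le hκ⟩

theorem union_mem_Pk {X a b : ZFSet.{u}} (hκ : ℵ₀ ≤ κ) (ha : a ∈ Pk κ X) (hb : b ∈ Pk κ X) :
    a ∪ b ∈ Pk κ X := by
  rw [mem_Pk] at ha hb ⊢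
  refine ⟨fun c hc => ?_, card_union_lt hκ ha.2 hb.2⟩
  rcases ZFSet.mem_union.1 hc with hc | hc
  · exact ha.1 hc
  · exact hb.1 hc

/-- For κ = ℵ₀ every x ∩ κ is finite, so its maximum is a regressive function of x. A thread would
fix this maximum while x may be required to contain its successor. -/
theorem Threadable.aleph0_lt (hle : κ ≤ lam) (hκ : ℵ₀ ≤ κ)
    (hP : Threadable κ lam (Pk κ (cset lam))) : ℵ₀ < κ := by
  classical
  refine lt_of_le_of_ne hκ fun heq => ?_
  have hsub : cset κ ⊆ cset lam := cset_subset_cset.2 hle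
  have h0 : ∅ ∈ cset κ := empty_mem_cset (aleph0_pos.trans_le hκ).ne'
  let M : ZFSet.{u} → ZFSet.{u} → Prop := fun x m =>
    m ∈ x ∧ m ∈ cset κ ∧ ∀ ξ ∈ x, ξ ∈ cset κ → ξ ⊆ m
  have hM : ∀ x ∈ Pk κ (cset lam), ∅ ∈ x → ∃ m, M x m := by
    intro x hx h0x
    have hfin : ((x ∩ cset κ : ZFSet) : Set ZFSet.{u}).Finite := by
      rw [← Cardinal.lt_aleph0_iff_set_finite, ← lift_aleph0.{u + 1, u}, heq]
      refine card_lt_iff.1 ((ZFSet.card_mono ?_).trans_lt (mem_Pk.1 hx).2)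
      exact fun a ha => (ZFSet.mem_inter.1 ha).1
    obtain ⟨m, hm, hm'⟩ := Set.exists_max_image _ ZFSet.rank hfin
      ⟨∅, ZFSet.mem_inter.2 ⟨h0x, h0⟩⟩
    have hm := ZFSet.mem_inter.1 hm
    refine ⟨m, hm.1, hm.2, fun ξ hξ hξκ => ?_⟩
    rw [← ZFSet.IsOrdinal.rank_le_iff_subset (isOrdinal_of_mem_cset hξκ) (isOrdinal_of_mem_cset hm.2)]
    exact hm' ξ (ZFSet.mem_inter.2 ⟨hξ, hξκ⟩)
  -- The family does not depend on i as long as a maximum exists, so only the value at index ∅ is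
  -- read off. Every z used below therefore contains ∅.
  obtain ⟨f, hf⟩ := hP (fun i x => if h : ∃ m, M x m then h.choose else i) (by
    intro x _ i hi
    split_ifs with h
    · exact h.choose_spec.1
    · exact hi)
  have hsing := singleton_mem_Pk hκ (hsub h0)
  have hmem : ∀ z ∈ Pk κ (cset lam), ∅ ∈ z → ∃ x, z ⊆ x ∧ M x (f ∅) := by
    intro z hz h0z
    obtain ⟨x, hx, hzx, h⟩ := hf z hz
    have h' := h _ h0z
    have hex := hM x hx (hzx h0z)
    rw [dif_pos hex] at h'
    exact ⟨x, hzx, by rw [← h']; exact hex.choose_spec⟩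
  obtain ⟨x, -, hx⟩ := hmem _ hsing (ZFSet.mem_singleton.2 rfl)
  have hs := insert_mem_cset hκ hx.2.1
  obtain ⟨x', hx', hx''⟩ := hmem _
    (union_mem_Pk hκ hsing (singleton_mem_Pk hκ (hsub hs)))
    (ZFSet.mem_union.2 (Or.inl (ZFSet.mem_singleton.2 rfl)))
  have := hx''.2.2 _ (hx' (ZFSet.mem_union.2 (Or.inr (ZFSet.mem_singleton.2 rfl)))) hs
    (ZFSet.mem_insert _ _)
  exact ZFSet.mem_irrefl _ this

/-- Let S ⊆ κ be unbounded with |S| < κ. Once S ⊆ x, an ordinal k ∈ S with |x| ≤ |k| is a regressive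
choice. A thread fixes k, yet x may be required to contain more than |k| elements. -/
theorem Threadable.isRegular (hle : κ ≤ lam) (hκ : ℵ₀ ≤ κ)
    (hP : Threadable κ lam (Pk κ (cset lam))) : κ.IsRegular := by
  classical
  refine ⟨hκ, ?_⟩
  by_contra hnr
  have hsub : cset κ ⊆ cset lam := cset_subset_cset.2 hle
  have h0 : ∅ ∈ cset κ := empty_mem_cset (aleph0_pos.trans_le hκ).ne'
  obtain ⟨S, hS, hSc, hunb⟩ : ∃ S ⊆ cset κ, S.card < κ ∧ ∀ ζ ∈ cset κ, ∃ ξ ∈ S, ξ ∉ ζ := by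
    by_contra hcon
    push Not at hcon
    exact hnr (le_cof_ord_of_bounded hcon)
  have hex : ∀ x ∈ Pk κ (cset lam), ∃ k ∈ S, x.card ≤ k.card := by
    intro x hx
    have hx' : cset x.card ∈ cset κ := cset_mem_cset.2 (mem_Pk.1 hx).2
    obtain ⟨ξ, hξ, hξx⟩ := hunb _ hx'
    refine ⟨ξ, hξ, ?_⟩
    have := ZFSet.card_mono ((ZFSet.IsOrdinal.notMem_iff_subset (isOrdinal_of_mem_cset (hS hξ))
      (isOrdinal_cset _)).1 hξx)
    rwa [card_cset] at this
  obtain ⟨f, hf⟩ := hP (fun i x => if h : ∃ k ∈ x, k ∈ S ∧ x.card ≤ k.card then h.choose else i)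
    (by
      intro x _ i hi
      split_ifs with h
      · exact h.choose_spec.1
      · exact hi)
  have hsing := singleton_mem_Pk hκ (hsub h0)
  have hz₀ : {∅} ∪ S ∈ Pk κ (cset lam) :=
    union_mem_Pk hκ hsing (mem_Pk.2 ⟨hS.trans hsub, hSc⟩)
  have hmem : ∀ z ∈ Pk κ (cset lam), {∅} ∪ S ⊆ z → ∃ x, z ⊆ x ∧ f ∅ ∈ S ∧ x.card ≤ (f ∅).card := by
    intro z hz h0z
    obtain ⟨x, hx, hzx, h⟩ := hf z hz
    have h' := h _ (h0z (ZFSet.mem_union.2 (Or.inl (ZFSet.mem_singleton.2 rfl))))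
    obtain ⟨k, hk, hk'⟩ := hex x hx
    have hex' : ∃ k ∈ x, k ∈ S ∧ x.card ≤ k.card :=
      ⟨k, hzx (h0z (ZFSet.mem_union.2 (Or.inr hk))), hk, hk'⟩
    rw [dif_pos hex'] at h'
    exact ⟨x, hzx, by rw [← h']; exact hex'.choose_spec.2⟩
  obtain ⟨x, -, hx, -⟩ := hmem _ hz₀ fun _ h => h
  have hlt : (f ∅).card < κ := card_lt_of_mem_cset (hS hx)
  -- Otherwise κ would be the successor of an infinite cardinal and hence regular.
  have hsucc : Order.succ (f ∅).card < κ := by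
    refine lt_of_le_of_ne (Order.succ_le_of_lt hlt) fun h => ?_
    have hinf : ℵ₀ ≤ (f ∅).card := by
      by_contra hfin
      rw [not_le, lt_aleph0] at hfin
      obtain ⟨n, hn⟩ := hfin
      rw [hn] at h
      have : Order.succ (n : Cardinal.{u}) < ℵ₀ := isSuccLimit_aleph0.succ_lt natCast_lt_aleph0
      exact absurd hκ (not_le.2 (h ▸ this))
    exact hnr (h ▸ (isRegular_succ hinf).2)
  obtain ⟨x', hx', -, hx''⟩ := hmem (({∅} ∪ S) ∪ cset (Order.succ (f ∅).card))
    (union_mem_Pk hκ hz₀ (mem_Pk.2 ⟨cset_subset_cset.2 (hsucc.le.trans hle), by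
      rwa [card_cset]⟩)) fun a ha => ZFSet.mem_union.2 (Or.inl ha)
  have h1 : cset (Order.succ (f ∅).card) ⊆ x' := fun a ha =>
    hx' (ZFSet.mem_union.2 (Or.inr ha))
  have h2 := (ZFSet.card_mono h1).trans hx''
  rw [card_cset] at h2
  exact absurd h2 (not_le.2 (Order.lt_succ _))

/-- If μ < κ ≤ 2^μ, take distinct sets Y ξ ⊆ μ for ξ < κ, and let s x < κ lie above x ∩ κ. Threading
the truth values of i ∈ Y (s x) for i < μ fixes the set Y (s x), hence s x. But y may be required to
contain s x, and then s x < s y. -/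
theorem Threadable.isInaccessible (hle : κ ≤ lam) (hκ : ℵ₀ ≤ κ)
    (hP : Threadable κ lam (Pk κ (cset lam))) : κ.IsInaccessible := by
  classical
  have hreg := hP.isRegular hle hκ
  refine ⟨hP.aleph0_lt hle hκ, hreg.2, ?_⟩
  intro μ hμ
  by_contra hge
  rw [not_lt] at hge
  have hsub : cset κ ⊆ cset lam := cset_subset_cset.2 hle
  have h0 : ∅ ∈ cset κ := empty_mem_cset (aleph0_pos.trans_le hκ).ne'
  have h1 : {∅} ∈ cset κ := singleton_empty_mem_cset hκ
  obtain ⟨Y, hYinj, hY⟩ : ∃ Y : ZFSet.{u} → ZFSet.{u}, Set.InjOn Y (cset κ : Set ZFSet.{u}) ∧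
      ∀ ξ ∈ cset κ, Y ξ ⊆ cset μ := by
    have hc : #(cset κ : Set ZFSet.{u}) ≤ #((cset μ).powerset : Set ZFSet.{u}) := by
      have : #((cset μ).powerset : Set ZFSet.{u}) =
        lift.{u + 1, u} (cset μ).powerset.card := ZFSet.cardinalMk_coe_sort
      rw [mk_cset, this, ZFSet.card_powerset, card_cset, Cardinal.lift_le]
      exact hge
    obtain ⟨e⟩ := hc
    refine ⟨fun ξ => if h : ξ ∈ cset κ then (e ⟨ξ, h⟩).1 else ∅, ?_, ?_⟩
    · intro a ha b hb hab
      have ha' : a ∈ cset κ := ha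
      have hb' : b ∈ cset κ := hb
      simp only [ha', hb', dif_pos] at hab
      simpa using e.injective (Subtype.ext hab)
    · intro ξ hξ
      simp only [hξ, dif_pos]
      exact ZFSet.mem_powerset.1 (e ⟨ξ, hξ⟩).2
  have hs : ∀ x ∈ Pk κ (cset lam), ∃ s ∈ cset κ, ∀ ξ ∈ x ∩ cset κ, ξ ∈ s := fun x hx =>
    exists_bound hreg (fun a ha => (ZFSet.mem_inter.1 ha).2)
      ((ZFSet.card_mono fun a ha => (ZFSet.mem_inter.1 ha).1).trans_lt (mem_Pk.1 hx).2)
  choose! s hs hs' using hs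
  obtain ⟨f, hf⟩ := hP (fun i x => if ∅ ∈ x ∧ {∅} ∈ x then
      (if i ∈ Y (s x) then {∅} else ∅) else i) (by
    intro x _ i hi
    split_ifs with h h'
    · exact h.2
    · exact h.1
    · exact hi)
  let z₀ : ZFSet.{u} := ({∅} ∪ {{∅}}) ∪ cset μ
  have hz₀ : z₀ ∈ Pk κ (cset lam) := union_mem_Pk hκ (union_mem_Pk hκ
    (singleton_mem_Pk hκ (hsub h0)) (singleton_mem_Pk hκ (hsub h1)))
    (mem_Pk.2 ⟨cset_subset_cset.2 (hμ.le.trans hle), by rwa [card_cset]⟩)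
  have hne : ({∅} : ZFSet.{u}) ≠ ∅ := by
    intro h
    have := ZFSet.mem_singleton.2 (rfl : (∅ : ZFSet.{u}) = ∅)
    rw [h] at this
    exact ZFSet.notMem_empty _ this
  have hmem : ∀ z ∈ Pk κ (cset lam), z₀ ⊆ z → ∃ x ∈ Pk κ (cset lam), z ⊆ x ∧
      ∀ i ∈ cset μ, (i ∈ Y (s x) ↔ f i = {∅}) := by
    intro z hz hzz
    obtain ⟨x, hx, hzx, h⟩ := hf z hz
    refine ⟨x, hx, hzx, fun i hi => ?_⟩
    have h' := h i (hzz (ZFSet.mem_union.2 (Or.inr hi)))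
    rw [if_pos ⟨hzx (hzz (by simp [z₀])), hzx (hzz (by simp [z₀]))⟩] at h'
    rw [← h']
    split_ifs with h
    · exact ⟨fun _ => rfl, fun _ => h⟩
    · exact ⟨fun hh => absurd hh h, fun hh => absurd hh.symm hne⟩
  obtain ⟨x, hx, hzx, hx'⟩ := hmem z₀ hz₀ fun _ h => h
  obtain ⟨y, hy, hzy, hy'⟩ := hmem (z₀ ∪ {s x})
    (union_mem_Pk hκ hz₀ (singleton_mem_Pk hκ (hsub (hs x hx))))
    fun a ha => ZFSet.mem_union.2 (Or.inl ha)
  have hYeq : Y (s x) = Y (s y) := by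
    ext i
    constructor
    · intro hi
      have hiμ := hY _ (hs x hx) hi
      exact (hy' i hiμ).2 ((hx' i hiμ).1 hi)
    · intro hi
      have hiμ := hY _ (hs y hy) hi
      exact (hx' i hiμ).2 ((hy' i hiμ).1 hi)
  have hseq := hYinj (hs x hx) (hs y hy) hYeq
  have := hs' y hy (s x) (ZFSet.mem_inter.2
    ⟨hzy (ZFSet.mem_union.2 (Or.inr (ZFSet.mem_singleton.2 rfl))), hs x hx⟩)
  rw [← hseq] at this
  exact ZFSet.mem_irrefl _ this

end

/-! ### Satisfaction for structures `(D, ∈, …)`, with assignments in the universe -/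

/-- The value of a term (necessarily a variable). -/
def tval {P : Type} {k : ℕ} (a : Fin k → ZFSet.{u}) : (langP P).Term (Empty ⊕ Fin k) → ZFSet.{u}
  | .var (.inl e) => e.elim
  | .var (.inr i) => a i
  | .func f _ => Empty.elim f

/-- The interpretation of the relation symbols of `langP P`. -/
def relHolds {P : Type} (J : P → Set ZFSet.{u}) : ∀ {l : ℕ}, SetRel P l → (Fin l → ZFSet.{u}) → Prop
  | _, .mem, v => v 0 ∈ v 1
  | _, .pred p, v => v 0 ∈ J p

/-- Satisfaction in the structure `(D, ∈, (J p)_p)`. -/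
def Sat {P : Type} (D : Set ZFSet.{u}) (J : P → Set ZFSet.{u}) :
    ∀ {k : ℕ}, (langP P).BoundedFormula Empty k → (Fin k → ZFSet.{u}) → Prop
  | _, .falsum, _ => False
  | _, .equal t s, a => tval a t = tval a s
  | _, .rel R ts, a => relHolds J R fun i => tval a (ts i)
  | _, .imp φ ψ, a => Sat D J φ a → Sat D J ψ a
  | _, .all φ, a => ∀ b ∈ D, Sat D J φ (Fin.snoc a b)

/-- With assignments in the universe rather than in a subtype, one tuple can be evaluated in
structures with different domains, which the Łoś arguments require. -/
theorem realize_iff_sat {P : Type} {D : ZFSet.{u}} {I : P → Set D} {J : P → Set ZFSet.{u}}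
    (hIJ : ∀ p (d : D), d ∈ I p ↔ (d : ZFSet.{u}) ∈ J p) {k : ℕ}
    (φ : (langP P).BoundedFormula Empty k) (v : Empty → D) (a : Fin k → D) :
    @FirstOrder.Language.BoundedFormula.Realize _ D (memStructure D I) _ _ φ v a ↔
      Sat (D : Set ZFSet.{u}) J φ (fun i => (a i : ZFSet.{u})) := by
  let _ := memStructure D I
  have ht : ∀ {k : ℕ} (a : Fin k → D) (t : (langP P).Term (Empty ⊕ Fin k)),
      ((t.realize (Sum.elim v a) : D) : ZFSet.{u}) = tval (fun i => (a i : ZFSet.{u})) t := by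
    intro k a t
    match t with
    | .var (.inl e) => exact e.elim
    | .var (.inr i) => rfl
    | .func f _ => exact Empty.elim f
  induction φ with
  | falsum => exact Iff.rfl
  | equal t s =>
    simp only [Sat, FirstOrder.Language.BoundedFormula.Realize, ← ht]
    exact Subtype.ext_iff
  | rel R ts =>
    simp only [Sat, FirstOrder.Language.BoundedFormula.Realize, ← ht]
    cases R with
    | mem => exact Iff.rfl
    | pred p => exact hIJ p _
  | imp φ ψ ih1 ih2 =>
    simp only [Sat, FirstOrder.Language.BoundedFormula.Realize, ih1, ih2]
  | all φ ih =>
    simp only [Sat, FirstOrder.Language.BoundedFormula.Realize, ih]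
    have hs : ∀ b : D, (fun i => ((Fin.snoc a b : Fin _ → D) i : ZFSet.{u})) =
        Fin.snoc (fun i => (a i : ZFSet.{u})) (b : ZFSet.{u}) := by
      intro b
      ext1 i
      refine Fin.lastCases ?_ (fun i => ?_) i
      · simp
      · simp
    constructor
    · intro h b hb
      have := h ⟨b, hb⟩
      rwa [hs] at this
    · intro h b
      rw [hs]
      exact h b b.2

/-- The interpretation of the predicate symbols of a `Π¹₁`-sentence. -/
def interp {n : ℕ} (R : ZFSet.{u}) (Y : Fin n → Set ZFSet.{u}) : Option (Fin n) → Set ZFSet.{u} :=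
  fun p => p.elim {d | d ∈ R} Y

/-- Only the trace of a class on D matters, so the set variables may range over all classes. -/
theorem PiOneOne.holds_iff (φ : PiOneOne) (D R : ZFSet.{u}) :
    φ.Holds D R ↔ ∀ Y : Fin φ.n → Set ZFSet.{u},
      Sat (D : Set ZFSet.{u}) (interp R Y) φ.matrix Fin.elim0 := by
  have e : (fun i => ((default : Fin 0 → D) i : ZFSet.{u})) = Fin.elim0 := by
    ext1 i; exact i.elim0
  constructor
  · intro h Y
    have h' : @FirstOrder.Language.BoundedFormula.Realize _ D (memStructure D fun p => p.elim
        {d : D | (d : ZFSet.{u}) ∈ R} fun i => {d : D | (d : ZFSet.{u}) ∈ Y i}) _ _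
        φ.matrix default default := h fun i => {d : D | (d : ZFSet.{u}) ∈ Y i}
    have := (realize_iff_sat (I := fun p => p.elim {d : D | (d : ZFSet.{u}) ∈ R}
      fun i => {d : D | (d : ZFSet.{u}) ∈ Y i}) (J := interp R Y) (by
        rintro (_ | i) d <;> exact Iff.rfl) φ.matrix default default).1
      h'
    rwa [e] at this
  · intro h X
    refine (realize_iff_sat (J := interp R fun i => {a | ∃ h : a ∈ D, ⟨a, h⟩ ∈ X i}) ?_
      φ.matrix default default).2 ?_
    · rintro (_ | i) d
      · exact Iff.rfl
      · exact ⟨fun h => ⟨d.2, h⟩, fun ⟨_, h⟩ => h⟩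
    · rw [e]
      exact h _

/-! ### The hierarchy `V_α(κ, A)` -/

section hier

variable {κ : Cardinal.{u}} {A : ZFSet.{u}}

theorem hier_mono {α β : Ordinal.{u}} (h : α ≤ β) : hier κ A α ⊆ hier κ A β := by
  induction β using Ordinal.limitRecOn generalizing α with
  | zero => rw [nonpos_iff_eq_zero.1 h]
  | add_one β ih =>
    rcases h.eq_or_lt with rfl | h
    · exact fun _ h => h
    · rw [hier_add_one]
      exact fun a ha => ZFSet.mem_union.2 (Or.inr (ih (Order.lt_add_one_iff.1 h) ha))
  | limit β hβ ih =>
    rcases h.eq_or_lt with rfl | h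
    · exact fun _ h => h
    · rw [hier_limit _ _ hβ]
      exact fun a ha => ZFSet.mem_iUnion.2 ⟨⟨α, h⟩, ha⟩

theorem mem_bigV (hκ : ℵ₀ ≤ κ) {a : ZFSet.{u}} :
    a ∈ bigV κ A ↔ ∃ α < κ.ord, a ∈ hier κ A α := by
  rw [bigV, hier_limit _ _ (isSuccLimit_ord hκ), ZFSet.mem_iUnion]
  constructor
  · rintro ⟨⟨α, hα⟩, h⟩; exact ⟨α, hα, h⟩
  · rintro ⟨α, hα, h⟩; exact ⟨⟨α, hα⟩, h⟩

theorem subset_bigV : A ⊆ bigV κ A := by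
  have := hier_mono (κ := κ) (A := A) (zero_le (a := κ.ord))
  rwa [hier_zero] at this

theorem bigV_induction {p : ZFSet.{u} → Prop} (h0 : ∀ a ∈ A, p a)
    (h1 : ∀ y ⊆ bigV κ A, y.card < κ → (∀ a ∈ y, p a) → p y) : ∀ a ∈ bigV κ A, p a := by
  have : ∀ α ≤ κ.ord, ∀ a ∈ hier κ A α, p a := by
    intro α
    induction α using Ordinal.limitRecOn with
    | zero => intro _ a ha; rw [hier_zero] at ha; exact h0 a ha
    | add_one β ih =>
      intro hβ a ha
      have hβ' : β ≤ κ.ord := (Order.le_succ β).trans hβ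
      rw [hier_add_one] at ha
      rcases ZFSet.mem_union.1 ha with ha | ha
      · rw [mem_Pk] at ha
        exact h1 a (ha.1.trans (hier_mono hβ')) ha.2 fun b hb => ih hβ' b (ha.1 hb)
      · exact ih hβ' a ha
    | limit β hβ ih =>
      intro hβ' a ha
      rw [hier_limit _ _ hβ] at ha
      obtain ⟨⟨γ, hγ⟩, ha⟩ := ZFSet.mem_iUnion.1 ha
      exact ih γ hγ (hγ.le.trans hβ') a ha
  exact this _ le_rfl

theorem subset_bigV_of_mem {a : ZFSet.{u}} (ha : a ∈ bigV κ A) :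
    a ∈ A ∨ (a ⊆ bigV κ A ∧ a.card < κ) :=
  bigV_induction (p := fun a => a ∈ A ∨ (a ⊆ bigV κ A ∧ a.card < κ)) (fun _ h => Or.inl h)
    (fun _ hy hc _ => Or.inr ⟨hy, hc⟩) a ha

/-- By regularity the levels at which fewer than κ many elements appear are bounded below κ. -/
theorem mem_bigV_of_subset (hκ : κ.IsRegular) {a : ZFSet.{u}} (ha : a ⊆ bigV κ A)
    (hc : a.card < κ) : a ∈ bigV κ A := by
  have h : ∀ b ∈ a, ∃ α < κ.ord, b ∈ hier κ A α := fun b hb => (mem_bigV hκ.1).1 (ha hb)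
  choose! r hr hr' using h
  obtain ⟨ζ, hζ, hb⟩ := exists_bound hκ (S := img (fun b => (r b).toZFSet) a)
    (fun b hb => by
      obtain ⟨c, hc, rfl⟩ := mem_img.1 hb
      exact mem_cset.2 ⟨_, hr c hc, rfl⟩) ((card_img_le _ _).trans_lt hc)
  obtain ⟨o, ho, rfl⟩ := mem_cset.1 hζ
  refine (mem_bigV hκ.1).2 ⟨o + 1, (isSuccLimit_ord hκ.1).succ_lt ho, ?_⟩
  rw [hier_add_one]
  refine ZFSet.mem_union.2 (Or.inl (mem_Pk.2 ⟨fun b hb' => ?_, hc⟩))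
  have := hb _ (mem_img_of_mem (f := fun b => (r b).toZFSet) hb')
  rw [Ordinal.toZFSet_mem_toZFSet_iff] at this
  exact hier_mono this.le (hr' b hb')

theorem card_bigV_le {lam : Cardinal.{u}} (hle : κ ≤ lam) (hl : ℵ₀ ≤ lam)
    (hpow : lam ^< κ ≤ lam) (hA : A.card ≤ lam) : (bigV κ A).card ≤ lam := by
  have : ∀ α ≤ κ.ord, (hier κ A α).card ≤ lam := by
    intro α
    induction α using Ordinal.limitRecOn with
    | zero => intro _; rwa [hier_zero]
    | add_one β ih =>
      intro hβ
      have ih := ih ((Order.le_succ β).trans hβ)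
      rw [hier_add_one]
      exact ZFSet.card_union_le.trans ((add_le_add (card_Pk_le hle hl hpow ih) ih).trans
        (add_eq_self hl).le)
    | limit β hβ ih =>
      intro hβ'
      refine (ZFSet.card_mono (y := bUnion β.toZFSet fun o => hier κ A o.rank) ?_).trans
        (card_bUnion_le hl ?_ ?_)
      · rw [hier_limit _ _ hβ]
        intro a ha
        obtain ⟨⟨γ, hγ⟩, ha⟩ := ZFSet.mem_iUnion.1 ha
        exact mem_bUnion.2 ⟨γ.toZFSet, Ordinal.toZFSet_mem_toZFSet_iff.2 hγ, by
          rwa [Ordinal.rank_toZFSet]⟩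
      · rw [Ordinal.card_toZFSet]
        have := Ordinal.card_le_card hβ'
        rw [card_ord] at this
        exact this.trans hle
      · intro i hi
        obtain ⟨γ, hγ, rfl⟩ := Ordinal.mem_toZFSet_iff.1 hi
        rw [Ordinal.rank_toZFSet]
        exact ih γ hγ (hγ.le.trans hβ')
  exact this _ le_rfl

end hier

theorem mk_tuples_le {α : Type (u + 1)} {lam : Cardinal.{u}} (hl : ℵ₀ ≤ lam) {s : Set α}
    (hs : #s ≤ lift.{u + 1} lam) (k : ℕ) :
    #{a : Fin k → α | ∀ i, a i ∈ s} ≤ lift.{u + 1} lam := by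
  have hl' : ℵ₀ ≤ Cardinal.lift.{u + 1} lam := by rwa [aleph0_le_lift]
  have h1 : #{a : Fin k → α | ∀ i, a i ∈ s} ≤ #(Fin k → s) :=
    mk_le_of_injective (f := fun a i => ⟨a.1 i, a.2 i⟩) fun a b hab => by
      apply Subtype.ext
      ext1 i
      exact congrArg Subtype.val (congrFun hab i)
  refine h1.trans ?_
  have : #(Fin k → s) = #s ^ k := by simp
  rw [this]
  exact (pow_le_pow_left' hs k).trans (power_nat_le hl')

/-! ### Threads give Π¹₁-indescribability. -/

section

variable {κ lam : Cardinal.{u}} {W : ZFSet.{u}}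

/-- For `U`-almost all `x`, the hierarchy over `x` is traced out on `V_κ(κ, λ)` by `x`. -/
theorem Ev.trace_bigV (hle : κ ≤ lam) (hκ : κ.IsInaccessible) {c : ZFSet.{u} → ZFSet.{u}}
    (hc : Set.InjOn c (bigV κ (cset lam) : Set ZFSet.{u}))
    (hc' : ∀ a ∈ bigV κ (cset lam), c a ∈ cset lam) :
    Ev κ lam (fun U => (∀ a ∈ bigV κ (cset lam), ∀ᶠ x in U, a ∈ bigV (kap κ x) x) ∧
      ∀ᶠ x in U, ∀ a ∈ bigV (kap κ x) x, a ∈ bigV κ (cset lam) ∧ c a ∈ x) := by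
  have hl : ℵ₀ ≤ lam := hκ.aleph0_lt.le.trans hle
  -- D z is the set whose elements have their codes in z. Every subset of V_κ(κ, λ) of size less
  -- than κ is D z for some z ∈ P_κ λ, so closure of x under z ↦ c (D z) handles a successor step of
  -- the hierarchy.
  let D : ZFSet.{u} → ZFSet.{u} := fun z => ZFSet.sep (fun a => c a ∈ z) (bigV κ (cset lam))
  refine ((Ev.inaccessible hle hκ).and hl ((Ev.fine_Pk hle hκ).and hl
    ((Ev.regressive hl fun x ξ => c ξ ∉ x).and hl
    (Ev.regressive_Pk hle hκ fun x z => c (D z) ∉ x)))).mono ?_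
  rintro U hU ⟨h1, h2, h3, h4⟩
  refine ⟨?_, ?_⟩
  · refine bigV_induction (fun a ha => ?_) fun y hy hyc h => ?_
    · filter_upwards [hU.fine a ha] with x hx
      exact subset_bigV hx
    · have hcy := hU.fine (cset y.card) (cset_subset_cset.2 hle (cset_mem_cset.2 hyc))
      filter_upwards [h1, hU.complete y hyc (fun a x => a ∈ bigV (kap κ x) x) h, hcy]
        with x hx hx' hx''
      refine mem_bigV_of_subset hx.2.isRegular hx' ?_
      rw [← cset_mem_cset, ← hx.1]
      exact ZFSet.mem_inter.2 ⟨hx'', cset_mem_cset.2 hyc⟩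
  · have e1 : ∀ᶠ x in U, ∀ ξ ∈ x, c ξ ∈ x := by
      by_contra hcon
      rw [not_eventually] at hcon
      obtain ⟨η, hη, hη'⟩ := h3 (hcon.mono fun x hx => by push Not at hx; exact hx)
      obtain ⟨x, hx, hx'⟩ := (hη'.and_eventually
        (hU.fine _ (hc' _ (subset_bigV hη)))).exists
      exact hx hx'
    have hD : ∀ z ∈ Pk κ (cset lam), D z ∈ bigV κ (cset lam) := by
      intro z hz
      refine mem_bigV_of_subset hκ.isRegular ZFSet.sep_subset (lt_of_le_of_lt ?_ (mem_Pk.1 hz).2)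
      rw [card_le_iff]
      refine le_trans ?_ (card_le_iff.1 (le_refl z.card))
      refine mk_le_of_injective (f := fun a => ⟨c a.1, (ZFSet.mem_sep.1 a.2).2⟩) ?_
      intro a b hab
      exact Subtype.ext (hc (ZFSet.mem_sep.1 a.2).1 (ZFSet.mem_sep.1 b.2).1
        (congrArg Subtype.val hab))
    have e2 : ∀ᶠ x in U, ∀ z ∈ Pk (kap κ x) x, c (D z) ∈ x := by
      by_contra hcon
      rw [not_eventually] at hcon
      obtain ⟨s, hs, hs'⟩ := h4 (hcon.mono fun x hx => by push Not at hx; exact hx)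
      obtain ⟨x, hx, hx'⟩ := (hs'.and_eventually (hU.fine _ (hc' _ (hD s hs)))).exists
      exact hx hx'
    filter_upwards [e1, e2, h1, hU.pk] with x hx1 hx2 hx3 hx4
    have hx4 := mem_Pk.1 hx4
    refine bigV_induction (fun a ha => ⟨subset_bigV (hx4.1 ha), hx1 a ha⟩) fun y _ hyc h => ?_
    have hyV : y ⊆ bigV κ (cset lam) := fun a ha => (h a ha).1
    have hy : y = D (img c y) := by
      ext a
      refine ⟨fun ha => ZFSet.mem_sep.2 ⟨hyV ha, mem_img_of_mem ha⟩, fun ha => ?_⟩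
      obtain ⟨ha, ha'⟩ := ZFSet.mem_sep.1 ha
      obtain ⟨b, hb, hba⟩ := mem_img.1 ha'
      rwa [← hc (hyV hb) ha hba]
    refine ⟨mem_bigV_of_subset hκ.isRegular hyV
      (hyc.trans ((kap_le_card x).trans_lt hx4.2)), ?_⟩
    rw [hy]
    refine hx2 _ (mem_Pk.2 ⟨fun a ha => ?_, (card_img_le _ _).trans_lt hyc⟩)
    obtain ⟨b, hb, rfl⟩ := mem_img.1 ha
    exact (h b hb).2

theorem tval_congr {P : Type} {k : ℕ} {s : Set ZFSet.{u}} {a : Fin k → ZFSet.{u}}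
    (ha : ∀ i, a i ∈ s) (t : (langP P).Term (Empty ⊕ Fin k)) : tval a t ∈ s := by
  match t with
  | .var (.inl e) => exact e.elim
  | .var (.inr i) => exact ha i
  | .func f _ => exact Empty.elim f

theorem snoc_mem {k : ℕ} {s : Set ZFSet.{u}} {a : Fin k → ZFSet.{u}}
    (ha : ∀ i, a i ∈ s) {b : ZFSet.{u}} (hb : b ∈ s) :
    ∀ i, (Fin.snoc a b : Fin (k + 1) → ZFSet.{u}) i ∈ s := by
  intro i
  refine Fin.lastCases ?_ (fun i => ?_) i
  · simpa using hb
  · simpa using ha i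

/-- A form of Łoś's theorem: a structure that is traced out almost everywhere by `D x` satisfies
a formula iff almost all `D x` do. -/
theorem Ev.sat_iff (hl : ℵ₀ ≤ lam) {P : Type} {V : Set ZFSet.{u}}
    (hV : #V ≤ lift.{u + 1} lam) {c : ZFSet.{u} → ZFSet.{u}} (hc : Set.InjOn c V)
    {D : ZFSet.{u} → Set ZFSet.{u}} {J : ZFSet.{u} → P → Set ZFSet.{u}}
    {Js : Filter ZFSet.{u} → P → Set ZFSet.{u}} {k : ℕ}
    (φ : (langP P).BoundedFormula Empty k) :
    Ev κ lam (fun U => (∀ a ∈ V, ∀ᶠ x in U, a ∈ D x) → (∀ᶠ x in U, ∀ a ∈ D x, a ∈ V ∧ c a ∈ x) →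
      (∀ p, ∀ a ∈ V, ∀ᶠ x in U, a ∈ J x p ↔ a ∈ Js U p) →
      ∀ a : Fin k → ZFSet.{u}, (∀ i, a i ∈ V) →
        ∀ᶠ x in U, Sat (D x) (J x) φ a ↔ Sat V (Js U) φ a) := by
  induction φ with
  | falsum => exact Ev.of_base fun U _ _ _ _ a _ => Eventually.of_forall fun x => Iff.rfl
  | equal t s => exact Ev.of_base fun U _ _ _ _ a _ => Eventually.of_forall fun x => Iff.rfl
  | rel R ts =>
    refine Ev.of_base fun U _ _ _ h a ha => ?_
    cases R with
    | mem => exact Eventually.of_forall fun x => Iff.rfl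
    | pred p => exact h p _ (tval_congr ha _)
  | imp φ ψ ih1 ih2 =>
    refine (ih1.and hl ih2).mono ?_
    rintro U hU ⟨h1, h2⟩ hd1 hd2 hJ a ha
    filter_upwards [h1 hd1 hd2 hJ a ha, h2 hd1 hd2 hJ a ha] with x hx1 hx2
    simp only [Sat, hx1, hx2]
  | @all k φ ih =>
    -- A counterexample b in D x has its code c b in x. Choosing the code is therefore regressive,
    -- and one choice for each of the at most λ many tuples from V suffices.
    refine (ih.and hl (Ev.forall hl (mk_tuples_le hl hV k) fun a _ =>
      Ev.regressive hl fun x ξ => ∃ b ∈ V, c b = ξ ∧ b ∈ D x ∧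
        ¬ Sat (D x) (J x) φ (Fin.snoc a b))).mono ?_
    rintro U hU ⟨h1, h2⟩ hd1 hd2 hJ a ha
    by_cases hs : Sat V (Js U) (.all φ) a
    · simp only [hs, iff_true]
      by_contra hcon
      rw [not_eventually] at hcon
      obtain ⟨η, -, hη⟩ := h2 a ha ((hcon.and_eventually hd2).mono fun x ⟨hx, hx'⟩ => by
        simp only [Sat] at hx
        push Not at hx
        obtain ⟨b, hb, hb'⟩ := hx
        exact ⟨c b, (hx' b hb).2, b, (hx' b hb).1, rfl, hb, hb'⟩)
      obtain ⟨x, b, hb, hbη, -⟩ := hη.exists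
      have hb' : ∃ᶠ x in U, ¬ Sat (D x) (J x) φ (Fin.snoc a b) := by
        refine hη.mono ?_
        rintro x ⟨b', hb', hbη', -, hx⟩
        rwa [hc hb hb' (hbη.trans hbη'.symm)]
      obtain ⟨x, hx, hx'⟩ := (hb'.and_eventually
        (h1 hd1 hd2 hJ _ (snoc_mem ha hb))).exists
      exact hx (hx'.2 (hs b hb))
    · simp only [hs, iff_false]
      simp only [Sat] at hs
      push Not at hs
      obtain ⟨b, hb, hb'⟩ := hs
      filter_upwards [hd1 b hb, h1 hd1 hd2 hJ _ (snoc_mem ha hb)] with x hx hx' hall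
      exact hb' (hx'.1 (hall b hx))

/-- Suppose φ failed at every relevant x ∈ W, through sets Y x. The filter decides a ∈ Y x i for
each a in V_κ(κ, λ), and by Łoś the resulting limit sets refute φ in V_κ(κ, λ). -/
theorem Threadable.indescribable (hle : κ ≤ lam) (hpow : lam ^< κ ≤ lam)
    (hκ : κ.IsInaccessible) (hW : W ⊆ Pk κ (cset lam)) (h : Threadable κ lam W) :
    PiOneOneIndescribable κ lam W := by
  classical
  intro R hR φ hφ
  by_contra hcon
  push Not at hcon
  have hl : ℵ₀ ≤ lam := hκ.aleph0_lt.le.trans hle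
  have hV : #(bigV κ (cset lam) : Set ZFSet.{u}) ≤ lift.{u + 1} lam :=
    card_le_iff.1 (card_bigV_le hle hl hpow (card_cset lam).le)
  obtain ⟨c, hc, hc'⟩ := exists_code hV
  have hY : ∀ x ∈ W, x ∩ cset κ = cset (kap κ x) → ∃ Y : Fin φ.n → Set ZFSet.{u},
      ¬ Sat (bigV (kap κ x) x : Set ZFSet.{u}) (interp (R ∩ bigV (kap κ x) x) Y) φ.matrix
        Fin.elim0 := by
    intro x hx hx'
    have := hcon x hx hx'
    rw [PiOneOne.holds_iff] at this
    push Not at this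
    exact this
  choose! Y hY using hY
  have hdec : ∀ i : Fin φ.n, Ev κ lam (fun U => ∀ a ∈ (bigV κ (cset lam) : Set ZFSet.{u}),
      (∀ᶠ x in U, a ∈ Y x i) ∨ ∀ᶠ x in U, a ∉ Y x i) := fun i =>
    Ev.forall hl hV fun a _ => Ev.decide hl fun x => a ∈ Y x i
  have hdec' : Ev κ lam (fun U => ∀ i ∈ (Set.univ : Set (ULift.{u + 1} (Fin φ.n))),
      ∀ a ∈ (bigV κ (cset lam) : Set ZFSet.{u}),
      (∀ᶠ x in U, a ∈ Y x i.down) ∨ ∀ᶠ x in U, a ∉ Y x i.down) :=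
    Ev.forall hl (mk_le_aleph0.trans (by rwa [aleph0_le_lift])) fun i _ => hdec i.down
  obtain ⟨U, hU, hUW, ⟨h1, h1'⟩, h2, h3, h4⟩ := h.exists_filter hle hκ.isRegular hW
    ((Ev.trace_bigV hle hκ hc hc').and hl ((Ev.inaccessible hle hκ).and hl (hdec'.and hl
      (Ev.sat_iff hl hV hc (D := fun x => bigV (kap κ x) x)
        (J := fun x => interp (R ∩ bigV (kap κ x) x) (Y x))
        (Js := fun U => interp R fun i => {a | ∀ᶠ x in U, a ∈ Y x i}) φ.matrix))))
  have := hU.neBot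
  have h5 := h4 h1 h1' (by
    rintro (_ | i) a ha
    · filter_upwards [h1 a ha] with x hx
      exact ⟨fun h => (ZFSet.mem_inter.1 h).1, fun h => ZFSet.mem_inter.2 ⟨h, hx⟩⟩
    · rcases h3 ⟨i⟩ trivial a ha with h | h
      · filter_upwards [h] with x hx
        exact ⟨fun _ => h, fun _ => hx⟩
      · filter_upwards [h] with x hx
        refine ⟨fun h' => absurd h' hx, fun h' => ?_⟩
        obtain ⟨y, hy, hy'⟩ := (h.and h').exists
        exact absurd hy' hy) Fin.elim0 (fun i => i.elim0)
  obtain ⟨x, hx1, hx2, hx3⟩ := (h5.and (hUW.and h2)).exists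
  exact hY x hx2 hx3.1 (hx1.2 ((φ.holds_iff _ _).1 hφ _))

end

/-! ### Π¹₁-indescribability gives threads. -/

/-- Conjunction. -/
def andF {P : Type} {k : ℕ} (φ ψ : (langP P).BoundedFormula Empty k) :
    (langP P).BoundedFormula Empty k := (φ.imp (ψ.imp .falsum)).imp .falsum

/-- Existential quantification. -/
def exF {P : Type} {k : ℕ} (φ : (langP P).BoundedFormula Empty (k + 1)) :
    (langP P).BoundedFormula Empty k := (φ.imp .falsum).all.imp .falsum

/-- Negation. -/
def notF {P : Type} {k : ℕ} (φ : (langP P).BoundedFormula Empty k) :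
    (langP P).BoundedFormula Empty k := φ.imp .falsum

section sentence

variable {P : Type} {D : Set ZFSet.{u}} {J : P → Set ZFSet.{u}} {k : ℕ}

/-- The formula `x_i ∈ x_j`. -/
def memF (i j : Fin k) : (langP P).BoundedFormula Empty k :=
  .rel (SetRel.mem : (langP P).Relations 2) ![.var (.inr i), .var (.inr j)]

/-- The formula `p(x_i)`. -/
def predF (p : P) (i : Fin k) : (langP P).BoundedFormula Empty k :=
  .rel (SetRel.pred p : (langP P).Relations 1) ![.var (.inr i)]

/-- The formula `x_i = x_j`. -/
def eqF (i j : Fin k) : (langP P).BoundedFormula Empty k :=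
  .equal (.var (.inr i)) (.var (.inr j))

theorem sat_memF {i j : Fin k} {a : Fin k → ZFSet.{u}} :
    Sat D J (memF i j) a ↔ a i ∈ a j := Iff.rfl

theorem sat_predF {p : P} {i : Fin k} {a : Fin k → ZFSet.{u}} :
    Sat D J (predF p i) a ↔ a i ∈ J p := Iff.rfl

theorem sat_eqF {i j : Fin k} {a : Fin k → ZFSet.{u}} :
    Sat D J (eqF i j) a ↔ a i = a j := Iff.rfl

theorem sat_imp {φ ψ : (langP P).BoundedFormula Empty k} {a : Fin k → ZFSet.{u}} :
    Sat D J (φ.imp ψ) a ↔ (Sat D J φ a → Sat D J ψ a) := Iff.rfl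

theorem sat_not {φ : (langP P).BoundedFormula Empty k} {a : Fin k → ZFSet.{u}} :
    Sat D J (notF φ) a ↔ ¬ Sat D J φ a := Iff.rfl

theorem sat_and {φ ψ : (langP P).BoundedFormula Empty k} {a : Fin k → ZFSet.{u}} :
    Sat D J (andF φ ψ) a ↔ Sat D J φ a ∧ Sat D J ψ a := by
  simp only [andF, Sat]; tauto

theorem sat_all {φ : (langP P).BoundedFormula Empty (k + 1)} {a : Fin k → ZFSet.{u}} :
    Sat D J φ.all a ↔ ∀ b ∈ D, Sat D J φ (Fin.snoc a b) := Iff.rfl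

theorem sat_ex {φ : (langP P).BoundedFormula Empty (k + 1)} {a : Fin k → ZFSet.{u}} :
    Sat D J (exF φ) a ↔ ∃ b ∈ D, Sat D J φ (Fin.snoc a b) := by
  simp only [exF, Sat, imp_false, not_forall, not_not, exists_prop]

end sentence

/-- Some element of an element of `x₀` satisfies `R`. -/
def testF : (langP (Option (Fin 1))).BoundedFormula Empty 1 :=
  exF (exF (andF (memF 1 0) (andF (memF 2 1) (predF none 2))))

/-- The sentence saying that no `X` is a thread, relative to the coding of
`Threadable.of_indescribable`. -/
def threadSentence : PiOneOne where
  n := 1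
  matrix := andF
    (exF (andF (predF none 0) (exF (exF (andF (memF 1 0) (andF (memF 2 0)
      (notF (eqF 1 2))))))))
    (exF (andF (predF none 0) (andF (testF.imp ((memF 1 0).imp (predF (some 0) 1)).all)
      ((notF testF).imp ((memF 0 1).imp (notF (predF (some 0) 1))).all))))

/-- The meaning of `testF`. -/
def Test (D R : ZFSet.{u}) (r : ZFSet.{u}) : Prop := ∃ d ∈ D, ∃ e ∈ D, d ∈ r ∧ e ∈ d ∧ e ∈ R

theorem sat_testF {D R r : ZFSet.{u}} {Y : Fin 1 → Set ZFSet.{u}} :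
    Sat (D : Set ZFSet.{u}) (interp R Y) testF (Fin.snoc Fin.elim0 r) ↔ Test D R r := by
  simp only [testF, sat_ex, sat_and, sat_memF, sat_predF, Test]
  exact Iff.rfl

theorem sat_threadSentence {D R : ZFSet.{u}} {Y : Fin 1 → Set ZFSet.{u}} :
    Sat (D : Set ZFSet.{u}) (interp R Y) threadSentence.matrix Fin.elim0 ↔
      (∃ r ∈ D, r ∈ R ∧ ∃ c ∈ D, ∃ d ∈ D, c ∈ r ∧ d ∈ r ∧ c ≠ d) ∧
      ∃ r ∈ D, r ∈ R ∧ (Test D R r → ∀ c ∈ D, c ∈ r → c ∈ Y 0) ∧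
        (¬ Test D R r → ∀ c ∈ D, r ∈ c → c ∉ Y 0) := by
  simp only [threadSentence, sat_ex, sat_and, sat_imp, sat_all, sat_not, sat_memF,
    sat_predF, sat_eqF, sat_testF]
  exact Iff.rfl

theorem empty_mem_of_isOrdinal {a : ZFSet.{u}} (ha : a.IsOrdinal) (h : a ≠ ∅) : ∅ ∈ a := by
  rcases (ZFSet.isOrdinal_empty.subset_iff_eq_or_mem ha).1 (ZFSet.empty_subset a) with h' | h'
  · exact absurd h'.symm h
  · exact h'

theorem singleton_ne_empty (a : ZFSet.{u}) : ({a} : ZFSet.{u}) ≠ ∅ := fun h =>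
  ZFSet.notMem_empty a (h ▸ ZFSet.mem_singleton.2 rfl)

/-- The marker `{{i}}`. -/
def marker (i : ZFSet.{u}) : ZFSet.{u} := {{i}}

/-- The code `{{{i}}, η}` of the pair `(i, η)`. -/
def literal (i η : ZFSet.{u}) : ZFSet.{u} := {marker i, η}

/-- Nonempty ordinals contain ∅. This separates markers and literals from members of λ, which sit at
the bottom of the same hierarchy. -/
theorem not_isOrdinal_of {a : ZFSet.{u}} (h : a ≠ ∅) (h' : ∅ ∉ a) : ¬ a.IsOrdinal :=
  fun ho => h' (empty_mem_of_isOrdinal ho h)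

theorem not_isOrdinal_marker (i : ZFSet.{u}) : ¬ (marker i).IsOrdinal :=
  not_isOrdinal_of (singleton_ne_empty _) fun h =>
    singleton_ne_empty i (ZFSet.mem_singleton.1 h).symm

theorem marker_inj {i j : ZFSet.{u}} (h : marker i = marker j) : i = j :=
  ZFSet.singleton_injective (ZFSet.singleton_injective h)

theorem marker_mem_literal (i η : ZFSet.{u}) : marker i ∈ literal i η :=
  ZFSet.mem_pair.2 (Or.inl rfl)

theorem eq_of_marker_mem_literal {i j η : ZFSet.{u}} (hη : η.IsOrdinal)
    (h : marker i ∈ literal j η) : i = j := by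
  rcases ZFSet.mem_pair.1 h with h | h
  · exact marker_inj h
  · exact absurd (h ▸ hη) (not_isOrdinal_marker i)

theorem literal_inj {i j η θ : ZFSet.{u}} (hη : η.IsOrdinal) (hθ : θ.IsOrdinal)
    (h : literal i η = literal j θ) : i = j ∧ η = θ := by
  refine ⟨eq_of_marker_mem_literal hθ (h ▸ marker_mem_literal i η), ?_⟩
  have : η ∈ literal j θ := h ▸ ZFSet.mem_pair.2 (Or.inr rfl)
  rcases ZFSet.mem_pair.1 this with h | h
  · exact absurd (h ▸ hη) (not_isOrdinal_marker j)
  · exact h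

theorem mem_hier_add_one {κ : Cardinal.{u}} {A a : ZFSet.{u}} {α : Ordinal.{u}}
    (h : a ⊆ hier κ A α) (hc : a.card < κ) : a ∈ hier κ A (α + 1) := by
  rw [hier_add_one]
  exact ZFSet.mem_union.2 (Or.inl (mem_Pk.2 ⟨h, hc⟩))

/-- Literals are two-element sets appearing within three levels; 2 < κ is what both facts need.
Nothing infinite is assumed, because the reflecting κ_x is not known to be infinite. -/
theorem literal_mem_bigV {κ : Cardinal.{u}} (hκ : 2 < κ) {x i η : ZFSet.{u}} (hi : i ∈ x)
    (hη : η ∈ x) : literal i η ∈ bigV κ x ∧ marker i ∈ bigV κ x := by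
  have h1κ : 1 < κ := lt_trans (by norm_num) hκ
  have h1 : {i} ∈ hier κ x (0 + 1) := mem_hier_add_one (fun a ha => by
    rw [ZFSet.mem_singleton.1 ha, hier_zero]; exact hi) (by rwa [ZFSet.card_singleton])
  have h2 : marker i ∈ hier κ x (0 + 1 + 1) := mem_hier_add_one (fun a ha => by
    rw [ZFSet.mem_singleton.1 ha]; exact h1) (by rwa [marker, ZFSet.card_singleton])
  have h3 : literal i η ∈ hier κ x (0 + 1 + 1 + 1) := mem_hier_add_one (fun a ha => by
    rcases ZFSet.mem_pair.1 ha with rfl | rfl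
    · exact h2
    · refine hier_mono (α := 0) (zero_le (a := (0 + 1 + 1 : Ordinal.{u}))) ?_
      rw [hier_zero]; exact hη) ((card_pair_le _ _).trans_lt hκ)
  have hle : (0 + 1 + 1 + 1 : Ordinal.{u}) ≤ κ.ord := by
    rw [Order.add_one_le_iff, lt_ord]
    simp only [Ordinal.card_add, Ordinal.card_zero, Ordinal.card_one]
    rwa [zero_add, one_add_one_eq_two]
  exact ⟨hier_mono hle h3, hier_mono ((Order.le_succ _).trans hle) h2⟩

/-- A set X of literals (i, η) is read as the valuation "f(i) = η". The predicate R lists clauses,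
and the sentence says that every X violates one of them. It cannot reflect to x ∈ W, where the
literals (i, g i x) satisfy all clauses; so it fails in V_κ(κ, λ), and a valuation satisfying all
clauses yields a thread. -/
theorem Threadable.of_indescribable {κ lam : Cardinal.{u}} {W : ZFSet.{u}} (hle : κ ≤ lam)
    (hκ : κ.IsInaccessible) (hW : W ⊆ Pk κ (cset lam)) (h : PiOneOneIndescribable κ lam W) :
    Threadable κ lam W := by
  intro g hg
  have hreg := hκ.isRegular
  have h2κ : 2 < κ := by exact_mod_cast hκ.nat_lt 2
  have h0 : ∅ ∈ cset lam := empty_mem_cset (hκ.pos.trans_le hle).ne'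
  have h1 : {∅} ∈ cset lam := singleton_empty_mem_cset (hκ.aleph0_lt.le.trans hle)
  have hne01 : (∅ : ZFSet.{u}) ≠ {∅} := (singleton_ne_empty ∅).symm
  have ord_lam : ∀ {i}, i ∈ cset lam → i.IsOrdinal := fun h => isOrdinal_of_mem_cset h
  set V := bigV κ (cset lam) with hVdef
  let G : ZFSet.{u} → ZFSet.{u} → Prop := fun x c => ∃ i ∈ x, c = literal i (g i x)
  let Lit : ZFSet.{u} → Prop := fun c => ∃ i ∈ cset lam, ∃ η ∈ cset lam, c = literal i η
  -- A marker of i is the positive clause "some c ∈ X contains this marker". A set r of the second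
  -- or third kind is the negative clause "not all elements of r are in X". The second kind forbids
  -- small sets of literals that no g · x realizes, and the third forbids elements that carry a
  -- marker without being literals.
  let T1 : ZFSet.{u} → Prop := fun r => ∃ i ∈ cset lam, r = marker i
  let T2 : ZFSet.{u} → Prop := fun r => r ≠ ∅ ∧ (∀ c ∈ r, Lit c) ∧ ∀ x ∈ W, ∃ c ∈ r, ¬ G x c
  let T3 : ZFSet.{u} → Prop := fun r => ∃ c, r = {c} ∧ (∃ i ∈ cset lam, marker i ∈ c) ∧ ¬ Lit c
  let R : ZFSet.{u} := ZFSet.sep (fun r => T1 r ∨ T2 r ∨ T3 r) V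
  have hR : ∀ {r}, r ∈ R ↔ r ∈ V ∧ (T1 r ∨ T2 r ∨ T3 r) := ZFSet.mem_sep
  have hT23 : ∀ r, T2 r ∨ T3 r → r ≠ ∅ ∧ ∀ c ∈ r, ∃ i ∈ cset lam, marker i ∈ c := by
    rintro r (⟨hr, hr', -⟩ | ⟨c, rfl, hc, -⟩)
    · refine ⟨hr, fun c hc => ?_⟩
      obtain ⟨i, hi, η, -, rfl⟩ := hr' c hc
      exact ⟨i, hi, marker_mem_literal i η⟩
    · exact ⟨singleton_ne_empty c, fun c' hc' => by rwa [ZFSet.mem_singleton.1 hc']⟩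
  have hnotord : ∀ r ∈ R, ¬ r.IsOrdinal := by
    intro r hr
    rcases (hR.1 hr).2 with ⟨i, -, rfl⟩ | hr
    · exact not_isOrdinal_marker i
    · refine not_isOrdinal_of (hT23 r hr).1 fun h => ?_
      obtain ⟨i, -, hi⟩ := (hT23 r hr).2 ∅ h
      exact ZFSet.notMem_empty _ hi
  have hmarkerV : ∀ i ∈ cset lam, marker i ∈ R := fun i hi =>
    hR.2 ⟨(literal_mem_bigV h2κ hi hi).2, Or.inl ⟨i, hi, rfl⟩⟩
  have hnotord' : ∀ {c i : ZFSet.{u}}, marker i ∈ c → ¬ c.IsOrdinal := fun hi hc =>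
    not_isOrdinal_marker _ (hc.mem hi)
  -- `Test` tells the two sorts of clauses apart by a first-order condition. The only element of an
  -- element of marker i is the ordinal i, which is not in R, whereas each element of a negative
  -- clause contains a marker, which is in R.
  have htest1 : ∀ (D R' : ZFSet.{u}) i, R' ⊆ R → i ∈ cset lam → ¬ Test D R' (marker i) := by
    rintro D R' i hR' hi ⟨d, -, e, -, hd, he, heR⟩
    rw [ZFSet.mem_singleton.1 hd] at he
    rw [ZFSet.mem_singleton.1 he] at heR
    exact hnotord i (hR' heR) (ord_lam hi)
  have hsubV : ∀ (μ : Cardinal.{u}) (x a : ZFSet.{u}), x ⊆ cset lam → ¬ a.IsOrdinal →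
      a ∈ bigV μ x → a ⊆ bigV μ x ∧ a.card < μ := by
    intro μ x a hx ha haV
    rcases subset_bigV_of_mem haV with h | h
    · exact absurd (ord_lam (hx h)) ha
    · exact h
  have htest2 : ∀ (μ : Cardinal.{u}) (x r : ZFSet.{u}), x ⊆ cset lam → r ∈ R →
      r ∈ bigV μ x → T2 r ∨ T3 r → Test (bigV μ x) (R ∩ bigV μ x) r := by
    intro μ x r hx hrR hr hT
    obtain ⟨hne, hm⟩ := hT23 r hT
    rcases ZFSet.eq_empty_or_nonempty r with rfl | ⟨c, hc⟩
    · exact absurd rfl hne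
    obtain ⟨i, hi, hic⟩ := hm c hc
    have hcD := (hsubV μ x r hx (hnotord r hrR) hr).1 hc
    have hiD := (hsubV μ x c hx (hnotord' hic) hcD).1 hic
    exact ⟨c, hcD, _, hiD, hc, hic, ZFSet.mem_inter.2 ⟨hmarkerV i hi, hiD⟩⟩
  have hRV : R ⊆ V := fun r hr => (hR.1 hr).1
  have hRint : R ∩ V = R := by
    ext r; exact ⟨fun h => (ZFSet.mem_inter.1 h).1, fun h => ZFSet.mem_inter.2 ⟨h, hRV h⟩⟩
  have hLitV : ∀ c, Lit c → c ∈ V := by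
    rintro c ⟨i, hi, η, hη, rfl⟩
    exact (literal_mem_bigV h2κ hi hη).1
  by_cases hholds : threadSentence.Holds V R
  · exfalso
    obtain ⟨x, hxW, hxκ, hx⟩ := h R hRV threadSentence hholds
    have hxlam := (mem_Pk.1 (hW hxW)).1
    obtain ⟨⟨r, hrD, hrR, c, -, d, -, hc, hd, hcd⟩, r', hrD', hrR', hr1, hr2⟩ :=
      sat_threadSentence.1 ((threadSentence.holds_iff _ _).1 hx fun _ => {c | G x c})
    have hrR := (ZFSet.mem_inter.1 hrR).1
    have hrR' := (ZFSet.mem_inter.1 hrR').1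
    -- The first conjunct of the sentence is there for this: a set with two distinct elements in the
    -- hierarchy over x forces 2 < κ_x, so that literals over x belong to it.
    have hkap : 2 < kap κ x := by
      refine lt_of_le_of_lt ?_ (hsubV _ x r hxlam (hnotord r hrR) hrD).2
      rw [← ZFSet.card_pair_of_ne hcd]
      refine ZFSet.card_mono fun a ha => ?_
      rcases ZFSet.mem_pair.1 ha with rfl | rfl
      · exact hc
      · exact hd
    rcases (hR.1 hrR').2 with ⟨i, hi, rfl⟩ | hT
    · have hix : i ∈ x := by
        have hs : {i} ∈ bigV (kap κ x) x :=
          (hsubV _ x _ hxlam (not_isOrdinal_marker i) hrD').1 (ZFSet.mem_singleton.2 rfl)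
        rcases subset_bigV_of_mem hs with hs | hs
        · have : {i} ∈ x ∩ cset κ := ZFSet.mem_inter.2 ⟨hs, mem_cset_of_isOrdinal
            (ord_lam (hxlam hs)) (by
              rw [ZFSet.card_singleton]; exact one_lt_aleph0.trans hκ.aleph0_lt)⟩
          rw [hxκ] at this
          have := subset_cset_of_mem this (ZFSet.mem_singleton.2 rfl)
          rw [← hxκ] at this
          exact (ZFSet.mem_inter.1 this).1
        · rcases subset_bigV_of_mem (hs.1 (ZFSet.mem_singleton.2 rfl)) with hs | hs
          · exact hs
          · have := mem_cset_of_isOrdinal (ord_lam hi) hs.2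
            rw [← hxκ] at this
            exact (ZFSet.mem_inter.1 this).1
      refine hr2 (htest1 _ _ i (fun a ha => (ZFSet.mem_inter.1 ha).1) hi) _
        (literal_mem_bigV hkap hix (hg x hxW i hix)).1 (marker_mem_literal i _) ⟨i, hix, rfl⟩
    · have hall := hr1 (htest2 _ x r' hxlam hrR' hrD' hT)
      have hsub := (hsubV _ x r' hxlam (hnotord r' hrR') hrD').1
      rcases hT with ⟨-, -, hbad⟩ | ⟨c, rfl, -, hnl⟩
      · obtain ⟨c, hc, hcG⟩ := hbad x hxW
        exact hcG (hall c (hsub hc) hc)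
      · obtain ⟨i, hi, rfl⟩ := hall c (hsub (ZFSet.mem_singleton.2 rfl)) (ZFSet.mem_singleton.2 rfl)
        exact hnl ⟨i, hxlam hi, _, hxlam (hg x hxW i hi), rfl⟩
  · rw [PiOneOne.holds_iff] at hholds
    push Not at hholds
    obtain ⟨Y, hY⟩ : ∃ Y : Fin 1 → Set ZFSet.{u}, ¬ Sat (V : Set ZFSet.{u}) (interp R Y)
        threadSentence.matrix Fin.elim0 := hholds
    have hY' := mt sat_threadSentence.2 hY
    -- This shows that the sentence does not fail through its first conjunct. Two literals giving ∅
    -- different values are never realized together, so their pair is a clause.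
    have hpair : ∃ r ∈ V, r ∈ R ∧ ∃ c ∈ V, ∃ d ∈ V, c ∈ r ∧ d ∈ r ∧ c ≠ d := by
      have hc : Lit (literal ∅ ∅) := ⟨∅, h0, ∅, h0, rfl⟩
      have hd : Lit (literal ∅ {∅}) := ⟨∅, h0, {∅}, h1, rfl⟩
      have hr : ({literal ∅ ∅, literal ∅ {∅}} : ZFSet.{u}) ∈ V := by
        refine mem_bigV_of_subset hreg (fun a ha => ?_) ((card_pair_le _ _).trans_lt h2κ)
        rcases ZFSet.mem_pair.1 ha with rfl | rfl
        · exact hLitV _ hc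
        · exact hLitV _ hd
      refine ⟨_, hr, hR.2 ⟨hr, Or.inr (Or.inl ⟨?_, fun a ha => ?_, fun x hx => ?_⟩)⟩, _, hLitV _ hc,
        _, hLitV _ hd, ZFSet.mem_pair.2 (Or.inl rfl), ZFSet.mem_pair.2 (Or.inr rfl), fun heq =>
          hne01 (literal_inj (ord_lam h0) (ord_lam h1) heq).2⟩
      · intro h
        have : literal ∅ ∅ ∈ ({literal ∅ ∅, literal ∅ {∅}} : ZFSet.{u}) :=
          ZFSet.mem_pair.2 (Or.inl rfl)
        rw [h] at this
        exact ZFSet.notMem_empty _ this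
      · rcases ZFSet.mem_pair.1 ha with rfl | rfl
        · exact hc
        · exact hd
      · by_contra hall
        push Not at hall
        have hxlam := (mem_Pk.1 (hW hx)).1
        obtain ⟨i, hi, hi'⟩ := hall (literal ∅ ∅) (ZFSet.mem_pair.2 (Or.inl rfl))
        obtain ⟨j, hj, hj'⟩ := hall (literal ∅ {∅}) (ZFSet.mem_pair.2 (Or.inr rfl))
        obtain ⟨rfl, e1⟩ := literal_inj (ord_lam h0) (ord_lam (hxlam (hg x hx i hi))) hi'
        obtain ⟨rfl, e2⟩ := literal_inj (ord_lam h1) (ord_lam (hxlam (hg x hx j hj))) hj'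
        exact hne01 (e1.trans e2.symm)
    have hX : ∀ r ∈ R, (Test V R r ∧ ∃ c ∈ V, c ∈ r ∧ c ∉ Y 0) ∨
        (¬ Test V R r ∧ ∃ c ∈ V, r ∈ c ∧ c ∈ Y 0) := by
      intro r hr
      by_contra hcon
      push Not at hcon
      exact hY' ⟨hpair, r, hRV hr, hr, hcon.1, hcon.2⟩
    have htestV : ∀ r ∈ R, T2 r ∨ T3 r → Test V R r := by
      intro r hr hT
      have := htest2 κ _ r (fun _ h => h) hr (hRV hr) hT
      rwa [← hVdef, hRint] at this
    have hf : ∀ i ∈ cset lam, ∃ η ∈ cset lam, literal i η ∈ Y 0 := by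
      intro i hi
      rcases hX _ (hmarkerV i hi) with ⟨h, -⟩ | ⟨-, c, hcV, hic, hcY⟩
      · exact absurd h (htest1 V R i (fun _ h => h) hi)
      · have hLit : Lit c := by
          by_contra hnl
          have hT3 : T3 {c} := ⟨c, rfl, ⟨i, hi, hic⟩, hnl⟩
          have hcR : {c} ∈ R := hR.2 ⟨mem_bigV_of_subset hreg (fun a ha => by
            rw [ZFSet.mem_singleton.1 ha]; exact hcV) (by
              rw [ZFSet.card_singleton]; exact one_lt_aleph0.trans hκ.aleph0_lt),
            Or.inr (Or.inr hT3)⟩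
          rcases hX _ hcR with ⟨-, c', -, hc', hcY'⟩ | ⟨h, -⟩
          · rw [ZFSet.mem_singleton.1 hc'] at hcY'
            exact hcY' hcY
          · exact h (htestV _ hcR (Or.inr hT3))
        obtain ⟨j, hj, η, hη, rfl⟩ := hLit
        rw [← eq_of_marker_mem_literal (ord_lam hη) hic] at hcY
        exact ⟨η, hη, hcY⟩
    choose! f hf hfY using hf
    refine ⟨f, fun z hz => ?_⟩
    -- Adding ∅ makes the set of literals nonempty, as clauses of the second kind must be.
    have hz' := union_mem_Pk hκ.aleph0_lt.le (singleton_mem_Pk hκ.aleph0_lt.le h0) hz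
    rw [mem_Pk] at hz'
    set z' := {∅} ∪ z with hz'def
    set r := img (fun i => literal i (f i)) z' with hrdef
    have hmem : ∀ i ∈ z', literal i (f i) ∈ r := fun i hi =>
      mem_img_of_mem (f := fun i => literal i (f i)) hi
    have hLit : ∀ c ∈ r, Lit c := fun c hc => by
      obtain ⟨i, hi, rfl⟩ := mem_img.1 hc
      exact ⟨i, hz'.1 hi, f i, hf i (hz'.1 hi), rfl⟩
    have hrV : r ∈ V := mem_bigV_of_subset hreg (fun c hc => hLitV c (hLit c hc))
      ((card_img_le _ _).trans_lt hz'.2)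
    have hex : ∃ x ∈ W, ∀ c ∈ r, G x c := by
      by_contra hbad
      push Not at hbad
      have hT2 : T2 r := ⟨fun h => by
        have := hmem ∅ (ZFSet.mem_union.2 (Or.inl (ZFSet.mem_singleton.2 rfl)))
        rw [h] at this
        exact ZFSet.notMem_empty _ this, hLit, hbad⟩
      have hrR : r ∈ R := hR.2 ⟨hrV, Or.inr (Or.inl hT2)⟩
      rcases hX r hrR with ⟨-, c, -, hc, hcY⟩ | ⟨h, -⟩
      · obtain ⟨i, hi, rfl⟩ := mem_img.1 hc
        exact hcY (hfY i (hz'.1 hi))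
      · exact h (htestV r hrR (Or.inl hT2))
    obtain ⟨x, hx, hxG⟩ := hex
    have hxlam := (mem_Pk.1 (hW hx)).1
    have key : ∀ i ∈ z, i ∈ x ∧ g i x = f i := by
      intro i hi
      have hi' : i ∈ z' := ZFSet.mem_union.2 (Or.inr hi)
      obtain ⟨j, hj, hij⟩ := hxG _ (hmem i hi')
      obtain ⟨rfl, e⟩ := literal_inj (ord_lam (hf i (hz'.1 hi')))
        (ord_lam (hxlam (hg x hx j hj))) hij
      exact ⟨hj, e.symm⟩
    exact ⟨x, hx, fun i hi => (key i hi).1, fun i hi => (key i hi).2⟩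

/-! ### Sets of hereditary cardinality at most `λ` -/

/-- The class of sets of hereditary cardinality at most `λ`. -/
def HC (lam : Cardinal.{u}) : Set ZFSet.{u} :=
  {a | ZFSet.Hereditarily (fun x => x.card ≤ lam) a}

section HC

variable {lam : Cardinal.{u}} {a b : ZFSet.{u}}

theorem mem_HC_of_subset (h : ∀ b ∈ a, b ∈ HC lam) (hc : a.card ≤ lam) : a ∈ HC lam :=
  ZFSet.hereditarily_iff.2 ⟨hc, h⟩

theorem card_le_of_mem_HC (h : a ∈ HC lam) : a.card ≤ lam := ZFSet.Hereditarily.self h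

theorem mem_HC_of_mem (h : a ∈ HC lam) (hb : b ∈ a) : b ∈ HC lam := ZFSet.Hereditarily.mem h hb

theorem mem_HC_of_subset_mem (h : a ∈ HC lam) (hb : b ⊆ a) : b ∈ HC lam :=
  mem_HC_of_subset (fun _ hc => mem_HC_of_mem h (hb hc))
    ((ZFSet.card_mono hb).trans (card_le_of_mem_HC h))

theorem empty_mem_HC : (∅ : ZFSet.{u}) ∈ HC lam :=
  mem_HC_of_subset (fun b hb => absurd hb (ZFSet.notMem_empty b)) (by simp)

theorem upair_mem_HC (hl : ℵ₀ ≤ lam) (ha : a ∈ HC lam) (hb : b ∈ HC lam) :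
    ({a, b} : ZFSet.{u}) ∈ HC lam := by
  refine mem_HC_of_subset (fun c hc => ?_) ((card_pair_le a b).trans
    ((natCast_lt_aleph0 (n := 2)).le.trans hl))
  rcases ZFSet.mem_pair.1 hc with rfl | rfl
  · exact ha
  · exact hb

theorem pair_mem_HC (hl : ℵ₀ ≤ lam) (ha : a ∈ HC lam) (hb : b ∈ HC lam) :
    ZFSet.pair a b ∈ HC lam := by
  refine upair_mem_HC hl ?_ (upair_mem_HC hl ha hb)
  have := upair_mem_HC hl ha ha
  rwa [ZFSet.pair_eq_singleton] at this

theorem img_mem_HC {f : ZFSet.{u} → ZFSet.{u}} (ha : a.card ≤ lam)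
    (hf : ∀ b ∈ a, f b ∈ HC lam) : img f a ∈ HC lam := by
  refine mem_HC_of_subset (fun c hc => ?_) ((card_img_le f a).trans ha)
  obtain ⟨b, hb, rfl⟩ := mem_img.1 hc
  exact hf b hb

theorem bUnion_mem_HC (hl : ℵ₀ ≤ lam) {f : ZFSet.{u} → ZFSet.{u}} (ha : a.card ≤ lam)
    (hf : ∀ b ∈ a, f b ∈ HC lam) : bUnion a f ∈ HC lam := by
  refine mem_HC_of_subset (fun c hc => ?_)
    (card_bUnion_le hl ha fun b hb => card_le_of_mem_HC (hf b hb))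
  obtain ⟨b, hb, hc⟩ := mem_bUnion.1 hc
  exact mem_HC_of_mem (hf b hb) hc

theorem isOrdinal_mem_HC (ha : a.IsOrdinal) (hc : a.card ≤ lam) : a ∈ HC lam := by
  induction a using ZFSet.inductionOn with
  | _ a ih =>
    exact mem_HC_of_subset (fun b hb => ih b hb (ha.mem hb)
      ((ZFSet.card_mono (ha.subset_of_mem hb)).trans hc)) hc

end HC

/-! ### Closure of sets under finitary operations -/

theorem mk_union_le_lift {lam : Cardinal.{u}} (hl : ℵ₀ ≤ lam) {α : Type (u + 1)} {s t : Set α}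
    (hs : #s ≤ lift.{u + 1} lam) (ht : #t ≤ lift.{u + 1} lam) :
    #(s ∪ t : Set α) ≤ lift.{u + 1} lam := by
  refine (mk_union_le _ _).trans ((add_le_add hs ht).trans ?_)
  rw [← lift_add, Cardinal.lift_le]
  exact (add_eq_self hl).le

theorem mk_le_lift_of_countable {lam : Cardinal.{u}} (hl : ℵ₀ ≤ lam) {α : Type (u + 1)} {s : Set α}
    (hs : s.Countable) : #s ≤ lift.{u + 1} lam :=
  (le_aleph0_iff_set_countable.2 hs).trans (by rwa [aleph0_le_lift])

/-- Closing off in ω rounds keeps the size at most λ, since each round applies at most λ operations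
to finite lists. Values outside H(λ⁺) are discarded. -/
theorem exists_closed {lam : Cardinal.{u}} (hl : ℵ₀ ≤ lam)
    {F : Set (List ZFSet.{u} → ZFSet.{u})} (hF : #F ≤ lift.{u + 1} lam) :
    ∃ M : ZFSet.{u}, M.card ≤ lam ∧ (∀ a ∈ M, a ∈ HC lam) ∧
      ∀ f ∈ F, ∀ l : List ZFSet.{u}, (∀ a ∈ l, a ∈ M) → f l ∈ HC lam → f l ∈ M := by
  have hl' : ℵ₀ ≤ lift.{u + 1} lam := by rwa [aleph0_le_lift]
  let G : Set ZFSet.{u} → Set ZFSet.{u} := fun S =>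
    (fun p : (List ZFSet.{u} → ZFSet.{u}) × List ZFSet.{u} => p.1 p.2) '' (F ×ˢ {l | ∀ a ∈ l, a ∈ S})
  have hG : ∀ S : Set ZFSet.{u}, #S ≤ lift.{u + 1} lam → #(G S) ≤ lift.{u + 1} lam := by
    intro S hS
    refine mk_image_le.trans ?_
    rw [mk_setProd]
    refine (mul_le_mul' hF ?_).trans (mul_eq_self hl').le
    rw [← Set.range_list_map_coe]
    exact mk_range_le.trans ((mk_list_le_max _).trans (max_le hl' hS))
  let step : Set ZFSet.{u} → Set ZFSet.{u} := fun S => S ∪ (G S ∩ HC lam)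
  let T : ℕ → Set ZFSet.{u} := fun n => step^[n] ∅
  have hT1 : ∀ n, T (n + 1) = T n ∪ (G (T n) ∩ HC lam) := fun n =>
    Function.iterate_succ_apply' step n ∅
  have hTc : ∀ n, #(T n) ≤ lift.{u + 1} lam := by
    intro n
    induction n with
    | zero => simp [T]
    | succ n ih =>
      rw [hT1]
      exact mk_union_le_lift hl ih ((mk_le_mk_of_subset Set.inter_subset_left).trans (hG _ ih))
  have hTmono : Monotone T := monotone_nat_of_le_succ fun n => by
    rw [hT1]; exact Set.subset_union_left
  have hTH : ∀ n, T n ⊆ HC lam := by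
    intro n
    induction n with
    | zero => exact Set.empty_subset _
    | succ n ih =>
      rw [hT1]
      exact Set.union_subset ih Set.inter_subset_right
  have hTU : #(⋃ n : ULift.{u + 1} ℕ, T n.down) ≤ lift.{u + 1} lam := by
    refine mk_iUnion_le_sum_mk.trans ((sum_le_sum _ (fun _ => Cardinal.lift.{u + 1} lam)
      fun n : ULift.{u + 1} ℕ => hTc n.down).trans ?_)
    rw [sum_const']
    refine (mul_le_mul_left (mk_le_aleph0.trans hl') _).trans (mul_eq_self hl').le
  obtain ⟨M, hM, hMc⟩ := exists_zfset hTU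
  have hM' : ∀ a, a ∈ M ↔ ∃ n, a ∈ T n := fun a => by
    rw [hM, Set.mem_iUnion]
    exact ⟨fun ⟨n, h⟩ => ⟨n.down, h⟩, fun ⟨n, h⟩ => ⟨⟨n⟩, h⟩⟩
  refine ⟨M, hMc, fun a ha => ?_, fun f hf l hlM hfl => ?_⟩
  · obtain ⟨n, hn⟩ := (hM' a).1 ha
    exact hTH n hn
  · have hn : ∃ n, ∀ a ∈ l, a ∈ T n := by
      clear hfl
      induction l with
      | nil => exact ⟨0, by simp⟩
      | cons b l ih =>
        obtain ⟨n, hn⟩ := ih fun a ha => hlM a (List.mem_cons_of_mem _ ha)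
        obtain ⟨m, hm⟩ := (hM' b).1 (hlM b List.mem_cons_self)
        refine ⟨max n m, fun a ha => ?_⟩
        rcases List.mem_cons.1 ha with rfl | ha
        · exact hTmono (le_max_right _ _) hm
        · exact hTmono (le_max_left _ _) (hn a ha)
    obtain ⟨n, hn⟩ := hn
    refine (hM' _).2 ⟨n + 1, ?_⟩
    rw [hT1]
    exact Or.inr ⟨⟨(f, l), ⟨hf, hn⟩, rfl⟩, hfl⟩

/-! ### Functions coded by sets -/

/-- The graph of `h` on `B`. -/
noncomputable def graph (B : ZFSet.{u}) (h : ZFSet.{u} → ZFSet.{u}) : ZFSet.{u} :=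
  img (fun x => ZFSet.pair x (h x)) B

open Classical in
/-- The value at `x` of the function with graph `m`. -/
noncomputable def app (m x : ZFSet.{u}) : ZFSet.{u} :=
  if h : ∃ y, ZFSet.pair x y ∈ m then h.choose else ∅

theorem app_graph {B x : ZFSet.{u}} {h : ZFSet.{u} → ZFSet.{u}} (hx : x ∈ B) :
    app (graph B h) x = h x := by
  have hex : ∃ y, ZFSet.pair x y ∈ graph B h := ⟨h x, mem_img_of_mem
    (f := fun x => ZFSet.pair x (h x)) hx⟩
  rw [app, dif_pos hex]
  obtain ⟨x', -, hx'⟩ := mem_img.1 hex.choose_spec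
  obtain ⟨rfl, h'⟩ := ZFSet.pair_inj.1 hx'
  exact h'.symm

theorem app_mem_HC {lam : Cardinal.{u}} {m : ZFSet.{u}} (hm : m ∈ HC lam) (x : ZFSet.{u}) :
    app m x ∈ HC lam := by
  rw [app]
  split_ifs with h
  · have := mem_HC_of_mem hm h.choose_spec
    refine mem_HC_of_mem (mem_HC_of_mem this (b := {x, h.choose}) ?_) ?_
    · rw [ZFSet.pair]; exact ZFSet.mem_pair.2 (Or.inr rfl)
    · exact ZFSet.mem_pair.2 (Or.inr rfl)
  · exact empty_mem_HC

theorem graph_mem_HC {lam : Cardinal.{u}} (hl : ℵ₀ ≤ lam) {B : ZFSet.{u}} (hB : B ∈ HC lam)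
    {h : ZFSet.{u} → ZFSet.{u}} (hh : ∀ x ∈ B, h x ∈ HC lam) : graph B h ∈ HC lam :=
  img_mem_HC (card_le_of_mem_HC hB) fun x hx => pair_mem_HC hl (mem_HC_of_mem hB hx) (hh x hx)

/-! ### Elementary submodels of `H(λ⁺)` -/

/-- Satisfaction in `(D, ∈)`. -/
abbrev ESat (D : Set ZFSet.{u}) {k : ℕ} (φ : langSet.BoundedFormula Empty k)
    (a : Fin k → ZFSet.{u}) : Prop := Sat D (fun p : Empty => p.elim) φ a

theorem realize_iff_esat {D : ZFSet.{u}} {n : ℕ} (φ : langSet.Formula (Fin n)) (v : Fin n → D) :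
    φ.Realize v ↔ ESat (D : Set ZFSet.{u})
      (FirstOrder.Language.BoundedFormula.relabel (Sum.inr : Fin n → Empty ⊕ Fin n) φ)
      (fun i => (v i : ZFSet.{u})) := by
  rw [← FirstOrder.Language.Formula.realize_relabel_sumInr φ (v := Empty.elim)]
  exact realize_iff_sat (I := fun p : Empty => p.elim) (J := fun p : Empty => p.elim)
    (fun p => p.elim) (FirstOrder.Language.BoundedFormula.relabel
      (Sum.inr : Fin n → Empty ⊕ Fin n) φ) Empty.elim v

open Classical in
/-- An element of `D` satisfying `p`. -/
noncomputable def pick (D : Set ZFSet.{u}) (p : ZFSet.{u} → Prop) : ZFSet.{u} :=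
  if h : ∃ b ∈ D, p b then h.choose else ∅

theorem pick_spec {D : Set ZFSet.{u}} {p : ZFSet.{u} → Prop} (h : ∃ b ∈ D, p b) :
    pick D p ∈ D ∧ p (pick D p) := by
  rw [pick, dif_pos h]; exact h.choose_spec

theorem pick_mem_HC {lam : Cardinal.{u}} (p : ZFSet.{u} → Prop) : pick (HC lam) p ∈ HC lam := by
  by_cases h : ∃ b ∈ HC lam, p b
  · exact (pick_spec h).1
  · rw [pick, dif_neg h]; exact empty_mem_HC

/-- A transitive elementary submodel of `H(λ⁺)` containing the elements of `C`, and closed under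
Skolem functions for the functions on `B`. -/
structure GoodModel (lam : Cardinal.{u}) (B : ZFSet.{u}) (C : Set ZFSet.{u}) (M : ZFSet.{u}) :
    Prop where
  trans : M.IsTransitive
  card_le : M.card ≤ lam
  sub : ∀ a ∈ M, a ∈ HC lam
  const : C ⊆ M
  elem : ∀ {k : ℕ} (ψ : langSet.BoundedFormula Empty k) (a : Fin k → ZFSet.{u}), (∀ i, a i ∈ M) →
    (ESat (M : Set ZFSet.{u}) ψ a ↔ ESat (HC lam) ψ a)
  skolem : ∀ {k : ℕ} (ψ : langSet.BoundedFormula Empty (k + 1)) (m : Fin k → ZFSet.{u}),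
    (∀ i, m i ∈ M) → ∃ c ∈ M, ∀ x ∈ B,
      (∃ b ∈ HC lam, ESat (HC lam) ψ (Fin.snoc (fun i => app (m i) x) b)) →
      ESat (HC lam) ψ (Fin.snoc (fun i => app (m i) x) (app c x))
  constFn : ∀ a ∈ M, graph B (fun _ => a) ∈ M
  zfc : ModelsZFCMinus M

/-- The tuple of the first `k` entries of a list. -/
def tup (k : ℕ) (l : List ZFSet.{u}) : Fin k → ZFSet.{u} := fun i => l.getD i ∅

theorem tup_ofFn {k : ℕ} (a : Fin k → ZFSet.{u}) : tup k (List.ofFn a) = a := by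
  funext i
  simp [tup]

instance : Countable langSet.Symbols := by
  have h1 : ∀ l, Countable (langSet.Functions l) := fun l => inferInstanceAs (Countable Empty)
  have h2 : ∀ l, Countable (langSet.Relations l) := fun l => by
    refine (Function.Injective.countable (f := fun _ : SetRel Empty l => ()) ?_)
    intro a b _
    cases a with
    | mem => cases b with
      | mem => rfl
    | pred p => exact p.elim
  unfold FirstOrder.Language.Symbols
  infer_instance

theorem countable_formulas (d : ℕ) : Countable (Σ k, langSet.BoundedFormula Empty (k + d)) :=
  Function.Injective.countable
    (f := fun ψ => (⟨ψ.1 + d, ψ.2⟩ : Σ k, langSet.BoundedFormula Empty k)) (by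
      rintro ⟨k, ψ⟩ ⟨k', ψ'⟩ h
      obtain ⟨h, h'⟩ := Sigma.mk.inj_iff.1 h
      obtain rfl : k = k' := by simpa using h
      exact congrArg (Sigma.mk k) (eq_of_heq h'))

/-- A well-ordering of `a`. -/
noncomputable def wo (a : ZFSet.{u}) : ZFSet.{u} :=
  ZFSet.pairSep (fun x y => WellOrderingRel x y) a a

theorem pair_mem_wo {a x y : ZFSet.{u}} (hx : x ∈ a) (hy : y ∈ a) :
    ZFSet.pair x y ∈ wo a ↔ WellOrderingRel x y := by
  rw [wo, ZFSet.mem_pairSep]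
  constructor
  · rintro ⟨b, -, c, -, h, h'⟩
    obtain ⟨rfl, rfl⟩ := ZFSet.pair_inj.1 h
    exact h'
  · exact fun h => ⟨x, hx, y, hy, rfl, h⟩

theorem wo_mem_HC {lam : Cardinal.{u}} (hl : ℵ₀ ≤ lam) {a : ZFSet.{u}} (ha : a ∈ HC lam) :
    wo a ∈ HC lam := by
  refine mem_HC_of_subset_mem (bUnion_mem_HC hl (card_le_of_mem_HC ha) fun x hx =>
    img_mem_HC (f := fun y => ZFSet.pair x y) (card_le_of_mem_HC ha) fun y hy =>
      pair_mem_HC hl (mem_HC_of_mem ha hx) (mem_HC_of_mem ha hy)) ?_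
  intro z hz
  obtain ⟨x, hx, y, hy, rfl, -⟩ := ZFSet.mem_pairSep.1 hz
  exact mem_bUnion.2 ⟨x, hx, mem_img_of_mem (f := fun y => ZFSet.pair x y) hy⟩

open Classical in
-- Close under Skolem functions for H(λ⁺), pointwise Skolem functions for functions on B, and the
-- operations demanded by the axioms. Separation and Collection are computed in H(λ⁺), where sets of
-- size at most λ can be formed freely, and pass to M by elementarity.
theorem exists_goodModel {lam : Cardinal.{u}} (hl : ℵ₀ ≤ lam) {B : ZFSet.{u}} (hB : B ∈ HC lam)
    {C : Set ZFSet.{u}} (hC : #C ≤ lift.{u + 1} lam) (hCH : C ⊆ HC lam) (hlam : cset lam ∈ C) :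
    ∃ M, GoodModel lam B C M := by
  let H := HC lam
  let sk : (Σ k, langSet.BoundedFormula Empty (k + 1)) → List ZFSet.{u} → ZFSet.{u} :=
    fun ψ l => pick H fun b => ESat H ψ.2 (Fin.snoc (tup ψ.1 l) b)
  let SK : (Σ k, langSet.BoundedFormula Empty (k + 1)) → List ZFSet.{u} → ZFSet.{u} :=
    fun ψ l => graph B fun x => pick H fun b =>
      ESat H ψ.2 (Fin.snoc (fun i => app (tup ψ.1 l i) x) b)
  let sep : (Σ k, langSet.BoundedFormula Empty (k + 1)) → List ZFSet.{u} → ZFSet.{u} :=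
    fun ψ l => ZFSet.sep (fun x => ESat H ψ.2 (Fin.cons x (tup ψ.1 l.tail))) (l.getD 0 ∅)
  let coll : (Σ k, langSet.BoundedFormula Empty (k + 2)) → List ZFSet.{u} → ZFSet.{u} :=
    fun ψ l => img (fun x => pick H fun b =>
      ESat H ψ.2 (Fin.cons x (Fin.cons b (tup ψ.1 l.tail)))) (l.getD 0 ∅)
  let upairOp : List ZFSet.{u} → ZFSet.{u} := fun l => {l.getD 0 ∅, l.getD 1 ∅}
  let unionOp : List ZFSet.{u} → ZFSet.{u} := fun l => bUnion (l.getD 0 ∅) id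
  let woOp : List ZFSet.{u} → ZFSet.{u} := fun l => wo (l.getD 0 ∅)
  let constOp : List ZFSet.{u} → ZFSet.{u} := fun l => graph B fun _ => l.getD 0 ∅
  have hΦ1 := countable_formulas 1
  have hΦ2 := countable_formulas 2
  let Fc : Set (List ZFSet.{u} → ZFSet.{u}) := (fun a _ => a) '' C
  -- These λ many operations list the elements of any member of M, which makes M transitive.
  let Fe : Set (List ZFSet.{u} → ZFSet.{u}) :=
    (fun ξ l => enum (l.getD 0 ∅) ξ) '' (cset lam : Set ZFSet.{u})
  let Ff : Set (List ZFSet.{u} → ZFSet.{u}) :=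
    Set.range sk ∪ (Set.range SK ∪ (Set.range sep ∪ (Set.range coll ∪ {upairOp, unionOp, woOp, constOp})))
  obtain ⟨M, hMc, hMH, hcl⟩ := exists_closed hl (F := Fc ∪ (Fe ∪ Ff)) (by
    refine mk_union_le_lift hl (mk_image_le.trans hC) (mk_union_le_lift hl (mk_image_le.trans
      (by rw [mk_cset])) (mk_le_lift_of_countable hl ?_))
    exact (Set.countable_range _).union ((Set.countable_range _).union
      ((Set.countable_range _).union ((Set.countable_range _).union (Set.toFinite _).countable))))
  have hofFn : ∀ {k : ℕ} {a : Fin k → ZFSet.{u}}, (∀ i, a i ∈ M) → ∀ b ∈ List.ofFn a, b ∈ M := by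
    intro k a ha b hb
    obtain ⟨i, rfl⟩ := List.mem_ofFn.1 hb
    exact ha i
  have hcons : ∀ {k : ℕ} {a : Fin k → ZFSet.{u}} {c : ZFSet.{u}}, c ∈ M → (∀ i, a i ∈ M) →
      ∀ b ∈ c :: List.ofFn a, b ∈ M := by
    intro k a c hc ha b hb
    rcases List.mem_cons.1 hb with rfl | hb
    · exact hc
    · exact hofFn ha b hb
  have hsing : ∀ {a : ZFSet.{u}}, a ∈ M → ∀ b ∈ [a], b ∈ M := by
    intro a ha b hb
    rw [List.mem_singleton.1 hb]; exact ha
  have hf : ∀ f ∈ Ff, ∀ l : List ZFSet.{u}, (∀ a ∈ l, a ∈ M) → f l ∈ HC lam → f l ∈ M :=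
    fun f h => hcl f (Or.inr (Or.inr h))
  have hmis : ∀ f ∈ ({upairOp, unionOp, woOp, constOp} : Set (List ZFSet.{u} → ZFSet.{u})),
      ∀ l : List ZFSet.{u}, (∀ a ∈ l, a ∈ M) → f l ∈ HC lam → f l ∈ M := fun f h =>
    hf _ (Or.inr (Or.inr (Or.inr (Or.inr h))))
  have hCM : C ⊆ M := fun a ha =>
    hcl _ (Or.inl ⟨a, ha, rfl⟩) [] (by simp) (hCH ha)
  have htr : M.IsTransitive := by
    intro a ha b hb
    obtain ⟨ξ, hξ, rfl⟩ := mem_iff_enum.1 hb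
    exact hcl _ (Or.inr (Or.inl ⟨ξ, cset_subset_cset.2 (card_le_of_mem_HC (hMH a ha)) hξ, rfl⟩))
      [a] (hsing ha) (mem_HC_of_mem (hMH a ha) hb)
  have helem : ∀ {k : ℕ} (ψ : langSet.BoundedFormula Empty k) (a : Fin k → ZFSet.{u}),
      (∀ i, a i ∈ M) → (ESat (M : Set ZFSet.{u}) ψ a ↔ ESat H ψ a) := by
    intro k ψ
    induction ψ with
    | falsum => exact fun _ _ => Iff.rfl
    | equal t s => exact fun _ _ => Iff.rfl
    | rel R ts => exact fun _ _ => Iff.rfl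
    | imp φ ψ ih1 ih2 =>
      intro a ha
      exact imp_congr (ih1 a ha) (ih2 a ha)
    | @all k φ ih =>
      intro a ha
      have hsnoc := fun (b : ZFSet.{u}) (hb : b ∈ M) =>
        snoc_mem (s := (M : Set ZFSet.{u})) ha hb
      constructor
      · intro h
        by_contra hcon
        -- This is the Tarski–Vaught test: a counterexample in H(λ⁺) may be replaced by the Skolem
        -- value, which lies in M.
        have hcon' : ∃ b ∈ H, ESat H (notF φ) (Fin.snoc a b) := by
          simp only [ESat, Sat, not_forall] at hcon
          obtain ⟨b, hb, h⟩ := hcon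
          exact ⟨b, hb, h⟩
        have hb := pick_spec hcon'
        have hM : pick H (fun b => ESat H (notF φ) (Fin.snoc a b)) ∈ M := by
          have := hf (sk ⟨k, notF φ⟩) (Or.inl ⟨_, rfl⟩) (List.ofFn a) (hofFn ha) (pick_mem_HC _)
          simpa only [sk, tup_ofFn] using this
        exact hb.2 ((ih _ (hsnoc _ hM)).1 (h _ hM))
      · intro h b hb
        exact (ih _ (hsnoc b hb)).2 (h b (hMH b hb))
  refine ⟨M, htr, hMc, hMH, hCM, helem, ?_, ?_, ?_⟩
  · intro k ψ m hm
    refine ⟨SK ⟨k, ψ⟩ (List.ofFn m), hf _ (Or.inr (Or.inl ⟨_, rfl⟩)) _ (hofFn hm)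
      (graph_mem_HC hl hB fun x _ => pick_mem_HC _), fun x hx hex => ?_⟩
    simp only [SK, tup_ofFn]
    rw [app_graph hx]
    exact (pick_spec hex).2
  · intro a ha
    exact hmis constOp (by simp) [a] (hsing ha) (graph_mem_HC hl hB fun _ _ => hMH a ha)
  · have hcoe : ∀ (a : M) (z : ZFSet.{u}), z ∈ (a : ZFSet.{u}) → z ∈ M := fun a z hz =>
      htr _ a.2 hz
    have hconsfun : ∀ {n : ℕ} (x : M) (p : Fin n → M),
        (fun i => ((Fin.cons x p : Fin (n + 1) → M) i : ZFSet.{u})) =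
          Fin.cons (x : ZFSet.{u}) fun i => (p i : ZFSet.{u}) := by
      intro n x p
      funext i
      refine Fin.cases rfl (fun i => rfl) i
    refine ⟨?_, ?_, ?_, ?_, ?_, ?_, ?_, ?_⟩
    · intro a b h
      refine Subtype.ext (ZFSet.ext fun z => ⟨fun hz => ?_, fun hz => ?_⟩)
      · exact (h ⟨z, hcoe a z hz⟩).1 hz
      · exact (h ⟨z, hcoe b z hz⟩).2 hz
    · rintro a ⟨z, hz⟩
      obtain ⟨y, hy, hay⟩ := ZFSet.regularity (a : ZFSet.{u}) (fun h =>
        ZFSet.notMem_empty (z : ZFSet.{u}) (h ▸ hz))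
      refine ⟨⟨y, hcoe a y hy⟩, hy, fun w hw hwy => ?_⟩
      exact ZFSet.notMem_empty (w : ZFSet.{u}) (hay ▸ ZFSet.mem_inter.2 ⟨hw, hwy⟩)
    · intro a b
      refine ⟨⟨{(a : ZFSet.{u}), (b : ZFSet.{u})}, hmis upairOp (by simp) [a, b] (by
        intro c hc
        simp only [List.mem_cons, List.not_mem_nil, or_false] at hc
        rcases hc with rfl | rfl
        · exact a.2
        · exact b.2) (upair_mem_HC hl (hMH _ a.2) (hMH _ b.2))⟩, fun z => ?_⟩
      rw [ZFSet.mem_pair, Subtype.ext_iff, Subtype.ext_iff]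
    · intro a
      refine ⟨⟨bUnion a id, hmis unionOp (by simp) [(a : ZFSet.{u})] (hsing a.2) (bUnion_mem_HC hl
        (card_le_of_mem_HC (hMH _ a.2)) fun b hb => mem_HC_of_mem (hMH _ a.2) hb)⟩, fun z => ?_⟩
      rw [mem_bUnion]
      exact ⟨fun ⟨y, hy, hz⟩ => ⟨⟨y, hcoe a y hy⟩, hy, hz⟩, fun ⟨y, hy, hz⟩ => ⟨y, hy, hz⟩⟩
    · exact ⟨cset lam, hCM hlam, empty_mem_cset (aleph0_pos.trans_le hl).ne', fun y hy =>
        insert_mem_cset hl hy⟩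
    · intro n φ p a
      let ψ : langSet.BoundedFormula Empty (n + 1) :=
        FirstOrder.Language.BoundedFormula.relabel (Sum.inr : Fin (n + 1) → Empty ⊕ Fin (n + 1)) φ
      have hm := hf (sep ⟨n, ψ⟩) (Or.inr (Or.inr (Or.inl ⟨_, rfl⟩)))
        ((a : ZFSet.{u}) :: List.ofFn fun i => (p i : ZFSet.{u}))
        (hcons a.2 fun i => (p i).2) (mem_HC_of_subset_mem (hMH _ a.2) fun x hx =>
          (ZFSet.mem_sep.1 hx).1)
      refine ⟨⟨_, hm⟩, fun x => ?_⟩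
      simp only [sep, List.tail_cons, tup_ofFn, ZFSet.mem_sep, List.getD_cons_zero]
      refine and_congr_right fun _ => ?_
      rw [realize_iff_esat, hconsfun]
      exact (helem ψ _ (fun i => by
        refine Fin.cases x.2 (fun i => (p i).2) i)).symm
    · intro n φ p a h
      let ψ : langSet.BoundedFormula Empty (n + 2) :=
        FirstOrder.Language.BoundedFormula.relabel (Sum.inr : Fin (n + 2) → Empty ⊕ Fin (n + 2)) φ
      have hr : ∀ x y : M, φ.Realize (Fin.cons x (Fin.cons y p)) ↔
          ESat H ψ (Fin.cons (x : ZFSet.{u}) (Fin.cons (y : ZFSet.{u})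
            fun i => (p i : ZFSet.{u}))) := by
        intro x y
        rw [realize_iff_esat, hconsfun, hconsfun]
        exact helem ψ _ (fun i => by
          refine Fin.cases x.2 (fun i => Fin.cases y.2 (fun i => (p i).2) i) i)
      have hm := hf (coll ⟨n, ψ⟩) (Or.inr (Or.inr (Or.inr (Or.inl ⟨_, rfl⟩))))
        ((a : ZFSet.{u}) :: List.ofFn fun i => (p i : ZFSet.{u}))
        (hcons a.2 fun i => (p i).2) (img_mem_HC (card_le_of_mem_HC (hMH _ a.2)) fun x _ =>
          pick_mem_HC _)
      refine ⟨⟨_, hm⟩, fun x hx => ?_⟩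
      obtain ⟨y, hy⟩ := h x hx
      have hp := pick_spec (p := fun b => ESat H ψ (Fin.cons (x : ZFSet.{u}) (Fin.cons b
        fun i => (p i : ZFSet.{u})))) ⟨(y : ZFSet.{u}), hMH _ y.2, (hr x y).1 hy⟩
      have hin : pick H (fun b => ESat H ψ (Fin.cons (x : ZFSet.{u}) (Fin.cons b
          fun i => (p i : ZFSet.{u})))) ∈ coll ⟨n, ψ⟩
          ((a : ZFSet.{u}) :: List.ofFn fun i => (p i : ZFSet.{u})) := by
        simp only [coll, List.tail_cons, tup_ofFn, List.getD_cons_zero]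
        exact mem_img.2 ⟨x, hx, rfl⟩
      exact ⟨⟨_, htr _ hm hin⟩, hin, (hr x _).2 hp.2⟩
    · intro a ha
      have hwf : WellFounded (WellOrderingRel : ZFSet.{u} → ZFSet.{u} → Prop) :=
        WellOrderingRel.isWellOrder.wf
      refine ⟨wo a, hmis woOp (by simp) [a] (hsing ha) (wo_mem_HC hl (hMH a ha)), ?_, ?_, ?_, ?_⟩
      · intro x hx h
        exact irrefl x ((pair_mem_wo hx hx).1 h)
      · intro x hx y hy z hz h h'
        exact (pair_mem_wo hx hz).2 (_root_.trans ((pair_mem_wo hx hy).1 h)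
          ((pair_mem_wo hy hz).1 h'))
      · intro x hx y hy
        rw [pair_mem_wo hx hy, pair_mem_wo hy hx]
        rcases trichotomous_of WellOrderingRel x y with h | h | h
        · exact Or.inr (Or.inl h)
        · exact Or.inl h
        · exact Or.inr (Or.inr h)
      · intro b _ hba hne
        obtain ⟨c, hc⟩ : ∃ c, c ∈ b := by
          rcases ZFSet.eq_empty_or_nonempty b with h | h
          · exact absurd h hne
          · exact h
        obtain ⟨m, hm, hmin⟩ := hwf.has_min {c | c ∈ b} ⟨c, hc⟩
        exact ⟨m, hm, fun y hy h => hmin y hy ((pair_mem_wo (hba hy) (hba hm)).1 h)⟩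

/-! ### Ultrapowers of elementary submodels of `H(λ⁺)` -/

theorem Base.eventually_forall_nat {κ lam : Cardinal.{u}} {U : Filter ZFSet.{u}}
    (hU : Base κ lam U) (hκ : ℵ₀ < κ) {P : ℕ → ZFSet.{u} → Prop} (h : ∀ n, ∀ᶠ x in U, P n x) :
    ∀ᶠ x in U, ∀ n, P n x := by
  refine (hU.complete (cset ℵ₀) (by rwa [card_cset])
    (fun i x => ∀ n : ℕ, i = (n : Ordinal.{u}).toZFSet → P n x) ?_).mono ?_
  · intro i hi
    obtain ⟨o, ho, rfl⟩ := mem_cset.1 hi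
    rw [ord_aleph0] at ho
    obtain ⟨n, rfl⟩ := Ordinal.lt_omega0.1 ho
    filter_upwards [h n] with x hx m hm
    have : n = m := by exact_mod_cast Ordinal.toZFSet_injective hm
    rwa [← this]
  · intro x hx n
    refine hx _ (mem_cset.2 ⟨n, ?_, rfl⟩) n rfl
    rw [ord_aleph0]
    exact Ordinal.natCast_lt_omega0 n

/-- Membership in the ultrapower. -/
def UMem (U : Filter ZFSet.{u}) (M m m' : ZFSet.{u}) : Prop :=
  m ∈ M ∧ ∀ᶠ x in U, app m x ∈ app m' x

/-- Completeness for countable families turns a descending sequence in the ultrapower into a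
descending ∈-sequence at a single x. -/
theorem wellFounded_UMem {κ lam : Cardinal.{u}} {U : Filter ZFSet.{u}}
    (hU : Base κ lam U) (hκ : ℵ₀ < κ) (M : ZFSet.{u}) : WellFounded (UMem U M) := by
  rw [wellFounded_iff_isEmpty_descending_chain]
  refine ⟨fun ⟨f, hf⟩ => ?_⟩
  have := hU.neBot
  obtain ⟨x, hx⟩ := (hU.eventually_forall_nat hκ fun n => (hf n).2).exists
  exact (wellFounded_iff_isEmpty_descending_chain.1 ZFSet.mem_wf).false
    ⟨fun n => app (f n) x, hx⟩

/-- No extensionality is assumed and no quotient is formed: codes with the same predecessors simply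
get the same value. -/
theorem exists_collapse {r : ZFSet.{u} → ZFSet.{u} → Prop} (h : WellFounded r) {M : ZFSet.{u}}
    (hM : ∀ m' m, r m' m → m' ∈ M) :
    ∃ col : ZFSet.{u} → ZFSet.{u}, ∀ m z, z ∈ col m ↔ ∃ m', r m' m ∧ col m' = z := by
  refine ⟨h.fix fun m ih => ZFSet.range fun m' : {m' : M // r m' m} => ih m' m'.2,
    fun m z => ?_⟩
  rw [h.fix_eq, ZFSet.mem_range]
  exact ⟨fun ⟨m', h⟩ => ⟨m', m'.2, h⟩, fun ⟨m', h, h'⟩ => ⟨⟨⟨m', hM _ _ h⟩, h⟩, h'⟩⟩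

section ultrapower

variable {lam : Cardinal.{u}} {U : Filter ZFSet.{u}} {B M : ZFSet.{u}} {C : Set ZFSet.{u}}
  {col : ZFSet.{u} → ZFSet.{u}}

/-- `U` decides all first-order properties of the elements of `M`, viewed as functions. -/
def DecidesFormulas (lam : Cardinal.{u}) (U : Filter ZFSet.{u}) (M : ZFSet.{u}) : Prop :=
  ∀ {k : ℕ} (ψ : langSet.BoundedFormula Empty k) (m : Fin k → ZFSet.{u}), (∀ i, m i ∈ M) →
    (∀ᶠ x in U, ESat (HC lam) ψ fun i => app (m i) x) ∨
      ∀ᶠ x in U, ¬ ESat (HC lam) ψ fun i => app (m i) x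

theorem comp_snoc_app {k : ℕ} (m : Fin k → ZFSet.{u}) (c x : ZFSet.{u}) :
    (fun i => app ((Fin.snoc m c : Fin (k + 1) → ZFSet.{u}) i) x) =
      Fin.snoc (fun i => app (m i) x) (app c x) :=
  Fin.comp_snoc (fun a => app a x) m c

/-- If two functions differed almost everywhere, M would contain a Skolem function choosing an
element of their difference. The collapse of that function lies in the common value, so by
∈-induction it agrees with a member of the other function, a contradiction. -/
theorem eventually_eq_of_collapse_eq (hM : GoodModel lam B C M) (hB : ∀ᶠ x in U, x ∈ B)
    (hdec : DecidesFormulas lam U M)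
    (hcol : ∀ m z, z ∈ col m ↔ ∃ m', UMem U M m' m ∧ col m' = z) {m m' : ZFSet.{u}} (hm : m ∈ M)
    (hm' : m' ∈ M) (h : col m = col m') : ∀ᶠ x in U, app m x = app m' x := by
  -- an element of the difference of two functions
  have key : ∀ {m m'}, m ∈ M → m' ∈ M → (∀ᶠ x in U, ∀ b ∈ HC lam, b ∈ app m x → b ∈ app m' x) ∨
      ∃ c, UMem U M c m ∧ ∀ᶠ x in U, app c x ∉ app m' x := by
    intro m m' hm hm'
    let φ : langSet.BoundedFormula Empty 3 := andF (memF 2 0) (notF (memF 2 1))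
    have hmm : ∀ i, (![m, m'] : Fin 2 → ZFSet.{u}) i ∈ M := by
      intro i
      fin_cases i
      · exact hm
      · exact hm'
    have hφ : ∀ x b, ESat (HC lam) φ
        (Fin.snoc (fun i => app ((![m, m'] : Fin 2 → ZFSet.{u}) i) x) b) ↔
          b ∈ app m x ∧ b ∉ app m' x := fun x b => by
      simp only [φ, ESat, sat_and, sat_not, sat_memF]
      exact Iff.rfl
    rcases hdec (exF φ) ![m, m'] hmm with h | h
    · right
      obtain ⟨c, hc, hc'⟩ := hM.skolem φ ![m, m'] hmm
      have : ∀ᶠ x in U, app c x ∈ app m x ∧ app c x ∉ app m' x := by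
        filter_upwards [h, hB] with x hx hxB
        exact (hφ x _).1 (hc' x hxB (sat_ex.1 hx))
      exact ⟨c, ⟨hc, this.mono fun x hx => hx.1⟩, this.mono fun x hx => hx.2⟩
    · left
      filter_upwards [h] with x hx b hb hbm
      by_contra hbm'
      exact hx (sat_ex.2 ⟨b, hb, (hφ x b).2 ⟨hbm, hbm'⟩⟩)
  have main : ∀ z m m', m ∈ M → m' ∈ M → col m = z → col m' = z →
      ∀ᶠ x in U, app m x = app m' x := by
    intro z
    induction z using ZFSet.inductionOn with
    | _ z ih =>
    have sub : ∀ m m', m ∈ M → m' ∈ M → col m = z → col m' = z →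
        ∀ᶠ x in U, ∀ b ∈ HC lam, b ∈ app m x → b ∈ app m' x := by
      intro m m' hm hm' h h'
      rcases key hm hm' with hk | ⟨c, hc, hc'⟩
      · exact hk
      · have hcz : col c ∈ z := by rw [← h]; exact (hcol _ _).2 ⟨c, hc, rfl⟩
        have hcz' := hcz
        rw [← h'] at hcz'
        obtain ⟨n, hn, hn'⟩ := (hcol _ _).1 hcz'
        filter_upwards [ih _ hcz n c hn.1 hc.1 hn' rfl, hn.2, hc'] with x h1 h2 h3
        rw [h1] at h2
        exact absurd h2 h3
    intro m m' hm hm' h h'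
    filter_upwards [sub m m' hm hm' h h', sub m' m hm' hm h' h] with x h1 h2
    ext b
    exact ⟨fun hb => h1 b (mem_HC_of_mem (app_mem_HC (hM.sub m hm) x) hb) hb,
      fun hb => h2 b (mem_HC_of_mem (app_mem_HC (hM.sub m' hm') x) hb) hb⟩
  exact main _ m m' hm hm' rfl h.symm

theorem collapse_eq_of_eventually_eq
    (hcol : ∀ m z, z ∈ col m ↔ ∃ m', UMem U M m' m ∧ col m' = z) {m m' : ZFSet.{u}}
    (h : ∀ᶠ x in U, app m x = app m' x) : col m = col m' := by
  ext z
  rw [hcol, hcol]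
  refine exists_congr fun c => and_congr_left fun _ => and_congr_right fun _ => ?_
  constructor <;> intro h' <;> filter_upwards [h, h'] with x h1 h2
  · rwa [← h1]
  · rwa [h1]

theorem collapse_mem_iff (hM : GoodModel lam B C M) (hB : ∀ᶠ x in U, x ∈ B)
    (hdec : DecidesFormulas lam U M)
    (hcol : ∀ m z, z ∈ col m ↔ ∃ m', UMem U M m' m ∧ col m' = z) {m m' : ZFSet.{u}} (hm : m ∈ M) :
    col m ∈ col m' ↔ ∀ᶠ x in U, app m x ∈ app m' x := by
  rw [hcol]
  constructor
  · rintro ⟨c, hc, hcm⟩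
    filter_upwards [hc.2, eventually_eq_of_collapse_eq hM hB hdec hcol hc.1 hm hcm] with x h1 h2
    rwa [← h2]
  · exact fun h => ⟨m, ⟨hm, h⟩, rfl⟩

/-- Łoś's theorem. -/
theorem esat_collapse_iff [U.NeBot] (hM : GoodModel lam B C M) (hB : ∀ᶠ x in U, x ∈ B)
    (hdec : DecidesFormulas lam U M)
    (hcol : ∀ m z, z ∈ col m ↔ ∃ m', UMem U M m' m ∧ col m' = z) {k : ℕ}
    (ψ : langSet.BoundedFormula Empty k) (m : Fin k → ZFSet.{u}) (hm : ∀ i, m i ∈ M) :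
    ESat (img col M : Set ZFSet.{u}) ψ (fun i => col (m i)) ↔
      ∀ᶠ x in U, ESat (HC lam) ψ fun i => app (m i) x := by
  have ht : ∀ {k : ℕ} (a : Fin k → ZFSet.{u}) (f : ZFSet.{u} → ZFSet.{u})
      (t : langSet.Term (Empty ⊕ Fin k)), ∃ i, t = .var (.inr i) := by
    intro k a f t
    match t with
    | .var (.inl e) => exact e.elim
    | .var (.inr i) => exact ⟨i, rfl⟩
    | .func f _ => exact Empty.elim f
  induction ψ with
  | falsum => exact ⟨fun h => h.elim, fun h => h.exists.choose_spec⟩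
  | equal t s =>
    obtain ⟨i, rfl⟩ := ht m id t
    obtain ⟨j, rfl⟩ := ht m id s
    exact ⟨eventually_eq_of_collapse_eq hM hB hdec hcol (hm i) (hm j),
      collapse_eq_of_eventually_eq hcol⟩
  | rel R ts =>
    cases R with
    | mem =>
      obtain ⟨i, hi⟩ := ht m id (ts 0)
      obtain ⟨j, hj⟩ := ht m id (ts 1)
      simp only [ESat, Sat, relHolds, hi, hj, tval]
      exact collapse_mem_iff hM hB hdec hcol (hm i)
    | pred p => exact p.elim
  | imp φ ψ ih1 ih2 =>
    have : ESat (img col M : Set ZFSet.{u}) (φ.imp ψ) (fun i => col (m i)) ↔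
      ((∀ᶠ x in U, ESat (HC lam) φ fun i => app (m i) x) →
        ∀ᶠ x in U, ESat (HC lam) ψ fun i => app (m i) x) := imp_congr (ih1 m hm) (ih2 m hm)
    rw [this]
    constructor
    · intro h
      rcases hdec φ m hm with h1 | h1
      · exact (h h1).mono fun x hx _ => hx
      · exact h1.mono fun x hx hx' => absurd hx' hx
    · intro h h'
      filter_upwards [h, h'] with x hx hx'
      exact hx hx'
  | @all k φ ih =>
    have hs : ∀ c, (Fin.snoc (fun i => col (m i)) (col c) : Fin (k + 1) → ZFSet.{u}) =
        fun i => col ((Fin.snoc m c : Fin (k + 1) → ZFSet.{u}) i) := fun c =>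
      (Fin.comp_snoc col m c).symm
    constructor
    · intro h
      rcases hdec φ.all m hm with h1 | h1
      · exact h1
      exfalso
      -- A function in M picks a counterexample at every x ∈ B that has one. Its class in the
      -- ultrapower then contradicts the assumed universal statement.
      obtain ⟨c, hc, hc'⟩ := hM.skolem (notF φ) m hm
      have h2 : ∀ᶠ x in U, ESat (HC lam) φ (Fin.snoc (fun i => app (m i) x) (app c x)) := by
        have h3 : ESat (img col M : Set ZFSet.{u}) φ (Fin.snoc (fun i => col (m i)) (col c)) :=
          h (col c) (mem_img_of_mem hc)
        rw [hs] at h3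
        simpa only [comp_snoc_app] using
          (ih _ (snoc_mem (s := (M : Set ZFSet.{u})) hm hc)).1 h3
      obtain ⟨x, h1, h2, hxB⟩ := (h1.and (h2.and hB)).exists
      refine hc' x hxB ?_ h2
      have h1' : ¬ ∀ b ∈ HC lam, ESat (HC lam) φ (Fin.snoc (fun i => app (m i) x) b) := h1
      push Not at h1'
      exact h1'
    · intro h b hb
      obtain ⟨c, hc, rfl⟩ := mem_img.1 hb
      have : ESat (img col M : Set ZFSet.{u}) φ
          (fun i => col ((Fin.snoc m c : Fin (k + 1) → ZFSet.{u}) i)) := by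
        refine (ih _ (snoc_mem (s := (M : Set ZFSet.{u})) hm hc)).2 ?_
        simp only [comp_snoc_app]
        exact h.mono fun x hx => hx _ (app_mem_HC (hM.sub c hc) x)
      rw [← hs] at this
      exact this

end ultrapower

/-! ### The embedding given by a threadable set -/

/-- The order type of `x ∩ β`, as a von Neumann ordinal. -/
noncomputable def pos (x β : ZFSet.{u}) : ZFSet.{u} :=
  ZFSet.range fun γ : {γ : β // γ.1 ∈ x} => pos x γ
termination_by β
decreasing_by exact γ.1.2

theorem mem_pos {x β a : ZFSet.{u}} : a ∈ pos x β ↔ ∃ γ ∈ β, γ ∈ x ∧ pos x γ = a := by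
  rw [pos, ZFSet.mem_range]
  exact ⟨fun ⟨γ, h⟩ => ⟨γ, γ.1.2, γ.2, h⟩, fun ⟨γ, h, h', h''⟩ => ⟨⟨⟨γ, h⟩, h'⟩, h''⟩⟩

theorem pos_eq_self {x β : ZFSet.{u}} (hβ : β.IsOrdinal) (h : β ⊆ x) : pos x β = β := by
  induction β using ZFSet.inductionOn with
  | _ β ih =>
    have hγ : ∀ γ ∈ β, pos x γ = γ := fun γ hγ =>
      ih γ hγ (hβ.mem hγ) ((hβ.subset_of_mem hγ).trans h)
    ext a
    rw [mem_pos]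
    constructor
    · rintro ⟨γ, h1, -, rfl⟩
      rwa [hγ γ h1]
    · exact fun ha => ⟨a, ha, h ha, hγ a ha⟩

theorem isOrdinal_pos {x β : ZFSet.{u}} (hβ : β.IsOrdinal) : (pos x β).IsOrdinal := by
  induction β using ZFSet.inductionOn with
  | _ β ih =>
    rw [ZFSet.isOrdinal_iff_forall_mem_isOrdinal]
    refine ⟨fun a ha b hb => ?_, fun a ha => ?_⟩
    · obtain ⟨γ, hγ, -, rfl⟩ := mem_pos.1 ha
      obtain ⟨δ, hδ, hδx, rfl⟩ := mem_pos.1 hb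
      exact mem_pos.2 ⟨δ, hβ.mem_trans hδ hγ, hδx, rfl⟩
    · obtain ⟨γ, hγ, -, rfl⟩ := mem_pos.1 ha
      exact ih γ hγ (hβ.mem hγ)

theorem card_pos_le (x β : ZFSet.{u}) : (pos x β).card ≤ x.card := by
  refine (ZFSet.card_mono (y := img (pos x) x) fun a ha => ?_).trans (card_img_le _ _)
  obtain ⟨γ, -, hγ, rfl⟩ := mem_pos.1 ha
  exact mem_img_of_mem hγ

open Classical in
/-- The `γ ∈ x ∩ β` whose position is `app m x`. -/
noncomputable def preimagePos (m β x : ZFSet.{u}) : ZFSet.{u} :=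
  if h : ∃ γ ∈ β, γ ∈ x ∧ pos x γ = app m x then h.choose else x

theorem preimagePos_spec {m β x : ZFSet.{u}} (h : app m x ∈ pos x β) :
    preimagePos m β x ∈ β ∧ preimagePos m β x ∈ x ∧ pos x (preimagePos m β x) = app m x := by
  have h' := mem_pos.1 h
  rw [preimagePos, dif_pos h']
  exact h'.choose_spec

theorem mk_list_le_lift {lam : Cardinal.{u}} (hl : ℵ₀ ≤ lam) {M : ZFSet.{u}} (hM : M.card ≤ lam) :
    #(List M) ≤ lift.{u + 1} lam :=
  (mk_list_le_max _).trans (max_le (by rwa [aleph0_le_lift]) (card_le_iff.1 hM))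

theorem Ev.decidesFormulas {κ lam : Cardinal.{u}} (hl : ℵ₀ ≤ lam) {M : ZFSet.{u}}
    (hM : M.card ≤ lam) : Ev κ lam fun U => DecidesFormulas lam U M := by
  let f : (Σ k, langSet.BoundedFormula Empty k) × List M → ZFSet.{u} → Prop := fun p x =>
    ESat (HC lam) p.1.2 fun i => app (tup p.1.1 (p.2.map Subtype.val) i) x
  have hf : #(Set.range f) ≤ lift.{u + 1} lam := by
    have hl' : ℵ₀ ≤ lift.{u + 1} lam := by rwa [aleph0_le_lift]
    refine mk_range_le.trans ?_
    rw [mk_prod]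
    refine (mul_le_mul' ?_ ?_).trans (mul_eq_self hl').le
    · have := countable_formulas 0
      exact (lift_le_aleph0.2 mk_le_aleph0).trans hl'
    · simpa using mk_list_le_lift hl hM
  refine (Ev.forall hl hf (P := fun Q U => (∀ᶠ x in U, Q x) ∨ ∀ᶠ x in U, ¬ Q x)
    fun Q _ => Ev.decide hl Q).mono fun U _ h k ψ m hm => ?_
  have := h (f ⟨⟨k, ψ⟩, List.ofFn fun i => (⟨m i, hm i⟩ : M)⟩) ⟨_, rfl⟩
  have e : (List.ofFn fun i => (⟨m i, hm i⟩ : M)).map Subtype.val = List.ofFn m := by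
    rw [List.map_ofFn]; rfl
  simpa only [f, e, tup_ofFn] using this

/-- The embedding sends a to the class of the constant function a. Elementarity combines Łoś, which
compares the ultrapower with H(λ⁺), and M ≺ H(λ⁺). -/
theorem Threadable.weaklyCompact {κ lam : Cardinal.{u}} {W : ZFSet.{u}} (hle : κ ≤ lam)
    (hpow : lam ^< κ ≤ lam) (hκ : κ.IsInaccessible) (hW : W ⊆ Pk κ (cset lam))
    (h : Threadable κ lam W) : WeaklyCompact κ lam W := by
  intro A hA
  have hl : ℵ₀ ≤ lam := hκ.aleph0_lt.le.trans hle
  set L := cset lam with hL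
  have ordL : ∀ {β}, β ∈ L → β.IsOrdinal := fun hβ => isOrdinal_of_mem_cset hβ
  have hsub : ∀ {x}, x ⊆ L → x ∈ HC lam := fun {x} hx => mem_HC_of_subset (fun a ha =>
    isOrdinal_mem_HC (ordL (hx ha)) (card_lt_of_mem_cset (hx ha)).le)
      ((ZFSet.card_mono hx).trans (card_cset lam).le)
  set B := Pk κ L with hBdef
  have hB : B ∈ HC lam := mem_HC_of_subset (fun x hx => hsub (mem_Pk.1 hx).1)
    (card_Pk_le hle hl hpow (card_cset lam).le)
  have hLH : L ∈ HC lam := hsub fun _ h => h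
  have hposH : ∀ x ∈ B, ∀ β, β.IsOrdinal → pos x β ∈ HC lam := fun x hx β hβ =>
    isOrdinal_mem_HC (isOrdinal_pos hβ) ((card_pos_le x β).trans
      (card_le_of_mem_HC (hsub (mem_Pk.1 hx).1)))
  -- The function x ↦ otp(x ∩ β) represents β for every β ≤ λ. Taking β = λ gives λ < j(κ), since
  -- otp(x) < κ; for β < κ almost every x contains β, so the function is almost constantly β.
  set o : ZFSet.{u} → ZFSet.{u} := fun β => graph B fun x => pos x β with ho
  set idc := graph B fun x => x with hidc
  have hlift : ∀ a : ZFSet.{u}, #({a} : Set ZFSet.{u}) ≤ lift.{u + 1} lam := fun a =>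
    mk_le_lift_of_countable hl (Set.countable_singleton a)
  obtain ⟨M, hM⟩ := exists_goodModel hl hB
    (C := {L} ∪ ({W} ∪ ({A} ∪ ({o L} ∪ ({idc} ∪ o '' (L : Set ZFSet.{u}))))))
    (mk_union_le_lift hl (hlift _) (mk_union_le_lift hl (hlift _) (mk_union_le_lift hl (hlift _)
      (mk_union_le_lift hl (hlift _) (mk_union_le_lift hl (hlift _)
        (mk_image_le.trans (mk_cset lam).le)))))) (by
      rintro c (rfl | rfl | rfl | rfl | rfl | ⟨β, hβ, rfl⟩)
      · exact hLH
      · exact mem_HC_of_subset_mem hB hW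
      · exact hsub hA
      · exact graph_mem_HC hl hB fun x hx => hposH x hx _ (isOrdinal_cset lam)
      · exact graph_mem_HC hl hB fun x hx => mem_HC_of_mem hB hx
      · exact graph_mem_HC hl hB fun x hx => hposH x hx _ (ordL hβ)) (Or.inl rfl)
  have hLM : L ∈ M := hM.const (Or.inl rfl)
  have hWM : W ∈ M := hM.const (Or.inr (Or.inl rfl))
  have hAM : A ∈ M := hM.const (Or.inr (Or.inr (Or.inl rfl)))
  have hoLM : o L ∈ M := hM.const (Or.inr (Or.inr (Or.inr (Or.inl rfl))))
  have hidM : idc ∈ M := hM.const (Or.inr (Or.inr (Or.inr (Or.inr (Or.inl rfl)))))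
  have hoM : ∀ β ∈ L, o β ∈ M := fun β hβ =>
    hM.const (Or.inr (Or.inr (Or.inr (Or.inr (Or.inr ⟨β, hβ, rfl⟩)))))
  have hκM : cset κ ∈ M := by
    rcases hle.eq_or_lt with e | hlt
    · rw [e]; exact hLM
    · exact hM.trans _ hLM (cset_mem_cset.2 hlt)
  obtain ⟨U, hU, hUW, hdec, happ, hpre⟩ := h.exists_filter hle hκ.isRegular hW
    ((Ev.decidesFormulas hl hM.card_le).and hl ((Ev.forall hl (card_le_iff.1 hM.card_le)
      fun m _ => Ev.decides (κ := κ) hl (app m)).and hl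
      (Ev.forall hl (card_le_iff.1 hM.card_le) fun m _ => Ev.forall hl
        (mk_union_le_lift hl (hlift L) (mk_cset lam).le) fun β _ =>
          Ev.decides (κ := κ) hl (preimagePos m β))))
  have := hU.neBot
  have hUB : ∀ᶠ x in U, x ∈ B := hU.pk
  obtain ⟨col, hcol⟩ := exists_collapse (wellFounded_UMem hU hκ.aleph0_lt M)
    fun _ _ h => h.1
  let N := img col M
  let cn : ZFSet.{u} → ZFSet.{u} := fun a => graph B fun _ => a
  have happcn : ∀ a, ∀ᶠ x in U, app (cn a) x = a := fun a => hUB.mono fun x hx => app_graph hx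
  have happo : ∀ β, ∀ᶠ x in U, app (o β) x = pos x β := fun β => hUB.mono fun x hx =>
    app_graph (h := fun x => pos x β) hx
  have happid : ∀ᶠ x in U, app idc x = x := hUB.mono fun x hx => app_graph (h := fun x => x) hx
  have hcolmem : ∀ {m m'}, m ∈ M → (col m ∈ col m' ↔ ∀ᶠ x in U, app m x ∈ app m' x) :=
    fun hm => collapse_mem_iff hM hUB hdec hcol hm
  -- the functions `o β` represent the ordinals up to `λ`
  have hcolo : ∀ β, β ∈ L ∨ β = L → col (o β) = β := by
    intro β
    induction β using ZFSet.inductionOn with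
    | _ β ih =>
    intro hβ
    have hβL : ∀ γ ∈ β, γ ∈ L := by
      rcases hβ with hβ | rfl
      · exact fun γ hγ => subset_cset_of_mem hβ hγ
      · exact fun _ h => h
    ext a
    constructor
    · intro ha
      obtain ⟨m, ⟨hm, hm'⟩, rfl⟩ := (hcol _ _).1 ha
      have hm' : ∀ᶠ x in U, app m x ∈ pos x β := by
        filter_upwards [hm', happo β] with x h1 h2
        rwa [← h2]
      -- A function below otp(x ∩ β) almost everywhere names an element of x ∩ β. That choice is
      -- regressive, hence constantly some η, and the function represents η.
      obtain ⟨η, hη⟩ := hpre m hm β (by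
        rcases hβ with hβ | rfl
        · exact Or.inr hβ
        · exact Or.inl rfl) (hm'.mono fun x hx => (preimagePos_spec hx).2.1).frequently
      obtain ⟨x, hx, hx'⟩ := (hη.and hm').exists
      have hηβ : η ∈ β := hx ▸ (preimagePos_spec hx').1
      rw [collapse_eq_of_eventually_eq (m' := o η) hcol, ih η hηβ (Or.inl (hβL η hηβ))]
      · exact hηβ
      · filter_upwards [hη, hm', happo η] with x h1 h2 h3
        rw [h3, ← h1, (preimagePos_spec h2).2.2]
    · intro ha
      rw [← ih a ha (Or.inl (hβL a ha)), hcolmem (hoM a (hβL a ha))]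
      filter_upwards [happo a, happo β, hU.fine a (hβL a ha)] with x h1 h2 h3
      rw [h1, h2]
      exact mem_pos.2 ⟨a, ha, h3, rfl⟩
  have hNtr : N.IsTransitive := by
    intro a ha b hb
    obtain ⟨m, -, rfl⟩ := mem_img.1 ha
    obtain ⟨m', hm', rfl⟩ := (hcol _ _).1 hb
    exact mem_img_of_mem hm'.1
  let j : M ↪ₑ[langSet] N :=
    { toFun := fun a => ⟨col (cn a), mem_img_of_mem (hM.constFn a a.2)⟩
      map_formula' := by
        intro n φ v
        rw [realize_iff_esat, realize_iff_esat]
        refine Iff.trans ?_ (hM.elem _ _ fun i => (v i).2).symm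
        refine (esat_collapse_iff hM hUB hdec hcol _ (fun i => cn (v i))
          fun i => hM.constFn _ (v i).2).trans ?_
        have e : ∀ᶠ x in U, (fun i => app (cn (v i)) x) = fun i => (v i : ZFSet.{u}) :=
          hUB.mono fun x hx => funext fun i => app_graph hx
        constructor
        · intro h'
          obtain ⟨x, h1, h2⟩ := (h'.and e).exists
          rwa [h2] at h1
        · intro h'
          filter_upwards [e] with x hx
          rwa [hx] }
  have hj : ∀ a : M, (j a : ZFSet.{u}) = col (cn a) := fun _ => rfl
  have hLj : L ∈ (j ⟨cset κ, hκM⟩ : ZFSet.{u}) := by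
    rw [hj, ← hcolo L (Or.inr rfl), hcolmem hoLM]
    filter_upwards [happo L, happcn (cset κ), hUB] with x h1 h2 h3
    rw [h1, h2]
    exact mem_cset_of_isOrdinal (isOrdinal_pos (isOrdinal_cset lam))
      ((card_pos_le _ _).trans_lt (mem_Pk.1 h3).2)
  refine ⟨M, N, hM.trans, hM.zfc, hNtr, hLM, hAM, hκM, hWM, j, ⟨isOrdinal_cset κ, ?_, ?_⟩, hLj,
    col idc, ?_, ?_⟩
  · rintro ⟨α, hα⟩ hακ
    have hαL : α ∈ L := cset_subset_cset.2 hle hακ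
    change col (cn α) = α
    rw [← hcolo α (Or.inl hαL)]
    refine collapse_eq_of_eventually_eq hcol ?_
    have hs := hU.subset (pk_mem_of_cset hle (subset_cset_of_mem hακ) (card_lt_of_mem_cset hακ))
    filter_upwards [happcn (col (o α)), happo α, hs] with x h1 h2 h3
    rw [h1, h2, hcolo α (Or.inl hαL), pos_eq_self (ordL hαL) h3]
  · intro h'
    rw [h'] at hLj
    exact absurd (cset_mem_cset.1 hLj) (not_lt.2 hle)
  · rw [hj, hcolmem hidM]
    filter_upwards [happid, happcn W, hUW] with x h1 h2 h3
    rwa [h1, h2]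
  · intro z
    constructor
    · intro hz
      obtain ⟨m, ⟨hm, hm'⟩, rfl⟩ := (hcol _ _).1 hz
      have hm' : ∀ᶠ x in U, app m x ∈ x := by
        filter_upwards [hm', happid] with x h1 h2
        rwa [h2] at h1
      -- The members of the class of the identity are the regressive functions in M. Each is almost
      -- constant with a value in λ, so that class is j''λ.
      obtain ⟨η, hη⟩ := happ m hm hm'.frequently
      obtain ⟨x, h1, h2, h3⟩ := (hη.and (hm'.and hUB)).exists
      have hηL : η ∈ L := (mem_Pk.1 h3).1 (h1 ▸ h2)
      refine ⟨⟨η, hM.trans _ hLM hηL⟩, hηL, ?_⟩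
      rw [hj]
      refine collapse_eq_of_eventually_eq hcol ?_
      filter_upwards [hη, happcn η] with x h1 h2
      rw [h1, h2]
    · rintro ⟨α, hα, rfl⟩
      rw [hj, hcolmem (hM.constFn _ α.2)]
      filter_upwards [happid, happcn α, hU.fine _ hα] with x h1 h2 h3
      rwa [h1, h2]

/-! ### Predicates definable uniformly in transitive sets -/

/-- The function `t` of the assignment is one of the variables. -/
def IsVar {n : ℕ} (t : (Fin n → ZFSet.{u}) → ZFSet.{u}) : Prop := ∃ i, ∀ v, t v = v i

theorem IsVar.init {n : ℕ} {t : (Fin n → ZFSet.{u}) → ZFSet.{u}} (h : IsVar t) :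
    IsVar fun v : Fin (n + 1) → ZFSet.{u} => t (Fin.init v) := by
  obtain ⟨i, hi⟩ := h
  exact ⟨i.castSucc, fun v => hi _⟩

theorem isVar_last {n : ℕ} : IsVar fun v : Fin (n + 1) → ZFSet.{u} => v (Fin.last n) :=
  ⟨_, fun _ => rfl⟩

/-- The predicate `P` is defined by the same formula in all transitive sets. -/
def Dfn {n : ℕ} (P : ZFSet.{u} → (Fin n → ZFSet.{u}) → Prop) : Prop :=
  ∃ ψ : langSet.BoundedFormula Empty n, ∀ D : ZFSet.{u}, D.IsTransitive →
    ∀ v : Fin n → ZFSet.{u}, (∀ i, v i ∈ D) → (ESat (D : Set ZFSet.{u}) ψ v ↔ P D v)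

section Dfn

variable {n : ℕ} {P Q : ZFSet.{u} → (Fin n → ZFSet.{u}) → Prop}
  {s t r : (Fin n → ZFSet.{u}) → ZFSet.{u}}
  {K : ZFSet.{u} → (Fin n → ZFSet.{u}) → ZFSet.{u} → Prop}

theorem Dfn.congr (h : Dfn P) (hPQ : ∀ D : ZFSet.{u}, D.IsTransitive →
    ∀ v : Fin n → ZFSet.{u}, (∀ i, v i ∈ D) → (P D v ↔ Q D v)) : Dfn Q := by
  obtain ⟨ψ, hψ⟩ := h
  exact ⟨ψ, fun D hD v hv => (hψ D hD v hv).trans (hPQ D hD v hv)⟩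

theorem Dfn.mem (hs : IsVar s) (ht : IsVar t) :
    Dfn fun (_ : ZFSet.{u}) v => s v ∈ t v := by
  obtain ⟨i, hi⟩ := hs
  obtain ⟨j, hj⟩ := ht
  refine ⟨memF i j, fun D _ v _ => ?_⟩
  beta_reduce
  rw [hi, hj]
  exact Iff.rfl

theorem Dfn.eq (hs : IsVar s) (ht : IsVar t) :
    Dfn fun (_ : ZFSet.{u}) v => s v = t v := by
  obtain ⟨i, hi⟩ := hs
  obtain ⟨j, hj⟩ := ht
  refine ⟨eqF i j, fun D _ v _ => ?_⟩
  beta_reduce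
  rw [hi, hj]
  exact Iff.rfl

theorem Dfn.not (hP : Dfn P) : Dfn fun D v => ¬ P D v := by
  obtain ⟨φ, hφ⟩ := hP
  exact ⟨notF φ, fun D hD v hv => not_congr (hφ D hD v hv)⟩

theorem Dfn.imp (hP : Dfn P) (hQ : Dfn Q) : Dfn fun D v => P D v → Q D v := by
  obtain ⟨φ, hφ⟩ := hP
  obtain ⟨ψ, hψ⟩ := hQ
  exact ⟨φ.imp ψ, fun D hD v hv => imp_congr (hφ D hD v hv) (hψ D hD v hv)⟩

theorem Dfn.and (hP : Dfn P) (hQ : Dfn Q) : Dfn fun D v => P D v ∧ Q D v :=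
  (hP.imp hQ.not).not.congr fun D _ v _ => by tauto

theorem Dfn.or (hP : Dfn P) (hQ : Dfn Q) : Dfn fun D v => P D v ∨ Q D v :=
  (hP.not.imp hQ).congr fun D _ v _ => by tauto

theorem Dfn.iff (hP : Dfn P) (hQ : Dfn Q) : Dfn fun D v => (P D v ↔ Q D v) :=
  ((hP.imp hQ).and (hQ.imp hP)).congr fun D _ v _ => by tauto

theorem Dfn.ex (h : Dfn fun D (v : Fin (n + 1) → ZFSet.{u}) => K D (Fin.init v) (v (Fin.last n))) :
    Dfn fun D v => ∃ b ∈ D, K D v b := by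
  obtain ⟨φ, hφ⟩ := h
  refine ⟨exF φ, fun D hD v hv => sat_ex.trans ?_⟩
  refine exists_congr fun b => and_congr_right fun hb => ?_
  refine (hφ D hD _ (snoc_mem (s := (D : Set ZFSet.{u})) hv hb)).trans ?_
  beta_reduce
  rw [Fin.init_snoc, Fin.snoc_last]

theorem Dfn.all (h : Dfn fun D (v : Fin (n + 1) → ZFSet.{u}) =>
    K D (Fin.init v) (v (Fin.last n))) : Dfn fun D v => ∀ b ∈ D, K D v b :=
  (Dfn.ex (K := fun D v b => ¬ K D v b) h.not).not.congr fun D _ v _ => by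
    push Not; exact Iff.rfl

theorem IsVar.mem_of_mem (ht : IsVar t) {D : ZFSet.{u}} (hD : D.IsTransitive)
    {v : Fin n → ZFSet.{u}} (hv : ∀ i, v i ∈ D) {b : ZFSet.{u}} (hb : b ∈ t v) : b ∈ D := by
  obtain ⟨i, hi⟩ := ht
  rw [hi] at hb
  exact hD _ (hv i) hb

theorem Dfn.bex (ht : IsVar t) (h : Dfn fun D (v : Fin (n + 1) → ZFSet.{u}) =>
    K D (Fin.init v) (v (Fin.last n))) : Dfn fun D v => ∃ b ∈ t v, K D v b :=
  (Dfn.ex (K := fun D v b => b ∈ t v ∧ K D v b) ((Dfn.mem isVar_last ht.init).and h)).congr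
    fun _ hD _ hv => ⟨fun ⟨b, _, h⟩ => ⟨b, h⟩, fun ⟨b, h⟩ => ⟨b, ht.mem_of_mem hD hv h.1, h⟩⟩

theorem Dfn.ball (ht : IsVar t) (h : Dfn fun D (v : Fin (n + 1) → ZFSet.{u}) =>
    K D (Fin.init v) (v (Fin.last n))) : Dfn fun D v => ∀ b ∈ t v, K D v b :=
  (Dfn.all (K := fun D v b => b ∈ t v → K D v b) ((Dfn.mem isVar_last ht.init).imp h)).congr
    fun _ hD _ hv => ⟨fun h b hb => h b (ht.mem_of_mem hD hv hb) hb, fun h b _ hb => h b hb⟩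

theorem Dfn.upair_eq (hs : IsVar s) (ht : IsVar t) (hr : IsVar r) :
    Dfn fun (_ : ZFSet.{u}) v => s v = {t v, r v} := by
  refine (((Dfn.mem ht hs).and (Dfn.mem hr hs)).and (Dfn.ball hs
    (K := fun _ v b => b = t v ∨ b = r v) ((Dfn.eq isVar_last ht.init).or
      (Dfn.eq isVar_last hr.init)))).congr fun D _ v _ => ?_
  constructor
  · rintro ⟨⟨h1, h2⟩, h3⟩
    ext b
    rw [ZFSet.mem_pair]
    refine ⟨h3 b, ?_⟩
    rintro (rfl | rfl)
    · exact h1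
    · exact h2
  · intro h
    rw [h]
    exact ⟨⟨ZFSet.mem_pair.2 (Or.inl rfl), ZFSet.mem_pair.2 (Or.inr rfl)⟩,
      fun b hb => ZFSet.mem_pair.1 hb⟩

theorem Dfn.pair_eq (hs : IsVar s) (ht : IsVar t) (hr : IsVar r) :
    Dfn fun (_ : ZFSet.{u}) v => s v = ZFSet.pair (t v) (r v) := by
  refine (Dfn.bex hs (K := fun _ v a => ∃ b ∈ s v, a = {t v, t v} ∧ b = {t v, r v} ∧ s v = {a, b})
    (Dfn.bex hs.init (K := fun _ v b => v (Fin.last n) = {t (Fin.init v), t (Fin.init v)} ∧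
      b = {t (Fin.init v), r (Fin.init v)} ∧ s (Fin.init v) = {v (Fin.last n), b})
      ((Dfn.upair_eq isVar_last.init ht.init.init ht.init.init).and
        ((Dfn.upair_eq isVar_last ht.init.init hr.init.init).and
          (Dfn.upair_eq hs.init.init isVar_last.init isVar_last))))).congr fun D _ v _ => ?_
  rw [ZFSet.pair]
  constructor
  · rintro ⟨a, -, b, -, rfl, rfl, h⟩
    rw [h, ZFSet.pair_eq_singleton]
  · intro h
    refine ⟨_, ?_, _, ?_, rfl, rfl, ?_⟩
    · rw [h, ZFSet.pair_eq_singleton]; exact ZFSet.mem_pair.2 (Or.inl rfl)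
    · rw [h]; exact ZFSet.mem_pair.2 (Or.inr rfl)
    · rw [h, ZFSet.pair_eq_singleton]

theorem Dfn.pair_mem (ht : IsVar t) (hr : IsVar r) (hs : IsVar s) :
    Dfn fun (_ : ZFSet.{u}) v => ZFSet.pair (t v) (r v) ∈ s v :=
  (Dfn.bex hs (K := fun _ v b => b = ZFSet.pair (t v) (r v))
    (Dfn.pair_eq isVar_last ht.init hr.init)).congr fun D _ v _ => by
      constructor
      · rintro ⟨b, hb, rfl⟩; exact hb
      · exact fun h => ⟨_, h, rfl⟩

end Dfn

/-- The renaming σ reconciles the axioms, which put the distinguished variables first, with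
quantification, which appends variables last. -/
theorem exists_formula_of_bounded {n m : ℕ} (ψ : langSet.BoundedFormula Empty n)
    (σ : Fin n → Fin m) : ∃ φ : langSet.Formula (Fin m), ∀ (D : ZFSet.{u}) (v : Fin m → D),
      φ.Realize v ↔ ESat (D : Set ZFSet.{u}) ψ fun i => (v (σ i) : ZFSet.{u}) := by
  refine ⟨ψ.toFormula.relabel (Sum.elim Empty.elim σ), fun D v => ?_⟩
  rw [FirstOrder.Language.Formula.realize_relabel,
    FirstOrder.Language.BoundedFormula.realize_toFormula]
  exact realize_iff_sat (I := fun p : Empty => p.elim) (J := fun p : Empty => p.elim)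
    (fun p => p.elim) ψ _ _

/-- All uses of elementarity pass through this: N and M interpret a uniformly definable predicate by
the same formula, although quantifiers over the domain range over different sets. -/
theorem Dfn.map {n : ℕ} {P : ZFSet.{u} → (Fin n → ZFSet.{u}) → Prop} (hP : Dfn P)
    {M N : ZFSet.{u}} (hM : M.IsTransitive) (hN : N.IsTransitive) (j : M ↪ₑ[langSet] N)
    (v : Fin n → M) : P N (fun i => (j (v i) : ZFSet.{u})) ↔ P M fun i => (v i : ZFSet.{u}) := by
  obtain ⟨ψ, hψ⟩ := hP
  obtain ⟨φ, hφ⟩ := exists_formula_of_bounded ψ id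
  rw [← hψ M hM _ fun i => (v i).2, ← hψ N hN _ fun i => (j (v i)).2]
  have := j.map_formula φ v
  rw [hφ, hφ] at this
  exact this

/-! ### Sets in a transitive model of `ZFC⁻` -/

namespace ModelsZFCMinus

variable {M : ZFSet.{u}}

theorem sep_mem (h : ModelsZFCMinus M) (hM : M.IsTransitive) {n : ℕ}
    {K : ZFSet.{u} → (Fin n → ZFSet.{u}) → ZFSet.{u} → Prop}
    (hK : Dfn fun D (v : Fin (n + 1) → ZFSet.{u}) => K D (Fin.init v) (v (Fin.last n)))
    {p : Fin n → ZFSet.{u}} (hp : ∀ i, p i ∈ M) {a : ZFSet.{u}} (ha : a ∈ M) :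
    ZFSet.sep (fun x => K M p x) a ∈ M := by
  obtain ⟨ψ, hψ⟩ := hK
  obtain ⟨φ, hφ⟩ := exists_formula_of_bounded ψ (Fin.snoc Fin.succ 0 : Fin (n + 1) → Fin (n + 1))
  obtain ⟨b, hb⟩ := h.separation n φ (fun i => ⟨p i, hp i⟩) ⟨a, ha⟩
  convert b.2
  ext x
  rw [ZFSet.mem_sep]
  have key : ∀ x : M, (x : ZFSet.{u}) ∈ (b : ZFSet.{u}) ↔ (x : ZFSet.{u}) ∈ a ∧ K M p x := by
    intro x
    rw [hb x, hφ]
    refine and_congr_right fun _ => ?_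
    have e : (fun i => ((Fin.cons x (fun i => ⟨p i, hp i⟩) : Fin (n + 1) → M)
        ((Fin.snoc Fin.succ 0 : Fin (n + 1) → Fin (n + 1)) i) : ZFSet.{u})) =
          Fin.snoc p (x : ZFSet.{u}) := by
      funext i
      refine Fin.lastCases ?_ (fun i => ?_) i
      · simp
      · simp
    rw [e, hψ M hM _ (snoc_mem (s := (M : Set ZFSet.{u})) hp x.2)]
    beta_reduce
    rw [Fin.init_snoc, Fin.snoc_last]
  constructor
  · exact fun hx => (key ⟨x, hM _ ha hx.1⟩).2 hx
  · exact fun hx => (key ⟨x, hM _ b.2 hx⟩).1 hx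

/-- This is Replacement: Collection bounds the values, and Separation cuts the bound down to the
image. -/
theorem img_mem (h : ModelsZFCMinus M) (hM : M.IsTransitive) {n : ℕ}
    {K : ZFSet.{u} → (Fin n → ZFSet.{u}) → ZFSet.{u} → ZFSet.{u} → Prop}
    (hK : Dfn fun D (v : Fin (n + 1 + 1) → ZFSet.{u}) =>
      K D (Fin.init (Fin.init v)) (Fin.init v (Fin.last n)) (v (Fin.last (n + 1))))
    {p : Fin n → ZFSet.{u}} (hp : ∀ i, p i ∈ M) {a : ZFSet.{u}} (ha : a ∈ M)
    {f : ZFSet.{u} → ZFSet.{u}} (hf : ∀ x ∈ a, f x ∈ M)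
    (hKf : ∀ x ∈ a, ∀ y ∈ M, K M p x y ↔ y = f x) : img f a ∈ M := by
  obtain ⟨ψ, hψ⟩ := id hK
  let σ : Fin (n + 2) → Fin (n + 2) := Fin.snoc (Fin.snoc (fun i => i.succ.succ) 0) 1
  obtain ⟨φ, hφ⟩ := exists_formula_of_bounded ψ σ
  let p' : Fin n → M := fun i => ⟨p i, hp i⟩
  have key : ∀ x y : M, φ.Realize (Fin.cons x (Fin.cons y p') : Fin (n + 2) → M) ↔ K M p x y := by
    intro x y
    rw [hφ]
    have e : (fun i => ((Fin.cons x (Fin.cons y p') : Fin (n + 2) → M) (σ i) : ZFSet.{u})) =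
        Fin.snoc (Fin.snoc p (x : ZFSet.{u}) : Fin (n + 1) → ZFSet.{u}) (y : ZFSet.{u}) := by
      funext i
      refine Fin.lastCases ?_ (fun i => Fin.lastCases ?_ (fun i => ?_) i) i
      · simp only [σ, Fin.snoc_last]; rfl
      · simp only [σ, Fin.snoc_last, Fin.snoc_castSucc]; rfl
      · simp only [σ, Fin.snoc_castSucc, Fin.cons_succ, p']
    rw [e, hψ M hM _ (snoc_mem (s := (M : Set ZFSet.{u}))
      (snoc_mem (s := (M : Set ZFSet.{u})) hp x.2) y.2)]
    beta_reduce
    rw [Fin.init_snoc, Fin.init_snoc, Fin.snoc_last, Fin.snoc_last]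
  obtain ⟨b, hb⟩ := h.collection n φ p' ⟨a, ha⟩ fun x hx =>
    ⟨⟨f x, hf x hx⟩, (key _ _).2 ((hKf x hx _ (hf x hx)).2 rfl)⟩
  have hsub : ∀ x ∈ a, f x ∈ (b : ZFSet.{u}) := by
    intro x hx
    obtain ⟨y, hy, hy'⟩ := hb ⟨x, hM _ ha hx⟩ hx
    rw [key, hKf x hx _ y.2] at hy'
    rwa [← hy']
  have hmem : ∀ i, (Fin.snoc p a : Fin (n + 1) → ZFSet.{u}) i ∈ M :=
    snoc_mem (s := (M : Set ZFSet.{u})) hp ha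
  have := h.sep_mem hM (n := n + 1)
    (K := fun D v y => ∃ x ∈ v (Fin.last n), K D (Fin.init v) x y) ?_ hmem b.2
  · convert this using 1
    ext y
    rw [mem_img, ZFSet.mem_sep, Fin.snoc_last, Fin.init_snoc]
    constructor
    · rintro ⟨x, hx, rfl⟩
      exact ⟨hsub x hx, x, hx, (hKf x hx _ (hf x hx)).2 rfl⟩
    · rintro ⟨hy, x, hx, hxy⟩
      exact ⟨x, hx, ((hKf x hx y (hM _ b.2 hy)).1 hxy).symm⟩
  · refine Dfn.bex (K := fun D v x => K D (Fin.init (Fin.init v)) x (v (Fin.last (n + 1))))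
      isVar_last.init ?_
    let τ : Fin (n + 2) → Fin (n + 3) := Fin.snoc (Fin.snoc
      (fun i => i.castSucc.castSucc.castSucc) (Fin.last (n + 2))) (Fin.last (n + 1)).castSucc
    obtain ⟨χ, hχ⟩ := exists_formula_of_bounded ψ τ
    refine ⟨FirstOrder.Language.BoundedFormula.relabel
      (Sum.inr : Fin (n + 3) → Empty ⊕ Fin (n + 3)) χ, fun D hD v hv => ?_⟩
    have e := realize_iff_esat χ (fun i => (⟨v i, hv i⟩ : D))
    rw [← e, hχ, hψ D hD _ fun i => hv _]
    refine Eq.to_iff (congr (congrArg₂ (K D) ?_ ?_) ?_)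
    · funext i
      simp only [Fin.init, τ, Fin.snoc_castSucc]
    · simp only [Fin.init, τ, Fin.snoc_castSucc, Fin.snoc_last]
    · simp only [Fin.init, τ, Fin.snoc_last]

theorem upair_mem (h : ModelsZFCMinus M) (hM : M.IsTransitive) {a b : ZFSet.{u}} (ha : a ∈ M) (hb : b ∈ M) : ({a, b} : ZFSet.{u}) ∈ M := by
  obtain ⟨c, hc⟩ := h.pairing ⟨a, ha⟩ ⟨b, hb⟩
  convert c.2
  ext z
  rw [ZFSet.mem_pair]
  constructor
  · rintro (rfl | rfl)
    · exact (hc ⟨z, ha⟩).2 (Or.inl rfl)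
    · exact (hc ⟨z, hb⟩).2 (Or.inr rfl)
  · intro hz
    rcases (hc ⟨z, hM _ c.2 hz⟩).1 hz with h | h
    · exact Or.inl (congrArg Subtype.val h)
    · exact Or.inr (congrArg Subtype.val h)

theorem pair_mem (h : ModelsZFCMinus M) (hM : M.IsTransitive) {a b : ZFSet.{u}} (ha : a ∈ M) (hb : b ∈ M) : ZFSet.pair a b ∈ M := by
  rw [ZFSet.pair, ← ZFSet.pair_eq_singleton a]
  exact h.upair_mem hM (h.upair_mem hM ha ha) (h.upair_mem hM ha hb)

theorem bUnion_mem (h : ModelsZFCMinus M) (hM : M.IsTransitive) {a : ZFSet.{u}} (ha : a ∈ M) : bUnion a id ∈ M := by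
  obtain ⟨c, hc⟩ := h.union ⟨a, ha⟩
  convert c.2
  ext z
  rw [mem_bUnion]
  constructor
  · rintro ⟨y, hy, hz⟩
    have hyM := hM _ ha hy
    exact (hc ⟨z, hM _ hyM hz⟩).2 ⟨⟨y, hyM⟩, hy, hz⟩
  · intro hz
    obtain ⟨y, hy, hz⟩ := (hc ⟨z, hM _ c.2 hz⟩).1 hz
    exact ⟨y, hy, hz⟩

theorem insert_mem (h : ModelsZFCMinus M) (hM : M.IsTransitive) {a b : ZFSet.{u}} (ha : a ∈ M) (hb : b ∈ M) : insert a b ∈ M := by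
  convert h.bUnion_mem hM (h.upair_mem hM (h.upair_mem hM ha ha) hb)
  ext z
  simp [mem_bUnion]

theorem prod_mem (h : ModelsZFCMinus M) (hM : M.IsTransitive) {a b : ZFSet.{u}} (ha : a ∈ M) (hb : b ∈ M) : a.prod b ∈ M := by
  have h1 : ∀ x ∈ M, img (fun y => ZFSet.pair x y) b ∈ M := fun x hx =>
    h.img_mem hM (n := 1) (K := fun _ v y z => z = ZFSet.pair (v 0) y)
      (Dfn.pair_eq isVar_last ⟨0, fun _ => rfl⟩ isVar_last.init) (p := ![x]) (by simpa using hx) hb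
      (fun y hy => h.pair_mem hM hx (hM _ hb hy)) fun y _ z _ => by simp
  have h2 := h.img_mem hM (n := 1) (f := fun x => img (fun y => ZFSet.pair x y) b)
    (K := fun _ v x z => (∀ q ∈ z, ∃ y ∈ v 0, q = ZFSet.pair x y) ∧
      ∀ y ∈ v 0, ∃ q ∈ z, q = ZFSet.pair x y)
    (Dfn.and (Dfn.ball isVar_last (Dfn.bex ⟨0, fun _ => rfl⟩ (Dfn.pair_eq isVar_last.init
      isVar_last.init.init.init isVar_last))) (Dfn.ball ⟨0, fun _ => rfl⟩ (Dfn.bex isVar_last.init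
        (Dfn.pair_eq isVar_last isVar_last.init.init.init isVar_last.init)))) (p := ![b])
    (by simpa using hb) ha (fun x hx => h1 x (hM _ ha hx)) (by
      intro x _ z _
      simp only [Matrix.cons_val_fin_one]
      constructor
      · rintro ⟨h3, h4⟩
        ext q
        rw [mem_img]
        constructor
        · intro hq
          obtain ⟨y, hy, rfl⟩ := h3 q hq
          exact ⟨y, hy, rfl⟩
        · rintro ⟨y, hy, rfl⟩
          obtain ⟨q, hq, rfl⟩ := h4 y hy
          exact hq
      · rintro rfl
        refine ⟨fun q hq => ?_, fun y hy => ⟨_, mem_img.2 ⟨y, hy, rfl⟩, rfl⟩⟩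
        obtain ⟨y, hy, rfl⟩ := mem_img.1 hq
        exact ⟨y, hy, rfl⟩)
  convert h.bUnion_mem hM h2
  ext q
  rw [ZFSet.mem_prod, mem_bUnion]
  constructor
  · rintro ⟨x, hx, y, hy, rfl⟩
    exact ⟨_, mem_img_of_mem hx, mem_img.2 ⟨y, hy, rfl⟩⟩
  · rintro ⟨_, hz, hq⟩
    obtain ⟨x, hx, rfl⟩ := mem_img.1 hz
    obtain ⟨y, hy, rfl⟩ := mem_img.1 hq
    exact ⟨x, hx, y, hy, rfl⟩

end ModelsZFCMinus

/-! ### Collapsing well-orderings -/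

/-- The relation coded by the set of pairs `R`, with first coordinate in `D`. -/
def Pred (D R a b : ZFSet.{u}) : Prop := a ∈ D ∧ ZFSet.pair a b ∈ R

/-- `R` is a strict well-ordering of `D`. -/
structure IsWO (D R : ZFSet.{u}) : Prop where
  wf : WellFounded (Pred D R)
  trans : ∀ a ∈ D, ∀ b ∈ D, ∀ c ∈ D, ZFSet.pair a b ∈ R → ZFSet.pair b c ∈ R → ZFSet.pair a c ∈ R
  total : ∀ a ∈ D, ∀ b ∈ D, a = b ∨ ZFSet.pair a b ∈ R ∨ ZFSet.pair b a ∈ R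

/-- `F` is the collapse of `(D, R)`. -/
def IsCollapse (D R : ZFSet.{u}) (F : ZFSet.{u} → ZFSet.{u}) : Prop :=
  ∀ d y, y ∈ F d ↔ ∃ d', Pred D R d' d ∧ F d' = y

section collapse

variable {D R S : ZFSet.{u}} {F : ZFSet.{u} → ZFSet.{u}}

theorem IsWO.mono (h : IsWO D R) (hS : S ⊆ D) : IsWO S R where
  wf := Subrelation.wf (fun {_ _} h' => ⟨hS h'.1, h'.2⟩) h.wf
  trans a ha b hb c hc := h.trans a (hS ha) b (hS hb) c (hS hc)
  total a ha b hb := h.total a (hS ha) b (hS hb)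

theorem IsWO.exists_isCollapse (h : IsWO D R) : ∃ F, IsCollapse D R F :=
  exists_collapse h.wf fun _ _ h' => h'.1

theorem IsCollapse.isOrdinal (hF : IsCollapse D R F) (h : IsWO D R) :
    ∀ d ∈ D, (F d).IsOrdinal := by
  intro d
  induction d using h.wf.induction with
  | _ d ih =>
    intro hd
    rw [ZFSet.isOrdinal_iff_forall_mem_isOrdinal]
    constructor
    · intro a ha b hb
      obtain ⟨d', hd', rfl⟩ := (hF _ _).1 ha
      obtain ⟨d'', hd'', rfl⟩ := (hF _ _).1 hb
      exact (hF _ _).2 ⟨d'', ⟨hd''.1, h.trans _ hd''.1 _ hd'.1 _ hd hd''.2 hd'.2⟩, rfl⟩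
    · intro a ha
      obtain ⟨d', hd', rfl⟩ := (hF _ _).1 ha
      exact ih d' hd' hd'.1

theorem IsCollapse.isOrdinal_img (hF : IsCollapse D R F) (h : IsWO D R) :
    (img F D).IsOrdinal := by
  rw [ZFSet.isOrdinal_iff_forall_mem_isOrdinal]
  constructor
  · intro a ha b hb
    obtain ⟨d, -, rfl⟩ := mem_img.1 ha
    obtain ⟨d', hd', rfl⟩ := (hF _ _).1 hb
    exact mem_img_of_mem hd'.1
  · intro a ha
    obtain ⟨d, hd, rfl⟩ := mem_img.1 ha
    exact hF.isOrdinal h d hd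

theorem IsCollapse.inj (hF : IsCollapse D R F) (h : IsWO D R) {a b : ZFSet.{u}} (ha : a ∈ D)
    (hb : b ∈ D) (hab : F a = F b) : a = b := by
  rcases h.total a ha b hb with h' | h' | h'
  · exact h'
  · have : F a ∈ F b := (hF _ _).2 ⟨a, ⟨ha, h'⟩, rfl⟩
    rw [hab] at this
    exact absurd this (ZFSet.mem_irrefl _)
  · have : F b ∈ F a := (hF _ _).2 ⟨b, ⟨hb, h'⟩, rfl⟩
    rw [hab] at this
    exact absurd this (ZFSet.mem_irrefl _)

theorem IsCollapse.card_le (hF : IsCollapse D R F) {d : ZFSet.{u}}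
    (hS : ∀ d', Pred D R d' d → d' ∈ S) : (F d).card ≤ S.card := by
  refine (ZFSet.card_mono (y := img F S) fun a ha => ?_).trans (card_img_le _ _)
  obtain ⟨d', hd', rfl⟩ := (hF _ _).1 ha
  exact mem_img_of_mem (hS _ hd')

end collapse

theorem pair_mem_graph {D q t : ZFSet.{u}} {F : ZFSet.{u} → ZFSet.{u}} :
    ZFSet.pair q t ∈ graph D F ↔ q ∈ D ∧ t = F q := by
  rw [graph, mem_img]
  constructor
  · rintro ⟨x, hx, h⟩
    obtain ⟨rfl, rfl⟩ := ZFSet.pair_inj.1 h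
    exact ⟨hx, rfl⟩
  · rintro ⟨hq, rfl⟩
    exact ⟨q, hq, rfl⟩

theorem mem_of_pair_mem {X a b c : ZFSet.{u}} (hX : X.IsTransitive) (hc : c ∈ X)
    (h : ZFSet.pair a b ∈ c) : a ∈ X ∧ b ∈ X := by
  have h1 : {a, b} ∈ X := hX _ (hX _ hc h) (by rw [ZFSet.pair]; exact ZFSet.mem_pair.2 (Or.inr rfl))
  exact ⟨hX _ h1 (ZFSet.mem_pair.2 (Or.inl rfl)), hX _ h1 (ZFSet.mem_pair.2 (Or.inr rfl))⟩

/-! ### Collapses in models of `ZFC⁻` -/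

/-- `g` is an attempt at the collapse of `(D, R)`, from the point of view of `X`. -/
def IsAttempt (X D R g : ZFSet.{u}) : Prop :=
  ∀ e ∈ D, ∀ z ∈ X, ZFSet.pair e z ∈ g →
    (∀ e' ∈ D, ZFSet.pair e' e ∈ R → ∃ w ∈ z, ZFSet.pair e' w ∈ g) ∧
      ∀ w ∈ z, ∃ e' ∈ D, ZFSet.pair e' e ∈ R ∧ ZFSet.pair e' w ∈ g

theorem dfn_attempt {n : ℕ} {D R d y : (Fin n → ZFSet.{u}) → ZFSet.{u}} (hD : IsVar D)
    (hR : IsVar R) (hd : IsVar d) (hy : IsVar y) :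
    Dfn fun X v => ∃ g ∈ X, IsAttempt X (D v) (R v) g ∧ ZFSet.pair (d v) (y v) ∈ g := by
  unfold IsAttempt
  refine Dfn.ex (Dfn.and (Dfn.ball hD.init (Dfn.all (Dfn.imp
    (Dfn.pair_mem isVar_last.init isVar_last isVar_last.init.init) (Dfn.and ?_ ?_))))
    (Dfn.pair_mem hd.init hy.init isVar_last))
  · exact Dfn.ball hD.init.init.init (Dfn.imp (Dfn.pair_mem isVar_last isVar_last.init.init
      hR.init.init.init.init) (Dfn.bex isVar_last.init (Dfn.pair_mem isVar_last.init isVar_last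
        isVar_last.init.init.init.init)))
  · exact Dfn.ball isVar_last (Dfn.bex hD.init.init.init.init (Dfn.and
      (Dfn.pair_mem isVar_last isVar_last.init.init.init hR.init.init.init.init.init)
      (Dfn.pair_mem isVar_last isVar_last.init isVar_last.init.init.init.init)))

/-- An attempt is not required to be a function; induction along the well-founded relation forces
each of its values to be the true collapse. -/
theorem IsAttempt.eq {X D R g : ZFSet.{u}} (hX : X.IsTransitive) (hg : IsAttempt X D R g)
    (hwf : WellFounded (Pred D R)) {F : ZFSet.{u} → ZFSet.{u}} (hF : IsCollapse D R F) :
    ∀ e ∈ D, ∀ z ∈ X, ZFSet.pair e z ∈ g → z = F e := by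
  intro e
  induction e using hwf.induction with
  | _ e ih =>
    intro he z hz hez
    obtain ⟨h1, h2⟩ := hg e he z hz hez
    ext w
    rw [hF]
    constructor
    · intro hw
      obtain ⟨e', he', hR, hg'⟩ := h2 w hw
      exact ⟨e', ⟨he', hR⟩, (ih e' ⟨he', hR⟩ he' w (hX _ hz hw) hg').symm⟩
    · rintro ⟨e', he', rfl⟩
      obtain ⟨w, hw, hg'⟩ := h1 e' he'.1 he'.2
      rwa [← ih e' he' he'.1 w (hX _ hz hw) hg']

/-- This is transfinite recursion inside M. Once every predecessor of d has an attempt in M,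
Replacement collects the graph below d, and adding the pair at d gives an attempt for d. -/
theorem ModelsZFCMinus.graph_collapse_mem {M D R : ZFSet.{u}} (h : ModelsZFCMinus M)
    (hM : M.IsTransitive) (hD : D ∈ M) (hR : R ∈ M) (hwo : IsWO D R) {F : ZFSet.{u} → ZFSet.{u}}
    (hF : IsCollapse D R F) : img F D ∈ M ∧ graph D F ∈ M := by
  let φ : ZFSet.{u} → ZFSet.{u} → Prop := fun d y =>
    ∃ g ∈ M, IsAttempt M D R g ∧ ZFSet.pair d y ∈ g
  have hφ : ∀ {d y}, d ∈ D → φ d y → y = F d ∧ y ∈ M := by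
    rintro d y hd ⟨g, hgM, hg, hdy⟩
    have hy := (mem_of_pair_mem hM hgM hdy).2
    exact ⟨hg.eq hM hwo.wf hF d hd y hy hdy, hy⟩
  have hp : ∀ i, (![D, R] : Fin 2 → ZFSet.{u}) i ∈ M := by
    intro i
    fin_cases i
    · exact hD
    · exact hR
  have key : ∀ S ∈ M, S ⊆ D → (∀ d ∈ S, φ d (F d)) → img F S ∈ M ∧ graph S F ∈ M := by
    intro S hS hSD hSφ
    constructor
    · refine h.img_mem hM (n := 2) (p := ![D, R]) (K := fun X v d y =>
        ∃ g ∈ X, IsAttempt X (v 0) (v 1) g ∧ ZFSet.pair d y ∈ g)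
        (dfn_attempt ⟨0, fun _ => rfl⟩ ⟨1, fun _ => rfl⟩ isVar_last.init isVar_last) hp hS
        (fun d hd => (hφ (hSD hd) (hSφ d hd)).2) fun d hd y _ => ?_
      exact ⟨fun hy => (hφ (hSD hd) hy).1, fun hy => hy ▸ hSφ d hd⟩
    · refine h.img_mem hM (n := 2) (p := ![D, R]) (K := fun X v d q =>
        ∃ y ∈ X, q = ZFSet.pair d y ∧ ∃ g ∈ X, IsAttempt X (v 0) (v 1) g ∧ ZFSet.pair d y ∈ g)
        (Dfn.ex (Dfn.and (Dfn.pair_eq isVar_last.init isVar_last.init.init isVar_last)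
          (dfn_attempt ⟨0, fun _ => rfl⟩ ⟨1, fun _ => rfl⟩ isVar_last.init.init isVar_last))) hp hS
        (fun d hd => h.pair_mem hM (hM _ hS hd) (hφ (hSD hd) (hSφ d hd)).2) fun d hd q _ => ?_
      constructor
      · rintro ⟨y, -, rfl, hy⟩
        rw [(hφ (hSD hd) hy).1]
      · rintro rfl
        exact ⟨F d, (hφ (hSD hd) (hSφ d hd)).2, rfl, hSφ d hd⟩
  have main : ∀ d ∈ D, φ d (F d) := by
    intro d
    induction d using hwo.wf.induction with
    | _ d ih =>
    intro hd
    have hS : ZFSet.sep (fun d' => ZFSet.pair d' d ∈ R) D ∈ M :=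
      h.sep_mem hM (n := 2) (p := ![d, R]) (K := fun _ v d' => ZFSet.pair d' (v 0) ∈ v 1)
        (Dfn.pair_mem isVar_last ⟨0, fun _ => rfl⟩ ⟨1, fun _ => rfl⟩) (by
          intro i
          fin_cases i
          · exact hM _ hD hd
          · exact hR) hD
    set S := ZFSet.sep (fun d' => ZFSet.pair d' d ∈ R) D with hSdef
    have hmem : ∀ d', d' ∈ S ↔ Pred D R d' d := fun d' => ZFSet.mem_sep
    obtain ⟨h1, h2⟩ := key S hS (fun d' hd' => ((hmem d').1 hd').1) fun d' hd' =>
      ih d' ((hmem d').1 hd') ((hmem d').1 hd').1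
    have himg : img F S = F d := by
      ext y
      rw [mem_img, hF]
      simp only [hmem]
    rw [himg] at h1
    refine ⟨_, h.insert_mem hM (h.pair_mem hM (hM _ hD hd) h1) h2, ?_,
      ZFSet.mem_insert_iff.2 (Or.inl rfl)⟩
    have hg : ∀ {e z}, ZFSet.pair e z ∈ insert (ZFSet.pair d (F d)) (graph S F) ↔
        (e = d ∨ Pred D R e d) ∧ z = F e := by
      intro e z
      rw [ZFSet.mem_insert_iff, ZFSet.pair_inj, pair_mem_graph, hmem]
      constructor
      · rintro (⟨rfl, rfl⟩ | ⟨h, rfl⟩)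
        · exact ⟨Or.inl rfl, rfl⟩
        · exact ⟨Or.inr h, rfl⟩
      · rintro ⟨rfl | h, rfl⟩
        · exact Or.inl ⟨rfl, rfl⟩
        · exact Or.inr ⟨h, rfl⟩
    intro e he z _ hez
    obtain ⟨hed, rfl⟩ := hg.1 hez
    have hlt : ∀ e' ∈ D, ZFSet.pair e' e ∈ R → Pred D R e' d := by
      intro e' he' h'
      rcases hed with rfl | hed
      · exact ⟨he', h'⟩
      · exact ⟨he', hwo.trans _ he' _ he _ hd h' hed.2⟩
    refine ⟨fun e' he' h' => ⟨F e', (hF _ _).2 ⟨e', ⟨he', h'⟩, rfl⟩,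
      hg.2 ⟨Or.inr (hlt e' he' h'), rfl⟩⟩, fun w hw => ?_⟩
    obtain ⟨e', he', rfl⟩ := (hF _ _).1 hw
    exact ⟨e', he'.1, he'.2, hg.2 ⟨Or.inr (hlt e' he'.1 he'.2), rfl⟩⟩
  exact key D hD (fun _ h => h) main

/-! ### Gödel's well-ordering of pairs -/

/-- `max a b < max c d`, for ordinals. -/
def MaxLt (a b c d : ZFSet.{u}) : Prop := (a ∈ c ∨ a ∈ d) ∧ (b ∈ c ∨ b ∈ d)

/-- Gödel's well-ordering of pairs of ordinals. -/
def GodelLt (a b c d : ZFSet.{u}) : Prop :=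
  MaxLt a b c d ∨ (¬ MaxLt c d a b ∧ (a ∈ c ∨ (a = c ∧ b ∈ d)))

/-- Gödel's well-ordering of `X × X`, as a set of pairs. -/
def godel (X : ZFSet.{u}) : ZFSet.{u} :=
  ZFSet.sep (fun t => ∃ q ∈ X.prod X, ∃ r ∈ X.prod X, t = ZFSet.pair q r ∧
    ∃ a ∈ X, ∃ b ∈ X, q = ZFSet.pair a b ∧ ∃ c ∈ X, ∃ d ∈ X, r = ZFSet.pair c d ∧ GodelLt a b c d)
    ((X.prod X).prod (X.prod X))

theorem pair_mem_godel {X q r : ZFSet.{u}} : ZFSet.pair q r ∈ godel X ↔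
    ∃ a ∈ X, ∃ b ∈ X, q = ZFSet.pair a b ∧ ∃ c ∈ X, ∃ d ∈ X, r = ZFSet.pair c d ∧
      GodelLt a b c d := by
  rw [godel, ZFSet.mem_sep]
  constructor
  · rintro ⟨-, q', -, r', -, h, h'⟩
    obtain ⟨rfl, rfl⟩ := ZFSet.pair_inj.1 h
    exact h'
  · rintro ⟨a, ha, b, hb, rfl, c, hc, d, hd, rfl, h⟩
    have hq := ZFSet.pair_mem_prod.2 ⟨ha, hb⟩
    have hr := ZFSet.pair_mem_prod.2 ⟨hc, hd⟩
    exact ⟨ZFSet.pair_mem_prod.2 ⟨hq, hr⟩, _, hq, _, hr, rfl, a, ha, b, hb, rfl, c, hc, d, hd,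
      rfl, h⟩

theorem pair_pair_mem_godel {X a b c d : ZFSet.{u}} (ha : a ∈ X) (hb : b ∈ X) (hc : c ∈ X)
    (hd : d ∈ X) :
    ZFSet.pair (ZFSet.pair a b) (ZFSet.pair c d) ∈ godel X ↔ GodelLt a b c d := by
  rw [pair_mem_godel]
  constructor
  · rintro ⟨a', -, b', -, h, c', -, d', -, h', h''⟩
    obtain ⟨rfl, rfl⟩ := ZFSet.pair_inj.1 h
    obtain ⟨rfl, rfl⟩ := ZFSet.pair_inj.1 h'
    exact h''
  · exact fun h => ⟨a, ha, b, hb, rfl, c, hc, d, hd, rfl, h⟩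

theorem ModelsZFCMinus.godel_mem {M X : ZFSet.{u}} (h : ModelsZFCMinus M) (hM : M.IsTransitive)
    (hX : X ∈ M) : godel X ∈ M := by
  have hXX := h.prod_mem hM hX hX
  refine h.sep_mem hM (n := 2) (p := ![X, X.prod X]) (K := fun _ v t =>
    ∃ q ∈ v 1, ∃ r ∈ v 1, t = ZFSet.pair q r ∧ ∃ a ∈ v 0, ∃ b ∈ v 0, q = ZFSet.pair a b ∧
      ∃ c ∈ v 0, ∃ d ∈ v 0, r = ZFSet.pair c d ∧ GodelLt a b c d) ?_ (by
        intro i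
        fin_cases i
        · exact hX
        · exact hXX) (h.prod_mem hM hXX hXX)
  unfold GodelLt MaxLt
  refine Dfn.bex ⟨1, fun _ => rfl⟩ (Dfn.bex ⟨1, fun _ => rfl⟩ (Dfn.and (Dfn.pair_eq
    isVar_last.init.init isVar_last.init isVar_last) (Dfn.bex ⟨0, fun _ => rfl⟩ (Dfn.bex
    ⟨0, fun _ => rfl⟩ (Dfn.and (Dfn.pair_eq isVar_last.init.init.init isVar_last.init isVar_last)
    (Dfn.bex ⟨0, fun _ => rfl⟩ (Dfn.bex ⟨0, fun _ => rfl⟩ (Dfn.and (Dfn.pair_eq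
    isVar_last.init.init.init.init isVar_last.init isVar_last) ?_))))))))
  have a := (isVar_last.{u} (n := 5)).init.init.init
  have b := (isVar_last.{u} (n := 6)).init.init
  have c := (isVar_last.{u} (n := 7)).init
  have d := isVar_last.{u} (n := 8)
  exact Dfn.or (Dfn.and (Dfn.or (Dfn.mem a c) (Dfn.mem a d)) (Dfn.or (Dfn.mem b c) (Dfn.mem b d)))
    (Dfn.and (Dfn.not (Dfn.and (Dfn.or (Dfn.mem c a) (Dfn.mem c b))
      (Dfn.or (Dfn.mem d a) (Dfn.mem d b)))) (Dfn.or (Dfn.mem a c)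
        (Dfn.and (Dfn.eq a c) (Dfn.mem b d))))

/-- The key by which Gödel's well-ordering compares pairs. -/
noncomputable def godelKey (a b : ZFSet.{u}) : Ordinal.{u} ×ₗ (Ordinal.{u} ×ₗ Ordinal.{u}) :=
  toLex (max a.rank b.rank, toLex (a.rank, b.rank))

theorem mem_iff_rank_lt {a b : ZFSet.{u}} (ha : a.IsOrdinal) (hb : b.IsOrdinal) :
    a ∈ b ↔ a.rank < b.rank := by
  obtain ⟨o, rfl⟩ := ZFSet.isOrdinal_iff_mem_range_toZFSet.1 ha
  obtain ⟨o', rfl⟩ := ZFSet.isOrdinal_iff_mem_range_toZFSet.1 hb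
  rw [Ordinal.toZFSet_mem_toZFSet_iff, Ordinal.rank_toZFSet, Ordinal.rank_toZFSet]

theorem eq_iff_rank_eq {a b : ZFSet.{u}} (ha : a.IsOrdinal) (hb : b.IsOrdinal) :
    a = b ↔ a.rank = b.rank := by
  obtain ⟨o, rfl⟩ := ZFSet.isOrdinal_iff_mem_range_toZFSet.1 ha
  obtain ⟨o', rfl⟩ := ZFSet.isOrdinal_iff_mem_range_toZFSet.1 hb
  rw [Ordinal.rank_toZFSet, Ordinal.rank_toZFSet]
  exact ⟨fun h => Ordinal.toZFSet_injective h, fun h => congrArg _ h⟩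

theorem godelLt_iff {a b c d : ZFSet.{u}} (ha : a.IsOrdinal) (hb : b.IsOrdinal)
    (hc : c.IsOrdinal) (hd : d.IsOrdinal) :
    GodelLt a b c d ↔ godelKey a b < godelKey c d := by
  simp only [GodelLt, MaxLt, godelKey, Prod.Lex.toLex_lt_toLex, mem_iff_rank_lt, eq_iff_rank_eq,
    ha, hb, hc, hd]
  simp only [← lt_max_iff, ← max_lt_iff]
  rcases lt_trichotomy (max a.rank b.rank) (max c.rank d.rank) with h | h | h
  · simp [h]
  · simp [h]
  · simp [h, h.not_gt, h.ne']

theorem isWO_godel (lam : Cardinal.{u}) :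
    IsWO ((cset lam).prod (cset lam)) (godel (cset lam)) := by
  have ho : ∀ {a}, a ∈ cset lam → a.IsOrdinal := fun h => isOrdinal_of_mem_cset h
  have hlt : ∀ {a b c d}, a ∈ cset lam → b ∈ cset lam → c ∈ cset lam → d ∈ cset lam →
      (ZFSet.pair (ZFSet.pair a b) (ZFSet.pair c d) ∈ godel (cset lam) ↔
        godelKey a b < godelKey c d) := fun ha hb hc hd =>
    (pair_pair_mem_godel ha hb hc hd).trans (godelLt_iff (ho ha) (ho hb) (ho hc) (ho hd))
  refine ⟨⟨fun q => ?_⟩, ?_, ?_⟩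
  · have key : ∀ k, ∀ a ∈ cset lam, ∀ b ∈ cset lam, godelKey a b = k →
        Acc (Pred ((cset lam).prod (cset lam)) (godel (cset lam))) (ZFSet.pair a b) := by
      intro k
      induction k using WellFoundedLT.induction with
      | _ k ih =>
      rintro a ha b hb rfl
      refine Acc.intro _ fun q hq => ?_
      obtain ⟨c, hc, d, hd, rfl⟩ := ZFSet.mem_prod.1 hq.1
      exact ih _ ((hlt hc hd ha hb).1 hq.2) c hc d hd rfl
    refine Acc.intro _ fun r hr => ?_
    obtain ⟨c, hc, d, hd, rfl⟩ := ZFSet.mem_prod.1 hr.1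
    exact key _ c hc d hd rfl
  · intro q hq r hr s hs h1 h2
    obtain ⟨a, ha, b, hb, rfl⟩ := ZFSet.mem_prod.1 hq
    obtain ⟨c, hc, d, hd, rfl⟩ := ZFSet.mem_prod.1 hr
    obtain ⟨e, he, f, hf, rfl⟩ := ZFSet.mem_prod.1 hs
    rw [hlt ha hb hc hd] at h1
    rw [hlt hc hd he hf] at h2
    exact (hlt ha hb he hf).2 (h1.trans h2)
  · intro q hq r hr
    obtain ⟨a, ha, b, hb, rfl⟩ := ZFSet.mem_prod.1 hq
    obtain ⟨c, hc, d, hd, rfl⟩ := ZFSet.mem_prod.1 hr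
    rw [hlt ha hb hc hd, hlt hc hd ha hb]
    rcases lt_trichotomy (godelKey a b) (godelKey c d) with h | h | h
    · exact Or.inr (Or.inl h)
    · left
      simp only [godelKey, EmbeddingLike.apply_eq_iff_eq, Prod.mk.injEq] at h
      rw [(eq_iff_rank_eq (ho ha) (ho hc)).2 h.2.1, (eq_iff_rank_eq (ho hb) (ho hd)).2 h.2.2]
    · exact Or.inr (Or.inr h)

theorem card_prod_le (a b : ZFSet.{u}) : (a.prod b).card ≤ a.card * b.card := by
  rw [card_le_iff, lift_mul]
  have e : ∀ c : ZFSet.{u}, lift.{u + 1} c.card = #(c : Set ZFSet.{u}) := fun c =>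
    (ZFSet.cardinalMk_coe_sort).symm
  rw [e, e]
  refine (mk_le_mk_of_subset (t := Set.image2 ZFSet.pair (a : Set ZFSet.{u}) b) ?_).trans
    mk_image2_le
  intro q hq
  obtain ⟨x, hx, y, hy, rfl⟩ := ZFSet.mem_prod.1 hq
  exact ⟨x, hx, y, hy, rfl⟩

/-- All predecessors of (a, b) lie in S × S, where S = (a + 1) ∪ (b + 1) has size less than λ. The
collapse is thus a pairing function λ × λ → λ that every transitive model of ZFC⁻ containing λ has
as an element. -/
theorem collapse_godel_mem {lam : Cardinal.{u}} (hl : ℵ₀ ≤ lam) {F : ZFSet.{u} → ZFSet.{u}}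
    (hF : IsCollapse ((cset lam).prod (cset lam)) (godel (cset lam)) F) :
    ∀ q ∈ (cset lam).prod (cset lam), F q ∈ cset lam := by
  intro q hq
  refine mem_cset_of_isOrdinal (hF.isOrdinal (isWO_godel lam) q hq) ?_
  obtain ⟨a, ha, b, hb, rfl⟩ := ZFSet.mem_prod.1 hq
  set S := insert a a ∪ insert b b with hS
  have hSc : S.card < lam := card_union_lt hl (card_insert_lt hl (card_lt_of_mem_cset ha))
    (card_insert_lt hl (card_lt_of_mem_cset hb))
  refine (hF.card_le (S := S.prod S) fun r hr => ?_).trans_lt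
    ((card_prod_le S S).trans_lt (mul_lt_of_lt hl hSc hSc))
  obtain ⟨c, hc, d, hd, rfl⟩ := ZFSet.mem_prod.1 hr.1
  have hlt := (pair_pair_mem_godel hc hd ha hb).1 hr.2
  have ho : ∀ {a}, a ∈ cset lam → a.IsOrdinal := fun h => isOrdinal_of_mem_cset h
  simp only [GodelLt, MaxLt, mem_iff_rank_lt, eq_iff_rank_eq, ho ha, ho hb, ho hc, ho hd] at hlt
  rw [ZFSet.pair_mem_prod]
  simp only [hS, ZFSet.mem_union, ZFSet.mem_insert_iff, mem_iff_rank_lt, eq_iff_rank_eq, ho ha,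
    ho hb, ho hc, ho hd]
  simp only [← le_iff_eq_or_lt]
  constructor
  · rcases hlt with ⟨h | h, -⟩ | ⟨-, h | h⟩
    · exact Or.inl h.le
    · exact Or.inr h.le
    · exact Or.inl h.le
    · exact Or.inl h.1.le
  · rcases hlt with ⟨-, h | h⟩ | ⟨h, -⟩
    · exact Or.inl h.le
    · exact Or.inr h.le
    · by_contra hcon
      push Not at hcon
      exact h ⟨Or.inr hcon.1, Or.inr hcon.2⟩

/-! ### Critical points -/

/-- A finite κ cannot be critical: 0 is definable, and n + 1 is definable from n, which is fixed
below the critical point. -/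
theorem WeaklyCompact.aleph0_le {κ lam : Cardinal.{u}} {W : ZFSet.{u}}
    (h : WeaklyCompact κ lam W) : ℵ₀ ≤ κ := by
  by_contra hlt
  rw [not_le, lt_aleph0] at hlt
  obtain ⟨n, rfl⟩ := hlt
  obtain ⟨M, N, hM, -, hN, -, -, hκ, -, j, ⟨-, hfix, hne⟩, -⟩ := h ∅ (ZFSet.empty_subset _)
  refine hne (ZFSet.ext fun z => ?_)
  rcases n with _ | n
  · have he : cset ((0 : ℕ) : Cardinal.{u}) = ∅ := by simp [cset]
    have := (Dfn.ball (n := 1) (K := fun _ v x => ¬ x = x) (t := fun v => v 0) ⟨0, fun _ => rfl⟩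
      (Dfn.eq isVar_last isVar_last).not).map hM hN j ![⟨_, hκ⟩]
    have h1 := this.2 fun x hx => absurd (he ▸ hx) (ZFSet.notMem_empty x)
    constructor
    · exact fun hz => absurd rfl (h1 z hz)
    · exact fun hz => absurd (he ▸ hz) (ZFSet.notMem_empty z)
  · have he : cset ((n + 1 : ℕ) : Cardinal.{u}) = insert (cset n) (cset n) := by
      rw [cset, cset, ord_natCast, ord_natCast, Nat.cast_succ]
      exact Ordinal.toZFSet_add_one _
    have hn : cset (n : Cardinal.{u}) ∈ cset ((n + 1 : ℕ) : Cardinal.{u}) := by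
      rw [he]; exact ZFSet.mem_insert_iff.2 (Or.inl rfl)
    have hnM := hM _ hκ hn
    have := (Dfn.and (n := 2) (Dfn.ball (K := fun _ v x => x = v 1 ∨ x ∈ v 1) (t := fun v => v 0)
      ⟨0, fun _ => rfl⟩ ((Dfn.eq isVar_last ⟨1, fun _ => rfl⟩).or
        (Dfn.mem isVar_last ⟨1, fun _ => rfl⟩))) (Dfn.and (Dfn.ball (K := fun _ v x => x ∈ v 0)
      (t := fun v => v 1) ⟨1, fun _ => rfl⟩ (Dfn.mem isVar_last ⟨0, fun _ => rfl⟩))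
      (Dfn.mem (s := fun v => v 1) (t := fun v => v 0) ⟨1, fun _ => rfl⟩
        ⟨0, fun _ => rfl⟩))).map hM hN j ![⟨_, hκ⟩, ⟨_, hnM⟩]
    have h1 := this.2 ⟨fun x hx => by
      rw [← ZFSet.mem_insert_iff]; exact he ▸ hx, fun x hx => by
      change x ∈ cset ((n + 1 : ℕ) : Cardinal.{u})
      rw [he]; exact ZFSet.mem_insert_iff.2 (Or.inr hx), hn⟩
    have hj : (j ⟨_, hnM⟩ : ZFSet.{u}) = cset n := hfix ⟨_, hnM⟩ hn
    change (∀ x ∈ (j ⟨_, hκ⟩ : ZFSet.{u}), x = (j ⟨_, hnM⟩ : ZFSet.{u}) ∨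
      x ∈ (j ⟨_, hnM⟩ : ZFSet.{u})) ∧ (∀ x ∈ (j ⟨_, hnM⟩ : ZFSet.{u}),
        x ∈ (j ⟨_, hκ⟩ : ZFSet.{u})) ∧ (j ⟨_, hnM⟩ : ZFSet.{u}) ∈ (j ⟨_, hκ⟩ : ZFSet.{u}) at h1
    rw [hj] at h1
    have hz : z ∈ cset ((n + 1 : ℕ) : Cardinal.{u}) ↔ z = cset n ∨ z ∈ cset n := by
      rw [he, ZFSet.mem_insert_iff]
    refine Iff.trans ?_ hz.symm
    constructor
    · exact h1.1 z
    · rintro (rfl | hz)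
      · exact h1.2.2
      · exact h1.2.1 z hz

section embedding

variable {M N : ZFSet.{u}} (j : M ↪ₑ[langSet] N)

theorem map_pair_mem (hM : M.IsTransitive) (hN : N.IsTransitive) (a b c : M) :
    ZFSet.pair (j a) (j b) ∈ (j c : ZFSet.{u}) ↔
      ZFSet.pair (a : ZFSet.{u}) b ∈ (c : ZFSet.{u}) :=
  (Dfn.pair_mem (n := 3) (t := fun v => v 0) (r := fun v => v 1) (s := fun v => v 2)
    ⟨0, fun _ => rfl⟩ ⟨1, fun _ => rfl⟩ ⟨2, fun _ => rfl⟩).map hM hN j ![a, b, c]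

theorem map_mem (hM : M.IsTransitive) (hN : N.IsTransitive) (a b : M) :
    (j a : ZFSet.{u}) ∈ (j b : ZFSet.{u}) ↔ (a : ZFSet.{u}) ∈ (b : ZFSet.{u}) :=
  (Dfn.mem (n := 2) (s := fun v => v 0) (t := fun v => v 1)
    ⟨0, fun _ => rfl⟩ ⟨1, fun _ => rfl⟩).map hM hN j ![a, b]

theorem map_pair (hM : M.IsTransitive) (hN : N.IsTransitive) (a b c : M)
    (h : (c : ZFSet.{u}) = ZFSet.pair a b) : (j c : ZFSet.{u}) = ZFSet.pair (j a) (j b) :=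
  ((Dfn.pair_eq (n := 3) (s := fun v => v 2) (t := fun v => v 0) (r := fun v => v 1)
    ⟨2, fun _ => rfl⟩ ⟨0, fun _ => rfl⟩ ⟨1, fun _ => rfl⟩).map hM hN j ![a, b, c]).2 h

/-- Elementary embeddings with critical point `κ` act pointwise on sets of size less than `κ`
well-ordered in the domain. -/
theorem exists_eq_of_mem_map (hM : M.IsTransitive) (hN : N.IsTransitive) (h : ModelsZFCMinus M)
    {κ : Cardinal.{u}} {hκ : cset κ ∈ M} (hj : IsCriticalPoint j ⟨cset κ, hκ⟩) {c R : ZFSet.{u}}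
    (hc : c ∈ M) (hR : R ∈ M) (hwo : IsWO c R) (hcard : c.card < κ) {q : ZFSet.{u}}
    (hq : q ∈ (j ⟨c, hc⟩ : ZFSet.{u})) : ∃ q₀ : M, (q₀ : ZFSet.{u}) ∈ c ∧ (j q₀ : ZFSet.{u}) = q := by
  obtain ⟨F, hF⟩ := hwo.exists_isCollapse
  -- M contains a bijection of c with an ordinal α < κ. All ordinals up to α are fixed by j, so
  -- every element of j(c) is matched with some i < α and is the image of the element of c matched
  -- with i.
  obtain ⟨hα, hG⟩ := h.graph_collapse_mem hM hc hR hwo hF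
  set α := img F c with hαdef
  set G := graph c F with hGdef
  have hακ : α ∈ cset κ := mem_cset_of_isOrdinal (hF.isOrdinal_img hwo)
    ((card_img_le F c).trans_lt hcard)
  have hjα : (j ⟨α, hα⟩ : ZFSet.{u}) = α := hj.2.1 ⟨α, hα⟩ hακ
  have h1 := ((Dfn.ball (n := 3) (t := fun v => v 0)
    (K := fun _ v q => ∃ i ∈ v 1, ZFSet.pair q i ∈ v 2) ⟨0, fun _ => rfl⟩
    (Dfn.bex ⟨1, fun _ => rfl⟩ (Dfn.pair_mem isVar_last.init isVar_last
      ⟨2, fun _ => rfl⟩))).map hM hN j ![⟨c, hc⟩, ⟨α, hα⟩, ⟨G, hG⟩]).2 fun q hq =>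
        ⟨F q, mem_img_of_mem hq, pair_mem_graph.2 ⟨hq, rfl⟩⟩
  have h2 := ((Dfn.ball (n := 3) (t := fun v => v 0)
    (K := fun _ v q => ∀ q' ∈ v 0, ∀ i ∈ v 1, ZFSet.pair q i ∈ v 2 → ZFSet.pair q' i ∈ v 2 →
      q = q') ⟨0, fun _ => rfl⟩ (Dfn.ball ⟨0, fun _ => rfl⟩ (Dfn.ball ⟨1, fun _ => rfl⟩
      ((Dfn.pair_mem isVar_last.init.init isVar_last ⟨2, fun _ => rfl⟩).imp
        ((Dfn.pair_mem isVar_last.init isVar_last ⟨2, fun _ => rfl⟩).imp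
          (Dfn.eq isVar_last.init.init isVar_last.init)))))).map hM hN j
            ![⟨c, hc⟩, ⟨α, hα⟩, ⟨G, hG⟩]).2 (by
        intro q hq q' hq' i _ h h'
        have h := (pair_mem_graph.1 h).2
        have h' := (pair_mem_graph.1 h').2
        exact hF.inj hwo hq hq' (h.symm.trans h'))
  obtain ⟨i, hi, hqi⟩ := h1 q hq
  have hi' : i ∈ α := by rw [← hjα]; exact hi
  obtain ⟨q₀, hq₀, rfl⟩ := mem_img.1 hi'
  have hq₀M := hM _ hc hq₀
  have hiM := hM _ hα hi'
  have hji : (j ⟨F q₀, hiM⟩ : ZFSet.{u}) = F q₀ := hj.2.1 ⟨F q₀, hiM⟩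
    (subset_cset_of_mem hακ hi')
  refine ⟨⟨q₀, hq₀M⟩, hq₀, h2 _ ((map_mem j hM hN _ ⟨c, hc⟩).2 hq₀) q hq (F q₀) hi ?_ hqi⟩
  have := (map_pair_mem j hM hN ⟨q₀, hq₀M⟩ ⟨F q₀, hiM⟩ ⟨G, hG⟩).2 (pair_mem_graph.2 ⟨hq₀, rfl⟩)
  rwa [hji] at this

end embedding

/-! ### Weak compactness gives threads. -/

theorem vec_mem_two {M a b : ZFSet.{u}} (ha : a ∈ M) (hb : b ∈ M) :
    ∀ i, (![a, b] : Fin 2 → ZFSet.{u}) i ∈ M := by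
  intro i
  fin_cases i <;> assumption

/-- Code g and all small subsets of λ × λ into one A ⊆ λ. In M this yields the relation T of pairs
(x, (i, g i x)). In N, j(T) assigns to s = j''λ and j(i) an element of s, which must be j(f i) for
some f i ∈ λ; this f is the thread. -/
theorem Threadable.of_weaklyCompact {κ lam : Cardinal.{u}} {W : ZFSet.{u}} (hle : κ ≤ lam)
    (hpow : lam ^< κ ≤ lam) (hκ : ℵ₀ ≤ κ) (hW : W ⊆ Pk κ (cset lam))
    (h : WeaklyCompact κ lam W) : Threadable κ lam W := by
  intro g hg
  have hl : ℵ₀ ≤ lam := hκ.trans hle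
  set L := cset lam with hL
  have hWL : ∀ {x a}, x ∈ W → a ∈ x → a ∈ L := fun hx ha => (mem_Pk.1 (hW hx)).1 ha
  obtain ⟨p, hp⟩ := (isWO_godel lam).exists_isCollapse
  have hpL := collapse_godel_mem hl hp
  have hpinj : ∀ {q r}, q ∈ L.prod L → r ∈ L.prod L → p q = p r → q = r := fun hq hr =>
    hp.inj (isWO_godel lam) hq hr
  have hpair : ∀ {a b}, a ∈ L → b ∈ L → ZFSet.pair a b ∈ L.prod L := fun ha hb =>
    ZFSet.pair_mem_prod.2 ⟨ha, hb⟩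
  have hppair : ∀ {a b}, a ∈ L → b ∈ L → p (ZFSet.pair a b) ∈ L := fun ha hb =>
    hpL _ (hpair ha hb)
  have hppinj : ∀ {a b c d}, a ∈ L → b ∈ L → c ∈ L → d ∈ L →
      p (ZFSet.pair a b) = p (ZFSet.pair c d) → a = c ∧ b = d := fun ha hb hc hd h =>
    ZFSet.pair_inj.1 (hpinj (hpair ha hb) (hpair hc hd) h)
  have hLLc : (L.prod L).card ≤ lam := (card_prod_le L L).trans (by
    rw [hL, card_cset]; exact (mul_eq_self hl).le)
  -- the subsets of `λ` to be coded by one set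
  obtain ⟨c, hcinj, hcL⟩ := exists_code (s := (W : Set ZFSet.{u})) (card_le_iff.1
    ((ZFSet.card_mono hW).trans (card_Pk_le hle hl hpow (card_cset lam).le)))
  -- With a code c x < λ for each x ∈ W, the set `D1` records membership in x and `D2` records the
  -- function i ↦ g i x, both as subsets of λ.
  let D1 : ZFSet.{u} := ZFSet.sep (fun t => ∃ x ∈ W, ∃ a ∈ x, t = p (ZFSet.pair (c x) a)) L
  let D2 : ZFSet.{u} := ZFSet.sep (fun t => ∃ x ∈ W, ∃ i ∈ x,
    t = p (ZFSet.pair (c x) (p (ZFSet.pair i (g i x))))) L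
  have hD1 : ∀ {x a}, x ∈ W → a ∈ L → (p (ZFSet.pair (c x) a) ∈ D1 ↔ a ∈ x) := by
    intro x a hx ha
    constructor
    · intro h
      obtain ⟨x', hx', a', ha', he⟩ := (ZFSet.mem_sep.1 h).2
      obtain ⟨h1, rfl⟩ := hppinj (hcL x hx) ha (hcL x' hx') (hWL hx' ha') he
      rw [hcinj hx hx' h1]
      exact ha'
    · exact fun h => ZFSet.mem_sep.2 ⟨hppair (hcL x hx) ha, x, hx, a, h, rfl⟩
  obtain ⟨e, -, he⟩ := exists_enum (lam := lam)
    (s := {D1} ∪ ({D2} ∪ img p '' (Pk κ (L.prod L) : Set ZFSet.{u})))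
    (mk_union_le_lift hl (mk_le_lift_of_countable hl (Set.countable_singleton _))
      (mk_union_le_lift hl (mk_le_lift_of_countable hl (Set.countable_singleton _))
        (mk_image_le.trans (card_le_iff.1 (card_Pk_le hle hl hpow hLLc)))))
    ⟨D1, Or.inl rfl⟩
  -- The ξ-th section of A is the ξ-th of the at most λ subsets of λ to be put into M. Decoding
  -- needs only the pairing function, which M computes.
  let A : ZFSet.{u} := ZFSet.sep (fun t => ∃ ξ ∈ L, ∃ b ∈ L, b ∈ e ξ ∧ t = p (ZFSet.pair ξ b)) L
  have hA : ∀ {ξ b}, ξ ∈ L → b ∈ L → (p (ZFSet.pair ξ b) ∈ A ↔ b ∈ e ξ) := by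
    intro ξ b hξ hb
    constructor
    · intro h
      obtain ⟨ξ', hξ', b', hb', h', h''⟩ := (ZFSet.mem_sep.1 h).2
      obtain ⟨rfl, rfl⟩ := hppinj hξ hb hξ' hb' h''
      exact h'
    · exact fun h => ZFSet.mem_sep.2 ⟨hppair hξ hb, ξ, hξ, b, hb, h, rfl⟩
  obtain ⟨M, N, hM, hZ, hN, hLM, hAM, hκM, hWM, j, hj, -, s, hsW, hs⟩ :=
    h A fun t ht => (ZFSet.mem_sep.1 ht).1
  have hLL := hZ.prod_mem hM hLM hLM
  have hE := hZ.godel_mem hM hLM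
  set P := graph (L.prod L) p with hP
  have hPM : P ∈ M := (hZ.graph_collapse_mem hM hLL hE (isWO_godel lam) hp).2
  have hPiff : ∀ {q t}, q ∈ L.prod L → (ZFSet.pair q t ∈ P ↔ t = p q) := fun hq => by
    rw [hP, pair_mem_graph]
    exact ⟨fun h => h.2, fun h => ⟨hq, h⟩⟩
  have hcode : ∀ {S : ZFSet.{u}}, S ⊆ L →
      S ∈ ({D1} ∪ ({D2} ∪ img p '' (Pk κ (L.prod L) : Set ZFSet.{u})) : Set ZFSet.{u}) →
      S ∈ M := by
    intro S hSL hS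
    obtain ⟨ξ, hξ, rfl⟩ := he S hS
    convert hZ.sep_mem hM (n := 4) (p := ![ξ, A, P, L.prod L]) (K := fun _ v b =>
      ∃ t ∈ v 1, ∃ q ∈ v 3, q = ZFSet.pair (v 0) b ∧ ZFSet.pair q t ∈ v 2)
      (Dfn.bex ⟨1, fun _ => rfl⟩ (Dfn.bex ⟨3, fun _ => rfl⟩ (Dfn.and
        (Dfn.pair_eq isVar_last ⟨0, fun _ => rfl⟩ isVar_last.init.init)
        (Dfn.pair_mem isVar_last isVar_last.init ⟨2, fun _ => rfl⟩)))) (by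
        intro i
        fin_cases i
        · exact hM _ hLM hξ
        · exact hAM
        · exact hPM
        · exact hLL) hLM using 1
    ext b
    rw [ZFSet.mem_sep]
    constructor
    · intro hb
      exact ⟨hSL hb, _, (hA hξ (hSL hb)).2 hb, _, hpair hξ (hSL hb), rfl,
        (hPiff (hpair hξ (hSL hb))).2 rfl⟩
    · rintro ⟨hb, t, ht, q, -, rfl, hqt⟩
      rw [← hA hξ hb, ← (hPiff (hpair hξ hb)).1 hqt]
      exact ht
  have hD1M : D1 ∈ M := hcode (fun t ht => (ZFSet.mem_sep.1 ht).1) (Or.inl rfl)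
  have hD2M : D2 ∈ M := hcode (fun t ht => (ZFSet.mem_sep.1 ht).1) (Or.inr (Or.inl rfl))
  have hsmall : ∀ {z}, z ∈ Pk κ (L.prod L) → z ∈ M := by
    intro z hz
    have hzL := (mem_Pk.1 hz).1
    have hi : img p z ∈ M := hcode (fun t ht => by
      obtain ⟨q, hq, rfl⟩ := mem_img.1 ht
      exact hpL q (hzL hq)) (Or.inr (Or.inr ⟨z, hz, rfl⟩))
    convert hZ.sep_mem hM (n := 2) (p := ![img p z, P]) (K := fun _ v q =>
      ∃ t ∈ v 0, ZFSet.pair q t ∈ v 1) (Dfn.bex ⟨0, fun _ => rfl⟩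
        (Dfn.pair_mem isVar_last.init isVar_last ⟨1, fun _ => rfl⟩)) (vec_mem_two hi hPM) hLL
          using 1
    ext q
    rw [ZFSet.mem_sep]
    constructor
    · exact fun hq => ⟨hzL hq, p q, mem_img_of_mem hq, (hPiff (hzL hq)).2 rfl⟩
    · rintro ⟨hq, t, ht, hqt⟩
      have ht : t ∈ img p z := ht
      have hqt : t = p q := (hPiff hq).1 hqt
      obtain ⟨q', hq', hqq⟩ := mem_img.1 ht
      rwa [← hpinj (hzL hq') hq (hqq.trans hqt)]
  -- the functions `i ↦ g i x`, for `x ∈ W`, as a set of pairs `(x, (i, g i x))`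
  obtain ⟨T, hTM, hT⟩ : ∃ T ∈ M, ∀ x q, ZFSet.pair x q ∈ T ↔
      x ∈ W ∧ ∃ i ∈ x, q = ZFSet.pair i (g i x) := by
    refine ⟨_, hZ.sep_mem hM (n := 6) (p := ![W, L.prod L, L, P, D1, D2]) (K := fun _ v t =>
      ∃ x ∈ v 0, ∃ q ∈ v 1, t = ZFSet.pair x q ∧ ∃ ξ ∈ v 2, ∃ b ∈ v 2, ZFSet.pair q b ∈ v 3 ∧
        (∃ t' ∈ v 5, ∃ r ∈ v 1, r = ZFSet.pair ξ b ∧ ZFSet.pair r t' ∈ v 3) ∧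
        ∀ a ∈ v 2, a ∈ x ↔ ∃ t' ∈ v 4, ∃ r ∈ v 1, r = ZFSet.pair ξ a ∧ ZFSet.pair r t' ∈ v 3)
      (Dfn.bex ⟨0, fun _ => rfl⟩ (Dfn.bex ⟨1, fun _ => rfl⟩ (Dfn.and
        (Dfn.pair_eq isVar_last.init.init isVar_last.init isVar_last)
        (Dfn.bex ⟨2, fun _ => rfl⟩ (Dfn.bex ⟨2, fun _ => rfl⟩ (Dfn.and
          (Dfn.pair_mem isVar_last.init.init isVar_last ⟨3, fun _ => rfl⟩)
          (Dfn.and (Dfn.bex ⟨5, fun _ => rfl⟩ (Dfn.bex ⟨1, fun _ => rfl⟩ (Dfn.and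
            (Dfn.pair_eq isVar_last isVar_last.init.init.init isVar_last.init.init)
            (Dfn.pair_mem isVar_last isVar_last.init ⟨3, fun _ => rfl⟩))))
          (Dfn.ball ⟨2, fun _ => rfl⟩ (Dfn.iff
            (Dfn.mem isVar_last isVar_last.init.init.init.init)
            (Dfn.bex ⟨4, fun _ => rfl⟩ (Dfn.bex ⟨1, fun _ => rfl⟩ (Dfn.and
              (Dfn.pair_eq isVar_last isVar_last.init.init.init.init isVar_last.init.init)
              (Dfn.pair_mem isVar_last isVar_last.init ⟨3, fun _ => rfl⟩)))))))))))))
      (by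
        intro i
        fin_cases i
        · exact hWM
        · exact hLL
        · exact hLM
        · exact hPM
        · exact hD1M
        · exact hD2M) (hZ.prod_mem hM hWM hLL), fun x q => ?_⟩
    rw [ZFSet.mem_sep, ZFSet.pair_mem_prod]
    change (x ∈ W ∧ q ∈ L.prod L) ∧ (∃ x' ∈ W, ∃ q' ∈ L.prod L, ZFSet.pair x q = ZFSet.pair x' q' ∧
      ∃ ξ ∈ L, ∃ b ∈ L, ZFSet.pair q' b ∈ P ∧
        (∃ t' ∈ D2, ∃ r ∈ L.prod L, r = ZFSet.pair ξ b ∧ ZFSet.pair r t' ∈ P) ∧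
        ∀ a ∈ L, a ∈ x' ↔ ∃ t' ∈ D1, ∃ r ∈ L.prod L, r = ZFSet.pair ξ a ∧ ZFSet.pair r t' ∈ P) ↔ _
    constructor
    · rintro ⟨-, x', hx', q', hq', hxq, ξ, hξ, b, hb, hqb, ⟨t, ht, r, hr, rfl, hrt⟩, hall⟩
      obtain ⟨rfl, rfl⟩ := ZFSet.pair_inj.1 hxq
      rw [hPiff hq'] at hqb
      rw [hPiff hr] at hrt
      subst hqb hrt
      obtain ⟨y, hy, i, hi, hti⟩ := (ZFSet.mem_sep.1 ht).2
      have hiL := hWL hy hi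
      have hgL := hWL hy (hg y hy i hi)
      obtain ⟨rfl, hq⟩ := hppinj hξ hb (hcL y hy) (hppair hiL hgL) hti
      have hq := hpinj hq' (hpair hiL hgL) hq
      -- The code ξ belongs to some y ∈ W, and the last condition says that `D1` lists the elements
      -- of x under ξ, so x is y.
      have hxy : x = y := by
        ext a
        constructor
        · intro ha
          obtain ⟨t', ht', r, hr, rfl, hrt⟩ := (hall a (hWL hx' ha)).1 ha
          rw [hPiff hr] at hrt
          subst hrt
          exact (hD1 hy (hWL hx' ha)).1 ht'
        · intro ha
          have haL := hWL hy ha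
          exact (hall a haL).2 ⟨_, (hD1 hy haL).2 ha, _, hpair hξ haL, rfl,
            (hPiff (hpair hξ haL)).2 rfl⟩
      subst hxy
      exact ⟨hx', i, hi, hq⟩
    · rintro ⟨hx, i, hi, rfl⟩
      have hiL := hWL hx hi
      have hgL := hWL hx (hg x hx i hi)
      have hq := hpair hiL hgL
      have hξb := hpair (hcL x hx) (hpL _ hq)
      refine ⟨⟨hx, hq⟩, x, hx, _, hq, rfl, c x, hcL x hx, _, hpL _ hq, (hPiff hq).2 rfl,
        ⟨_, ZFSet.mem_sep.2 ⟨hpL _ hξb, x, hx, i, hi, rfl⟩, _, hξb, rfl, (hPiff hξb).2 rfl⟩,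
        fun a ha => ?_⟩
      have hξa := hpair (hcL x hx) ha
      rw [← hD1 hx ha]
      constructor
      · exact fun h => ⟨_, h, _, hξa, rfl, (hPiff hξa).2 rfl⟩
      · rintro ⟨t, ht, r, hr, rfl, hrt⟩
        rw [hPiff hr] at hrt
        rwa [← hrt]
  -- the thread, read off at `s = j''λ`
  have h1 := ((Dfn.ball (n := 3) (t := fun v => v 0) (K := fun _ v x => ∀ i ∈ x, ∃ η ∈ x,
    ∃ q ∈ v 1, q = ZFSet.pair i η ∧ ZFSet.pair x q ∈ v 2) ⟨0, fun _ => rfl⟩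
    (Dfn.ball isVar_last (Dfn.bex isVar_last.init (Dfn.bex ⟨1, fun _ => rfl⟩ (Dfn.and
      (Dfn.pair_eq isVar_last isVar_last.init.init isVar_last.init)
      (Dfn.pair_mem isVar_last.init.init.init isVar_last ⟨2, fun _ => rfl⟩)))))).map hM hN j
        ![⟨W, hWM⟩, ⟨L.prod L, hLL⟩, ⟨T, hTM⟩]).2 (by
      intro x hx i hi
      have hx : x ∈ W := hx
      exact ⟨g i x, hg x hx i hi, _, hpair (hWL hx hi) (hWL hx (hg x hx i hi)), rfl,
        (hT x _).2 ⟨hx, i, hi, rfl⟩⟩)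
  have hf : ∀ i ∈ L, ∃ η, ∃ _ : η ∈ L, ∀ i' η' : M, (i' : ZFSet.{u}) = i →
      (η' : ZFSet.{u}) = η → ZFSet.pair s (ZFSet.pair (j i') (j η')) ∈ (j ⟨T, hTM⟩ : ZFSet.{u}) := by
    intro i hi
    have hiM := hM _ hLM hi
    obtain ⟨η, hη, q, -, rfl, hq⟩ := h1 s hsW (j ⟨i, hiM⟩) ((hs _).2 ⟨⟨i, hiM⟩, hi, rfl⟩)
    obtain ⟨η', hη', rfl⟩ := (hs _).1 hη
    refine ⟨η', hη', fun i₁ η₁ hi₁ hη₁ => ?_⟩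
    obtain rfl : i₁ = ⟨i, hiM⟩ := Subtype.ext hi₁
    obtain rfl : η₁ = η' := Subtype.ext hη₁
    exact hq
  choose! f hfL hf using hf
  refine ⟨f, fun z hz => ?_⟩
  have hzL := (mem_Pk.1 hz).1
  have hgrL : graph z f ⊆ L.prod L := fun q hq => by
    obtain ⟨i, hi, rfl⟩ := mem_img.1 hq
    exact hpair (hzL hi) (hfL i (hzL hi))
  have hgrc : (graph z f).card < κ := (card_img_le _ z).trans_lt (mem_Pk.1 hz).2
  have hgrM := hsmall (mem_Pk.2 ⟨hgrL, hgrc⟩)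
  -- The graph of f on z has size less than κ, so j maps it pointwise. Hence s ∈ j(W) realizes all
  -- of j(graph) in j(T), and elementarity finds x ∈ W realizing the graph in T.
  have h2 := ((Dfn.bex (n := 3) (t := fun v => v 0) (K := fun _ v x => ∀ q ∈ v 1,
    ZFSet.pair x q ∈ v 2) ⟨0, fun _ => rfl⟩ (Dfn.ball ⟨1, fun _ => rfl⟩
      (Dfn.pair_mem isVar_last.init isVar_last ⟨2, fun _ => rfl⟩))).map hM hN j
        ![⟨W, hWM⟩, ⟨graph z f, hgrM⟩, ⟨T, hTM⟩]).1 ⟨s, hsW, fun q hq => by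
    obtain ⟨q₀, hq₀, rfl⟩ := exists_eq_of_mem_map j hM hN hZ hj hgrM hE
      ((isWO_godel lam).mono hgrL) hgrc hq
    obtain ⟨i, hi, hiq⟩ := mem_img.1 hq₀
    have hiM := hM _ hLM (hzL hi)
    have hfM := hM _ hLM (hfL i (hzL hi))
    rw [map_pair j hM hN ⟨i, hiM⟩ ⟨f i, hfM⟩ q₀ hiq.symm]
    exact hf i (hzL hi) ⟨i, hiM⟩ ⟨f i, hfM⟩ rfl rfl⟩
  obtain ⟨x, hx, hxq⟩ := h2
  have key : ∀ i ∈ z, i ∈ x ∧ g i x = f i := by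
    intro i hi
    obtain ⟨-, i', hi', he⟩ := (hT x _).1 (hxq (ZFSet.pair i (f i)) (mem_img_of_mem
      (f := fun i => ZFSet.pair i (f i)) hi))
    obtain ⟨rfl, he⟩ := ZFSet.pair_inj.1 he
    exact ⟨hi', he.symm⟩
  exact ⟨x, hx, fun i hi => (key i hi).1, fun i hi => (key i hi).2⟩

end TwoCardinal

/-! ### The equivalence. -/

open TwoCardinal
theorem theorem1p3 (κ lam : Cardinal.{u}) (hle : κ ≤ lam) (hpow : lam ^< κ = lam)
    (hwc : WeaklyCompact κ lam (Pk κ (cset lam)))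
    (W : ZFSet.{u}) (hW : W ⊆ Pk κ (cset lam)) :
    List.TFAE
      [PiOneOneIndescribable κ lam W,
       WeaklyCompact κ lam W,
       ∀ C : ZFSet.{u}, OneClub κ lam C → (C ∩ W).Nonempty] := by
  -- Extracting threads from weak compactness needs κ only infinite, so inaccessibility can be
  -- derived from threads on P_κ λ without circularity.
  have hκ := hwc.aleph0_le
  have hP := Threadable.of_weaklyCompact hle hpow.le hκ (fun _ h => h) hwc
  have hin := hP.isInaccessible hle hκ
  tfae_have 1 → 2 := fun h =>
    (Threadable.of_indescribable hle hin hW h).weaklyCompact hle hpow.le hin hW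
  tfae_have 2 → 3 := fun h C hC =>
    (Threadable.of_weaklyCompact hle hpow.le hκ hW h).inter_nonempty hle hpow.le hin hW hC
  tfae_have 3 → 1 := fun h =>
    (threadable_of_inter_nonempty hle hin hP h).indescribable hle hpow.le hin hW
  tfae_finish
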